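/- Let $\alpha\in(\tfrac12,1)$, $\sigma\ge 0$, $\lambda\in\{1,-1\}$, $a<b$, let $N$ be a positive even integer, $\mu=\frac{2\pi}{b-a}$, $h=\frac{b-a}{N}$ and $x_j=a+jh$ for $0\le j\le N-1$. Let $D_1^\alpha$ be the $N\times N$ Fourier pseudospectral matrix $$(D_1^\alpha)_{j,l}=\sum_{k=-N/2}^{N/2}\frac1{Nc_k}\,ik\mu\,|k\mu|^{\alpha-1}e^{ik\mu(x_j-x_l)},\qquad c_k=1\ \text{for } |k|<\tfrac N2,\quad c_{\pm N/2}=2$$ (the term $k=0$ is $0$), which has real entries. On a probability space $(\Omega,\mathcal F,\mathbb P)$ with a filtration $(\mathcal F_t)_{t\ge0}$ let $(\beta_k)_{k\ge1}$ be independent $(\mathcal F_t)$-Brownian motions, let $\varphi_k$ be real functions with $\sum_k\varphi_k(x)^2<\infty$ for $x\in[a,b]$, and let $W(t,x)=\sum_k\beta_k(t)\varphi_k(x)$ (limit in probability), in an adapted version that is continuous in $t$. Consider, for $0\le j\le N-1$, the semi-discrete Stratonovich system $$\begin{aligned} dp_j+(D_1^\alpha\mathbf w)_j\,dt-\lambda(p_j^2+q_j^2)^\sigma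 q_j\,dt-q_j\circ dW(t,x_j)&=0,\\ dq_j-(D_1^\alpha\mathbf v)_j\,dt+\lambda(p_j^2+q_j^2)^\sigma p_j\,dt+p_j\circ dW(t,x_j)&=0,\\ (D_1^\alpha\mathbf p)_j=v_j,\qquad (D_1^\alpha\mathbf q)_j&=w_j. \end{aligned}$$ Here $\int X\circ dW=\int X\,dW+\frac12[X,W]$, where the Itô integral of a continuous adapted integrand and the covariation $[X,W]$ (a continuous process of locally bounded variation) are limits in probability of the corresponding sums over partitions with mesh tending to $0$. Let $z_j=(p_j,q_j,v_j,w_j)^T$ be the phase flow of this system: for every initial datum $y=(\mathbf p(0),\mathbf q(0))\in\mathbb R^{2N}$ a continuous adapted solution that starts from $y$, in a version that is almost surely continuous in $y$ for every $t$. Denote by $d$ the differential with respect to the initial datum $y$ and put $$\Psi_j=\tfrac12\,dz_j\wedge\mathbf M\,dz_j,\qquad d\tilde{\mathcal G}z_j=\sum_{k=0}^{N-1}(D_1^\alpha)_{j,k}\,dz_k,$$ $$\mathbf M=\begin{pmatrix}0&1&0&0\\-1&0&0&0\\0&0&0&0\\0&0&0&0\end{pmatrix},\qquad \mathbf K=\begin{pmatrix}0&0&-1&0\\0&0&0&-1\\1&0&0&0\\0&1&0&0\end{pmatrix}.$$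 Then $D_1^\alpha$ is skew-symmetric, and almost surely the following holds: for every $t\ge0$ the map $y\mapsto z(t)$ is differentiable, and for all $t\ge0$ and at every initial datum $$\frac{d}{dt}\Psi_j+dz_j\wedge\mathbf K\,d\tilde{\mathcal G}z_j=0,\qquad 0\le j\le N-1$$ (the time derivative at $t=0$ is one-sided), and the global symplectic form is conserved: $\frac{d}{dt}\sum_{j=0}^{N-1}\Psi_j=0$, so that $\sum_j\Psi_j(t)=\sum_j\Psi_j(0)$. -/

import Mathlib

open MeasureTheory ProbabilityTheory Filter Topology
open scoped NNReal ENNReal Matrix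

namespace StochFracNLS

noncomputable section

/-! ### The Fourier pseudospectral differentiation matrix -/

/-- The grid points `x_j = a + j h`, `h = (b - a) / N`, `0 ≤ j ≤ N - 1`. -/
def gridPoint (a b : ℝ) (N : ℕ) (j : Fin N) : ℝ := a + (j : ℝ) * ((b - a) / N)

/-- The base frequency `μ = 2π / (b - a)`. -/
def baseFreq (a b : ℝ) : ℝ := 2 * Real.pi / (b - a)

/-- `c_k = 2` for `k = ± N / 2` and `c_k = 1` for `|k| < N / 2`. -/
def modeWeight (N : ℕ) (k : ℤ) : ℝ := if 2 * |k| = (N : ℤ) then 2 else 1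

/-- The pseudospectral matrix of `𝒢̃` as the trigonometric sum
`∑_{k = -N/2}^{N/2} (N c_k)⁻¹ i k μ |k μ|^(α-1) e^{i k μ (x_j - x_l)}`. -/
def complexD1 (α a b : ℝ) (N : ℕ) : Matrix (Fin N) (Fin N) ℂ :=
  Matrix.of fun j l ↦ ∑ k ∈ Finset.Icc (-((N : ℤ) / 2)) ((N : ℤ) / 2),
    ((1 / (N * modeWeight N k) : ℝ) : ℂ) *
      (Complex.I * ((k * baseFreq a b * |k * baseFreq a b| ^ (α - 1) : ℝ) : ℂ)) *
      Complex.exp (Complex.I *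
        ((k * baseFreq a b * (gridPoint a b N j - gridPoint a b N l) : ℝ) : ℂ))

/-- The matrix `D₁^α`. The trigonometric sum has real values (`complexD1_eq_map_D1`), and this is
the sum as a real matrix. -/
def D1 (α a b : ℝ) (N : ℕ) : Matrix (Fin N) (Fin N) ℝ :=
  (complexD1 α a b N).map Complex.re

theorem complexD1_eq_map_D1 (α a b : ℝ) (N : ℕ) :
    complexD1 α a b N = (D1 α a b N).map Complex.ofReal := by
  ext j l
  simp only [D1, Matrix.map_apply]
  refine (Complex.conj_eq_iff_re.mp ?_).symm
  simp only [complexD1, Matrix.of_apply, map_sum]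
  refine Finset.sum_nbij' (fun k ↦ -k) (fun k ↦ -k) ?_ ?_ ?_ ?_ ?_
  · intro k hk
    simp only [Finset.mem_Icc] at hk ⊢
    omega
  · intro k hk
    simp only [Finset.mem_Icc] at hk ⊢
    omega
  · simp
  · simp
  · intro k _
    have h : modeWeight N (-k) = modeWeight N k := by simp [modeWeight]
    simp only [map_mul, Complex.conj_ofReal, Complex.conj_I, ← Complex.exp_conj, h]
    push_cast
    simp only [neg_mul, mul_neg, abs_neg]

/-! ### Stochastic integrals along partitions -/

/-- A finite partition `0 = τ₀ ≤ τ₁ ≤ ⋯ ≤ τ_n = t` of `[0, t]`. -/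
structure TimePartition (t : ℝ≥0) where
  n : ℕ
  pt : ℕ → ℝ≥0
  mono : Monotone pt
  pt_zero : pt 0 = 0
  pt_last : pt n = t

/-- The mesh `max_i (τ_{i+1} - τ_i)` of a partition. -/
def TimePartition.mesh {t : ℝ≥0} (π : TimePartition t) : ℝ≥0 :=
  (Finset.range π.n).sup fun i ↦ π.pt (i + 1) - π.pt i

/-- The filter "mesh of the partition of `[0, t]` tends to `0`". -/
def meshToZero (t : ℝ≥0) : Filter (TimePartition t) := comap TimePartition.mesh (𝓝 0)

variable {Ω : Type*} {mΩ : MeasurableSpace Ω}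

/-- `I` is the Itô integral process `∫₀ᵗ X dW` of the (continuous adapted) integrand `X`: for every
`t` the left-point sums over partitions of `[0, t]` converge to `I t` in probability. -/
def IsItoIntegral (P : Measure Ω) (X W I : ℝ≥0 → Ω → ℝ) : Prop :=
  ∀ t : ℝ≥0, TendstoInMeasure P
    (fun (π : TimePartition t) (ω : Ω) ↦ ∑ i ∈ Finset.range π.n,
      X (π.pt i) ω * (W (π.pt (i + 1)) ω - W (π.pt i) ω))
    (meshToZero t) (I t)

/-- `C` is the quadratic covariation `[X, W]`: a process with continuous paths of locally bounded
variation such that for every `t` the sums of products of increments over partitions of `[0, t]`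
converge to `C t` in probability. -/
def IsCovariation (P : Measure Ω) (X W C : ℝ≥0 → Ω → ℝ) : Prop :=
  (∀ᵐ ω ∂P, Continuous (fun t ↦ C t ω) ∧
    LocallyBoundedVariationOn (fun t ↦ C t ω) Set.univ) ∧
  ∀ t : ℝ≥0, TendstoInMeasure P
    (fun (π : TimePartition t) (ω : Ω) ↦ ∑ i ∈ Finset.range π.n,
      (X (π.pt (i + 1)) ω - X (π.pt i) ω) * (W (π.pt (i + 1)) ω - W (π.pt i) ω))
    (meshToZero t) (C t)

/-- `S` is the Stratonovich integral process `∫₀ᵗ X ∘ dW = ∫₀ᵗ X dW + ½ [X, W]_t`. -/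
def IsStratonovichIntegral (P : Measure Ω) (X W S : ℝ≥0 → Ω → ℝ) : Prop :=
  ∃ I C : ℝ≥0 → Ω → ℝ, IsItoIntegral P X W I ∧ IsCovariation P X W C ∧
    S = fun t ω ↦ I t ω + C t ω / 2

/-! ### The noise -/

/-- A sequence of independent Brownian motions associated with the filtration `ℱ`. -/
structure IsBrownianSequence (P : Measure Ω) (ℱ : Filtration ℝ≥0 mΩ)
    (β : ℕ → ℝ≥0 → Ω → ℝ) : Prop where
  brownian : ∀ k, IsBrownianReal (β k) P
  adapted : ∀ k, Adapted ℱ (β k)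
  indep : iIndepFun (fun k ω t ↦ β k t ω) P
  indep_past : ∀ s t, s ≤ t →
    Indep (MeasurableSpace.comap (fun ω k ↦ β k t ω - β k s ω) inferInstance) (ℱ s) P

/-- `W` is the Wiener process `W(t, x) = ∑_k β_k(t) φ_k(x)`, `x ∈ [a, b]`, with `φ_k = Φ e_k`
and `F_Φ(x) = ∑_k φ_k(x)² < ∞`, in a version that is adapted and continuous in time. -/
structure IsWienerField (P : Measure Ω) (ℱ : Filtration ℝ≥0 mΩ) (a b : ℝ)
    (β : ℕ → ℝ≥0 → Ω → ℝ) (φ : ℕ → ℝ → ℝ) (W : ℝ≥0 → ℝ → Ω → ℝ) : Prop where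
  brownian : IsBrownianSequence P ℱ β
  summable : ∀ x ∈ Set.Icc a b, Summable fun k ↦ φ k x ^ 2
  series : ∀ t, ∀ x ∈ Set.Icc a b, TendstoInMeasure P
    (fun (n : ℕ) (ω : Ω) ↦ ∑ k ∈ Finset.range n, β k t ω * φ k x) atTop (W t x)
  adapted : ∀ x ∈ Set.Icc a b, Adapted ℱ fun t ↦ W t x
  continuous : ∀ x ∈ Set.Icc a b, ∀ᵐ ω ∂P, Continuous fun t ↦ W t x ω

/-! ### The semi-discrete system and its phase flow -/

/-- The space of initial data `(p(0), q(0))`. -/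
abbrev Phase (N : ℕ) : Type := (Fin N → ℝ) × (Fin N → ℝ)

/-- `z_j = (p_j, q_j, v_j, w_j)` (components `0, 1, 2, 3`) solves the semi-discrete system
`dp_j + (D₁ w)_j dt - λ (p_j² + q_j²)^σ q_j dt - q_j ∘ dW(t, x_j) = 0`,
`dq_j - (D₁ v)_j dt + λ (p_j² + q_j²)^σ p_j dt + p_j ∘ dW(t, x_j) = 0`,
`(D₁ p)_j = v_j`, `(D₁ q)_j = w_j` with initial datum `(p, q)(0) = y`. -/
structure IsSemidiscreteSolution (P : Measure Ω) (ℱ : Filtration ℝ≥0 mΩ)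
    (W : ℝ≥0 → ℝ → Ω → ℝ) (α σ lam a b : ℝ) (N : ℕ) (y : Phase N)
    (z : ℝ≥0 → Ω → Fin N → Fin 4 → ℝ) : Prop where
  adapted : ∀ j c, Adapted ℱ fun t ω ↦ z t ω j c
  continuous : ∀ᵐ ω ∂P, Continuous fun t ↦ z t ω
  eq_p : ∀ j, ∃ S : ℝ≥0 → Ω → ℝ,
    IsStratonovichIntegral P (fun t ω ↦ z t ω j 1) (fun t ↦ W t (gridPoint a b N j)) S ∧
    ∀ᵐ ω ∂P, ∀ t : ℝ≥0, z t ω j 0 = y.1 j +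
      (∫ s in (0 : ℝ)..t,
        (-(D1 α a b N *ᵥ fun k ↦ z s.toNNReal ω k 3) j +
          lam * (z s.toNNReal ω j 0 ^ 2 + z s.toNNReal ω j 1 ^ 2) ^ σ * z s.toNNReal ω j 1)) +
      S t ω
  eq_q : ∀ j, ∃ S : ℝ≥0 → Ω → ℝ,
    IsStratonovichIntegral P (fun t ω ↦ z t ω j 0) (fun t ↦ W t (gridPoint a b N j)) S ∧
    ∀ᵐ ω ∂P, ∀ t : ℝ≥0, z t ω j 1 = y.2 j +
      (∫ s in (0 : ℝ)..t,
        ((D1 α a b N *ᵥ fun k ↦ z s.toNNReal ω k 2) j -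
          lam * (z s.toNNReal ω j 0 ^ 2 + z s.toNNReal ω j 1 ^ 2) ^ σ * z s.toNNReal ω j 0)) -
      S t ω
  eq_v : ∀ᵐ ω ∂P, ∀ t j, (D1 α a b N *ᵥ fun k ↦ z t ω k 0) j = z t ω j 2
  eq_w : ∀ᵐ ω ∂P, ∀ t j, (D1 α a b N *ᵥ fun k ↦ z t ω k 1) j = z t ω j 3

/-- `Z t ω y` is the phase flow of the semi-discrete system: for every initial datum `y` it is the
solution that starts from `y`, in a version that almost surely depends continuously on `y`. -/
structure IsPhaseFlow (P : Measure Ω) (ℱ : Filtration ℝ≥0 mΩ)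
    (W : ℝ≥0 → ℝ → Ω → ℝ) (α σ lam a b : ℝ) (N : ℕ)
    (Z : ℝ≥0 → Ω → Phase N → Fin N → Fin 4 → ℝ) : Prop where
  solution : ∀ y, IsSemidiscreteSolution P ℱ W α σ lam a b N y fun t ω ↦ Z t ω y
  continuous : ∀ᵐ ω ∂P, ∀ t, Continuous (Z t ω)

/-! ### Differential forms on the space of initial data -/

/-- The skew-symmetric matrix `𝐌`. -/
def matM : Matrix (Fin 4) (Fin 4) ℝ :=
  !![0, 1, 0, 0; -1, 0, 0, 0; 0, 0, 0, 0; 0, 0, 0, 0]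

/-- The skew-symmetric matrix `𝐊`. -/
def matK : Matrix (Fin 4) (Fin 4) ℝ :=
  !![0, 0, -1, 0; 0, 0, 0, -1; 1, 0, 0, 0; 0, 1, 0, 0]

/-- The wedge product of two covectors, as an alternating form in two tangent vectors. -/
def wedge {E : Type*} [NormedAddCommGroup E] [NormedSpace ℝ E]
    (θ ϑ : E →L[ℝ] ℝ) (ξ η : E) : ℝ := θ ξ * ϑ η - θ η * ϑ ξ

/-- `θ ∧ A ϑ = ∑_c θ_c ∧ (A ϑ)_c` for vectors `θ`, `ϑ` of covectors and a matrix `A`. -/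
def wedgeMat {E : Type*} [NormedAddCommGroup E] [NormedSpace ℝ E]
    (θ : Fin 4 → E →L[ℝ] ℝ) (A : Matrix (Fin 4) (Fin 4) ℝ) (ϑ : Fin 4 → E →L[ℝ] ℝ)
    (ξ η : E) : ℝ :=
  ∑ c, wedge (θ c) (∑ d, A c d • ϑ d) ξ η

/-- The differentials `dz_j = (dp_j, dq_j, dv_j, dw_j)` at `y` of a map `F` of the initial
datum. -/
def dz {N : ℕ} (F : Phase N → Fin N → Fin 4 → ℝ) (j : Fin N) (y : Phase N) :
    Fin 4 → Phase N →L[ℝ] ℝ :=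
  fun c ↦ fderiv ℝ (fun y' ↦ F y' j c) y

/-- `d𝒢̃z_j = ∑_k D_{j,k} dz_k`. -/
def dGz {N : ℕ} (D : Matrix (Fin N) (Fin N) ℝ) (F : Phase N → Fin N → Fin 4 → ℝ) (j : Fin N)
    (y : Phase N) : Fin 4 → Phase N →L[ℝ] ℝ :=
  fun c ↦ ∑ k, D j k • dz F k y c

/-- `Ψ_j = ½ dz_j ∧ 𝐌 dz_j`. -/
def symplForm {N : ℕ} (F : Phase N → Fin N → Fin 4 → ℝ) (j : Fin N) (y ξ η : Phase N) : ℝ :=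
  1 / 2 * wedgeMat (dz F j y) matM (dz F j y) ξ η

end

end StochFracNLS

/-! With `u_j = p_j + i q_j` the system reads `du_j = i (D²u)_j dt - i λ |u_j|^{2σ} u_j dt - i u_j ∘
dW(t, x_j)`, where `D = D₁^α`. The noise only turns the phase of `u_j`, so it can be removed. Put
`θ_j(t) = W(t, x_j) - W(0, x_j)`. By the Stratonovich chain rule `U_j = e^{iθ_j} u_j` solves, path
by path, an ordinary differential equation whose coefficients are continuous in time (`gaugeField`).
What remains is deterministic.

Since `D` is skew, `D²` is symmetric and the mass `∑ |U_j|²` is conserved (`sum_inner_gaugeField`),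
so solutions stay bounded. The field is continuously differentiable in `U`, also at zeros of `U_j`,
hence the flow is differentiable and its derivative solves the variational equation
(`hasFDerivAt_flow`). The form `Ψ_j = dp_j ∧ dq_j` is an area form in the `j`-th complex plane,
which the rotation by `θ_j` preserves, so it can be computed from `dU_j` and differentiated in time.
The nonlinearity contributes nothing because its derivative is a symmetric real-linear map; the
linear part gives `dp_j ∧ (D dv)_j + dq_j ∧ (D dw)_j` (`areaForm_gaugeFieldDeriv`). This is the
local law, since `D dp = dv` and `D dq = dw` annihilate the other terms of the `K`-form. Summation
over `j` gives zero by skewness of `D`.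

The stochastic work is the chain rule (`exp_mul_path_sub`, `ae_exp_mul_path_sub`), obtained from the
limits in probability along dyadic partitions. The only quantitative input about the noise is an
isometry inequality for elementary integrals (`IsometryBound`). It shows that the left-point errors
of the Itô integral vanish both in quadratic mean and after summation with bounded adapted weights.
The null sets are then merged: the identity holds at countably many times and for countably many
initial data, and extends by continuity (`gaugeField_solution_of_dense`). -/

namespace StochFracNLS

open scoped ComplexConjugate

/-! ### Dyadic partitions -/

/-- Countably many sequences that converge in measure have a common subsequence of indices along
which all of them converge almost everywhere. -/
theorem exists_strictMono_forall_tendsto_ae {Ω : Type*} {mΩ : MeasurableSpace Ω} {P : Measure Ω}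
    {ι : Type*} [Countable ι] {f : ι → ℕ → Ω → ℝ} {g : ι → Ω → ℝ}
    (h : ∀ i, TendstoInMeasure P (f i) atTop (g i)) :
    ∃ ns : ℕ → ℕ, StrictMono ns ∧
      ∀ᵐ ω ∂P, ∀ i, Tendsto (fun k ↦ f i (ns k) ω) atTop (𝓝 (g i ω)) := by
  obtain ⟨e, he⟩ := exists_injective_nat ι
  -- At stage `j` only the finitely many indices with `e i ≤ j` are tested, so one `n` serves them
  -- all. Each index is tested from stage `e i` on, which is enough for Borel-Cantelli.
  have key : ∀ j : ℕ, ∀ᶠ n in atTop, ∀ i ∈ {i | e i ≤ j},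
      P {ω | ENNReal.ofReal ((1 / 2 : ℝ) ^ j) ≤ edist (f i n ω) (g i ω)} ≤
        ENNReal.ofReal ((1 / 2 : ℝ) ^ j) := by
    intro j
    have hfin : {i | e i ≤ j}.Finite :=
      Set.Finite.preimage (Function.Injective.injOn he) (Set.finite_Iic j)
    rw [hfin.eventually_all]
    intro i _
    have hpos : 0 < ENNReal.ofReal ((1 / 2 : ℝ) ^ j) := by
      rw [ENNReal.ofReal_pos]; positivity
    exact ((h i _ hpos).eventually_lt_const hpos).mono fun n hn ↦ hn.le
  obtain ⟨ns, hns, hP⟩ := extraction_forall_of_eventually key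
  refine ⟨ns, hns, ?_⟩
  rw [ae_all_iff]
  intro i
  have hsum : ∑' k, P {ω | ENNReal.ofReal ((1 / 2 : ℝ) ^ (k + e i)) ≤
      edist (f i (ns (k + e i)) ω) (g i ω)} ≠ ∞ := by
    have hb : ∀ k, P {ω | ENNReal.ofReal ((1 / 2 : ℝ) ^ (k + e i)) ≤
        edist (f i (ns (k + e i)) ω) (g i ω)} ≤ ENNReal.ofReal ((1 / 2 : ℝ) ^ (k + e i)) :=
      fun k ↦ hP (k + e i) i (by simp)
    refine ne_top_of_le_ne_top ?_ (ENNReal.tsum_le_tsum hb)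
    rw [← ENNReal.ofReal_tsum_of_nonneg (fun k ↦ by positivity)]
    · exact ENNReal.ofReal_ne_top
    · exact (summable_nat_add_iff (e i)).2 summable_geometric_two
  filter_upwards [ae_eventually_notMem hsum] with ω hω
  rw [← tendsto_add_atTop_iff_nat (e i), tendsto_iff_edist_tendsto_0]
  have h0 : Tendsto (fun k ↦ ENNReal.ofReal ((1 / 2 : ℝ) ^ (k + e i))) atTop (𝓝 0) := by
    rw [← ENNReal.ofReal_zero]
    exact ENNReal.tendsto_ofReal ((tendsto_add_atTop_iff_nat (e i)).2
      (tendsto_pow_atTop_nhds_zero_of_lt_one (by norm_num) (by norm_num)))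
  refine tendsto_of_tendsto_of_tendsto_of_le_of_le' tendsto_const_nhds h0
    (Eventually.of_forall fun _ ↦ zero_le) ?_
  filter_upwards [hω] with k hk
  simpa using (not_le.1 hk).le

/-- The point `i T / 2 ^ n` of the dyadic partition of level `n` of `[0, T]`. -/
noncomputable def dyadicPt (T : ℝ≥0) (n i : ℕ) : ℝ≥0 := i * T / 2 ^ n

theorem dyadicPt_mono (T : ℝ≥0) (n : ℕ) : Monotone (dyadicPt T n) := by
  intro i j hij
  unfold dyadicPt
  gcongr

theorem dyadicPt_zero (T : ℝ≥0) (n : ℕ) : dyadicPt T n 0 = 0 := by simp [dyadicPt]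

theorem dyadicPt_last (T : ℝ≥0) (n : ℕ) : dyadicPt T n (2 ^ n) = T := by
  simp [dyadicPt, mul_div_cancel_left₀]

theorem dyadicPt_le {T : ℝ≥0} {n i : ℕ} (hi : i ≤ 2 ^ n) : dyadicPt T n i ≤ T :=
  (dyadicPt_mono T n hi).trans_eq (dyadicPt_last T n)

theorem dyadicPt_refine (T : ℝ≥0) (n m i : ℕ) :
    dyadicPt T (n + m) (i * 2 ^ m) = dyadicPt T n i := by
  unfold dyadicPt
  push_cast
  rw [pow_add]
  field_simp

theorem dyadicPt_succ_sub (T : ℝ≥0) (n i : ℕ) :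
    dyadicPt T n (i + 1) - dyadicPt T n i = T / 2 ^ n := by
  rw [tsub_eq_iff_eq_add_of_le (dyadicPt_mono T n i.le_succ)]
  unfold dyadicPt
  push_cast
  ring

/-- The dyadic points of level `n` up to the index `L`, as a partition of `[0, L T / 2 ^ n]`. -/
noncomputable def dyadicPartition (T : ℝ≥0) (n L : ℕ) {t : ℝ≥0} (h : dyadicPt T n L = t) :
    TimePartition t where
  n := L
  pt := dyadicPt T n
  mono := dyadicPt_mono T n
  pt_zero := dyadicPt_zero T n
  pt_last := h

/-- Limits over all partitions are used only through this sequence: the `b`-th point of level `n`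
has index `b * 2 ^ m` at level `n + m`, so the refinements all end at the same time. -/
theorem tendsto_dyadicPartition (T : ℝ≥0) (n b : ℕ) :
    Tendsto (fun m ↦ dyadicPartition T (n + m) (b * 2 ^ m) (dyadicPt_refine T n m b)) atTop
      (meshToZero (dyadicPt T n b)) := by
  rw [meshToZero, tendsto_comap_iff]
  have h0 : Tendsto (fun m : ℕ ↦ T / 2 ^ (n + m)) atTop (𝓝 0) := by
    have : Tendsto (fun m : ℕ ↦ (T : ℝ) / 2 ^ m) atTop (𝓝 0) := by
      have := (tendsto_pow_atTop_nhds_zero_of_lt_one (r := (1 / 2 : ℝ)) (by norm_num)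
        (by norm_num)).const_mul (T : ℝ)
      simpa [div_eq_mul_inv] using this
    rw [← NNReal.tendsto_coe]
    have h2 := this.comp (tendsto_add_atTop_nat n)
    simpa [Function.comp_def, add_comm] using h2
  refine tendsto_of_tendsto_of_tendsto_of_le_of_le tendsto_const_nhds h0 (fun _ ↦ zero_le) ?_
  intro m
  simp only [Function.comp_apply, TimePartition.mesh, dyadicPartition]
  exact Finset.sup_le fun i _ ↦ (dyadicPt_succ_sub T (n + m) i).le

theorem sum_range_mul_eq {M : Type*} [AddCommMonoid M] (f : ℕ → M) (n m : ℕ) :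
    ∑ k ∈ Finset.range (n * m), f k =
      ∑ i ∈ Finset.range n, ∑ l ∈ Finset.range m, f (i * m + l) := by
  induction n with
  | zero => simp
  | succ n ih => rw [Nat.succ_mul, Finset.sum_range_add, ih, Finset.sum_range_succ]

theorem IsItoIntegral.tendsto_dyadic {Ω : Type*} {mΩ : MeasurableSpace Ω} {P : Measure Ω}
    {X w I : ℝ≥0 → Ω → ℝ} (h : IsItoIntegral P X w I) (T : ℝ≥0) (n b : ℕ) :
    TendstoInMeasure P (fun m ω ↦ ∑ k ∈ Finset.range (b * 2 ^ m), X (dyadicPt T (n + m) k) ω *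
      (w (dyadicPt T (n + m) (k + 1)) ω - w (dyadicPt T (n + m) k) ω)) atTop
      (I (dyadicPt T n b)) := by
  have := (h (dyadicPt T n b)).comp (tendsto_dyadicPartition T n b)
  simpa only [dyadicPartition, Function.comp_def] using this

theorem IsCovariation.tendsto_dyadic {Ω : Type*} {mΩ : MeasurableSpace Ω} {P : Measure Ω}
    {X w C : ℝ≥0 → Ω → ℝ} (h : IsCovariation P X w C) (T : ℝ≥0) (n b : ℕ) :
    TendstoInMeasure P (fun m ω ↦ ∑ k ∈ Finset.range (b * 2 ^ m),
      (X (dyadicPt T (n + m) (k + 1)) ω - X (dyadicPt T (n + m) k) ω) *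
      (w (dyadicPt T (n + m) (k + 1)) ω - w (dyadicPt T (n + m) k) ω)) atTop
      (C (dyadicPt T n b)) := by
  have := (h.2 (dyadicPt T n b)).comp (tendsto_dyadicPartition T n b)
  simpa only [dyadicPartition, Function.comp_def] using this

/-! ### A discrete Itô isometry -/

section Isometry

variable {Ω : Type*} {mΩ : MeasurableSpace Ω} {P : Measure Ω}

/-- Discrete Itô isometry (as an inequality) for bounded predictable integrands. -/
theorem integral_sq_martingale_transform_le [IsProbabilityMeasure P] {G : ℕ → MeasurableSpace Ω}
    (hG : ∀ i, G i ≤ mΩ) (hGmono : Monotone G) {V Y : ℕ → Ω → ℝ} {K : ℝ} {v : ℕ → ℝ}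
    (hVm : ∀ i, Measurable[G (i + 1)] (V i)) (hY : ∀ i, Measurable[G i] (Y i))
    (hYK : ∀ i ω, |Y i ω| ≤ K)
    (hind : ∀ i, Indep (MeasurableSpace.comap (V i) inferInstance) (G i) P)
    (hV : ∀ i, MemLp (V i) 2 P) (hV0 : ∀ i, ∫ ω, V i ω ∂P = 0)
    (hVv : ∀ i, ∫ ω, V i ω ^ 2 ∂P = v i) (n : ℕ) :
    Measurable[G n] (fun ω ↦ ∑ i ∈ Finset.range n, Y i ω * V i ω) ∧
    MemLp (fun ω ↦ ∑ i ∈ Finset.range n, Y i ω * V i ω) 2 P ∧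
    ∫ ω, (∑ i ∈ Finset.range n, Y i ω * V i ω) ^ 2 ∂P ≤ K ^ 2 * ∑ i ∈ Finset.range n, v i := by
  induction n with
  | zero => simp
  | succ n ih =>
    obtain ⟨hm, hL, hle⟩ := ih
    set M : Ω → ℝ := fun ω ↦ ∑ i ∈ Finset.range n, Y i ω * V i ω with hM
    have hYm : Measurable (Y n) := (hY n).mono (hG n) le_rfl
    have hVm' : Measurable (V n) := (hVm n).mono (hG _) le_rfl
    have hMm : Measurable M := hm.mono (hG n) le_rfl
    have hYV : MemLp (fun ω ↦ Y n ω * V n ω) 2 P := by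
      refine MemLp.of_le_mul (c := K) (hV n) (hYm.mul hVm').aestronglyMeasurable
        (Eventually.of_forall fun ω ↦ ?_)
      rw [norm_mul]
      exact mul_le_mul_of_nonneg_right (hYK n ω) (norm_nonneg _)
    have hMY : MemLp (fun ω ↦ M ω * Y n ω) 2 P := by
      refine MemLp.of_le_mul (c := K) hL (hMm.mul hYm).aestronglyMeasurable
        (Eventually.of_forall fun ω ↦ ?_)
      rw [norm_mul, mul_comm]
      exact mul_le_mul_of_nonneg_right (hYK n ω) (norm_nonneg _)
    have hindF : ∀ Q : Ω → ℝ, Measurable[G n] Q → IndepFun Q (V n) P := by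
      intro Q hQ
      rw [IndepFun_iff_Indep]
      exact indep_of_indep_of_le_left (hind n).symm hQ.comap_le
    simp only [Finset.sum_range_succ]
    refine ⟨?_, hL.add hYV, ?_⟩
    · exact (hm.mono (hGmono n.le_succ) le_rfl).add
        (((hY n).mono (hGmono n.le_succ) le_rfl).mul (hVm n))
    -- `V n` is centred and independent of `G n`, which contains the information in `M` and `Y n`.
    -- The mixed term vanishes and second moments add up.
    · have hcross : ∫ ω, M ω * Y n ω * V n ω ∂P = 0 := by
        have := (hindF (fun ω ↦ M ω * Y n ω) (hm.mul (hY n))).integral_fun_mul_eq_mul_integral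
          hMY.aestronglyMeasurable (hV n).aestronglyMeasurable
        rw [this, hV0, mul_zero]
      have hsq : ∫ ω, Y n ω ^ 2 * V n ω ^ 2 ∂P ≤ K ^ 2 * v n := by
        have hi : IndepFun (fun ω ↦ Y n ω ^ 2) (fun ω ↦ V n ω ^ 2) P :=
          (hindF (Y n) (hY n)).comp (φ := fun x ↦ x ^ 2) (ψ := fun x ↦ x ^ 2)
            (measurable_id.pow_const 2) (measurable_id.pow_const 2)
        rw [hi.integral_fun_mul_eq_mul_integral (hYm.pow_const 2).aestronglyMeasurable
          (hVm'.pow_const 2).aestronglyMeasurable, hVv]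
        have hv : 0 ≤ v n := by rw [← hVv]; exact integral_nonneg fun ω ↦ sq_nonneg _
        refine mul_le_mul_of_nonneg_right ?_ hv
        have hb : ∀ ω, Y n ω ^ 2 ≤ K ^ 2 := fun ω ↦ by
          rw [← sq_abs]; exact pow_le_pow_left₀ (abs_nonneg _) (hYK n ω) 2
        calc ∫ ω, Y n ω ^ 2 ∂P ≤ ∫ ω, K ^ 2 ∂P := by
              refine integral_mono_of_nonneg (Eventually.of_forall fun ω ↦ sq_nonneg _)
                (integrable_const _) (Eventually.of_forall hb)
          _ = K ^ 2 := by simp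
      have hi1 : Integrable (fun ω ↦ M ω ^ 2) P := hL.integrable_sq
      have hi2 : Integrable (fun ω ↦ M ω * Y n ω * V n ω) P := hMY.integrable_mul (hV n)
      have hi3 : Integrable (fun ω ↦ Y n ω ^ 2 * V n ω ^ 2) P := by
        simpa [mul_pow] using hYV.integrable_sq
      calc ∫ ω, (M ω + Y n ω * V n ω) ^ 2 ∂P
          = ∫ ω, (M ω ^ 2 + (2 * (M ω * Y n ω * V n ω) + Y n ω ^ 2 * V n ω ^ 2)) ∂P := by
            congr 1; ext ω; ring
        _ = ∫ ω, M ω ^ 2 ∂P + (2 * ∫ ω, M ω * Y n ω * V n ω ∂P +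
              ∫ ω, Y n ω ^ 2 * V n ω ^ 2 ∂P) := by
            have hadd := (hi2.const_mul 2).add hi3
            rw [← integral_const_mul, ← integral_add (hi2.const_mul 2) hi3]
            exact integral_add hi1 hadd
        _ ≤ K ^ 2 * (∑ i ∈ Finset.range n, v i + v n) := by
            rw [hcross, mul_zero, zero_add, mul_add]
            exact add_le_add hle hsq

/-- Increments of the partial sums of the noise series. -/
def partialIncr (β : ℕ → ℝ≥0 → Ω → ℝ) (c : ℕ → ℝ) (r : ℕ) (s t : ℝ≥0) (ω : Ω) : ℝ :=
  ∑ k ∈ Finset.range r, (β k t ω - β k s ω) * c k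

section Brownian

variable {ℱ : Filtration ℝ≥0 mΩ} {β : ℕ → ℝ≥0 → Ω → ℝ}

theorem IsBrownianSequence.memLp_sub (h : IsBrownianSequence P ℱ β) (k : ℕ) (s t : ℝ≥0) :
    MemLp (β k t - β k s) 2 P := by
  have hl := (h.brownian k).hasLaw_sub t s
  have := memLp_id_gaussianReal' (μ := 0) (v := nndist t.1 s.1) 2 (by simp)
  rw [← hl.map_eq] at this
  exact (memLp_map_measure_iff aestronglyMeasurable_id hl.aemeasurable).1 this

theorem IsBrownianSequence.integral_sub (h : IsBrownianSequence P ℱ β) (k : ℕ) (s t : ℝ≥0) :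
    ∫ ω, (β k t - β k s) ω ∂P = 0 := by
  rw [((h.brownian k).hasLaw_sub t s).integral_eq, integral_id_gaussianReal]

theorem IsBrownianSequence.variance_sub (h : IsBrownianSequence P ℱ β) (k : ℕ) {s t : ℝ≥0}
    (hst : s ≤ t) : Var[β k t - β k s; P] = (t : ℝ) - s := by
  rw [((h.brownian k).hasLaw_sub t s).variance_eq, variance_id_gaussianReal]
  rw [coe_nndist, Real.dist_eq, abs_of_nonneg (sub_nonneg.2 (by exact_mod_cast hst))]
  rfl

theorem IsBrownianSequence.memLp_partialIncr (h : IsBrownianSequence P ℱ β) (c : ℕ → ℝ) (r : ℕ)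
    (s t : ℝ≥0) : MemLp (partialIncr β c r s t) 2 P := by
  refine memLp_finsetSum _ fun k _ ↦ ?_
  exact (h.memLp_sub k s t).mul_const (c k)

theorem IsBrownianSequence.integral_partialIncr [IsProbabilityMeasure P]
    (h : IsBrownianSequence P ℱ β) (c : ℕ → ℝ) (r : ℕ) (s t : ℝ≥0) : ∫ ω, partialIncr β c r s t ω ∂P = 0 := by
  have hi : ∀ k, Integrable (fun ω ↦ (β k t ω - β k s ω) * c k) P := fun k ↦
    ((h.memLp_sub k s t).integrable (by norm_num)).mul_const (c k)
  unfold partialIncr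
  rw [integral_finsetSum _ fun k _ ↦ hi k]
  refine Finset.sum_eq_zero fun k _ ↦ ?_
  have := h.integral_sub k s t
  simp only [Pi.sub_apply] at this
  rw [integral_mul_const, this, zero_mul]

theorem IsBrownianSequence.integral_sq_partialIncr [IsProbabilityMeasure P]
    (h : IsBrownianSequence P ℱ β) (c : ℕ → ℝ) (r : ℕ) {s t : ℝ≥0} (hst : s ≤ t) :
    ∫ ω, partialIncr β c r s t ω ^ 2 ∂P = (∑ k ∈ Finset.range r, c k ^ 2) * ((t : ℝ) - s) := by
  rw [← variance_of_integral_eq_zero (h.memLp_partialIncr c r s t).aemeasurable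
    (h.integral_partialIncr c r s t)]
  have heq : partialIncr β c r s t =
      ∑ k ∈ Finset.range r, fun ω ↦ c k * (β k t - β k s) ω := by
    ext ω
    simp [partialIncr, mul_comm]
  rw [heq, IndepFun.variance_sum (fun k _ ↦ (h.memLp_sub k s t).const_mul (c k)), Finset.sum_mul]
  · refine Finset.sum_congr rfl fun k _ ↦ ?_
    rw [variance_const_mul, h.variance_sub k hst]
  · intro k _ l _ hkl
    have := (h.indep.indepFun hkl).comp (φ := fun f : ℝ≥0 → ℝ ↦ c k * (f t - f s))
      (ψ := fun f : ℝ≥0 → ℝ ↦ c l * (f t - f s)) (by fun_prop) (by fun_prop)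
    exact this

theorem IsBrownianSequence.measurable_partialIncr (h : IsBrownianSequence P ℱ β) (c : ℕ → ℝ)
    (r : ℕ) {s t : ℝ≥0} (hst : s ≤ t) : Measurable[ℱ t] (partialIncr β c r s t) := by
  refine Finset.measurable_fun_sum _ fun k _ ↦ ?_
  exact ((h.adapted k t).sub ((h.adapted k s).mono (ℱ.mono hst) le_rfl)).mul_const (c k)

theorem IsBrownianSequence.indep_partialIncr (h : IsBrownianSequence P ℱ β) (c : ℕ → ℝ)
    (r : ℕ) {s t : ℝ≥0} (hst : s ≤ t) :
    Indep (MeasurableSpace.comap (partialIncr β c r s t) inferInstance) (ℱ s) P := by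
  refine indep_of_indep_of_le_left (h.indep_past s t hst) ?_
  have hg : Measurable (fun x : ℕ → ℝ ↦ ∑ k ∈ Finset.range r, x k * c k) := by fun_prop
  have heq : partialIncr β c r s t =
      (fun x : ℕ → ℝ ↦ ∑ k ∈ Finset.range r, x k * c k) ∘ fun ω k ↦ β k t ω - β k s ω := rfl
  rw [heq, ← MeasurableSpace.comap_comp]
  exact MeasurableSpace.comap_mono hg.comap_le

end Brownian

/-- Fatou's lemma for an almost everywhere convergent sequence with bounded integrals. -/
theorem lintegral_le_of_tendsto_ae {μ : Measure Ω} {g : ℕ → Ω → ℝ≥0∞} {g' : Ω → ℝ≥0∞} {B : ℝ≥0∞}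
    (hg : ∀ k, Measurable (g k)) (hlim : ∀ᵐ ω ∂μ, Tendsto (fun k ↦ g k ω) atTop (𝓝 (g' ω)))
    (hB : ∀ k, ∫⁻ ω, g k ω ∂μ ≤ B) : ∫⁻ ω, g' ω ∂μ ≤ B :=
  calc ∫⁻ ω, g' ω ∂μ = ∫⁻ ω, liminf (fun k ↦ g k ω) atTop ∂μ :=
        lintegral_congr_ae (hlim.mono fun ω h ↦ h.liminf_eq.symm)
    _ ≤ liminf (fun k ↦ ∫⁻ ω, g k ω ∂μ) atTop := lintegral_liminf_le hg
    _ ≤ B := by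
        refine liminf_le_of_le (by isBoundedDefault) fun c hc ↦ ?_
        obtain ⟨k, hk⟩ := hc.exists
        exact hk.trans (hB _)

/-- Itô's isometry, as an inequality, for elementary bounded integrands and the noise at a fixed
point of space. -/
theorem IsWienerField.lintegral_sq_sum_le [IsProbabilityMeasure P] {ℱ : Filtration ℝ≥0 mΩ}
    {a b : ℝ} {β : ℕ → ℝ≥0 → Ω → ℝ} {φ : ℕ → ℝ → ℝ} {W : ℝ≥0 → ℝ → Ω → ℝ}
    (hW : IsWienerField P ℱ a b β φ W) {x : ℝ} (hx : x ∈ Set.Icc a b) {τ : ℕ → ℝ≥0}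
    (hτ : Monotone τ) {Y : ℕ → Ω → ℝ} {K : ℝ} (hY : ∀ i, Measurable[ℱ (τ i)] (Y i))
    (hYK : ∀ i ω, |Y i ω| ≤ K) (n : ℕ) :
    ∫⁻ ω, ENNReal.ofReal
      ((∑ i ∈ Finset.range n, Y i ω * (W (τ (i + 1)) x ω - W (τ i) x ω)) ^ 2) ∂P ≤
      ENNReal.ofReal (K ^ 2 * ((∑' k, φ k x ^ 2) * ((τ n : ℝ) - τ 0))) := by
  have hB := hW.brownian
  have hconv : ∀ i : ℕ, TendstoInMeasure P
      (fun r ω ↦ ∑ k ∈ Finset.range r, β k (τ i) ω * φ k x) atTop (W (τ i) x) :=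
    fun i ↦ hW.series (τ i) x hx
  -- The isometry is available for the finite partial sums of the noise, with a constant uniform in
  -- `r`. Fatou's lemma carries it to `W` along a subsequence that converges almost surely at all
  -- the times `τ i` at once.
  obtain ⟨rs, -, hrs⟩ := exists_strictMono_forall_tendsto_ae hconv
  let F : ℕ → Ω → ℝ := fun r ω ↦
    (∑ i ∈ Finset.range n, Y i ω * partialIncr β (fun k ↦ φ k x) r (τ i) (τ (i + 1)) ω) ^ 2
  have hF : ∀ r, Measurable (F r) := by
    intro r
    refine Measurable.pow_const (Finset.measurable_fun_sum _ fun i _ ↦ ?_) 2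
    exact ((hY i).mono (ℱ.le _) le_rfl).mul
      ((hB.measurable_partialIncr _ r (hτ i.le_succ)).mono (ℱ.le _) le_rfl)
  have hbound : ∀ r, ∫⁻ ω, ENNReal.ofReal (F r ω) ∂P ≤
      ENNReal.ofReal (K ^ 2 * ((∑' k, φ k x ^ 2) * ((τ n : ℝ) - τ 0))) := by
    intro r
    obtain ⟨-, hL, hle⟩ := integral_sq_martingale_transform_le (P := P) (G := fun i ↦ ℱ (τ i))
      (fun i ↦ ℱ.le _) (fun i j hij ↦ ℱ.mono (hτ hij))
      (V := fun i ↦ partialIncr β (fun k ↦ φ k x) r (τ i) (τ (i + 1))) (Y := Y) (K := K)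
      (v := fun i ↦ (∑ k ∈ Finset.range r, φ k x ^ 2) * ((τ (i + 1) : ℝ) - τ i))
      (fun i ↦ hB.measurable_partialIncr _ r (hτ i.le_succ)) hY hYK
      (fun i ↦ hB.indep_partialIncr _ r (hτ i.le_succ))
      (fun i ↦ hB.memLp_partialIncr _ r _ _) (fun i ↦ hB.integral_partialIncr _ r _ _)
      (fun i ↦ hB.integral_sq_partialIncr _ r (hτ i.le_succ)) n
    rw [← ofReal_integral_eq_lintegral_ofReal hL.integrable_sq
      (Eventually.of_forall fun ω ↦ sq_nonneg _)]
    refine ENNReal.ofReal_le_ofReal (hle.trans ?_)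
    rw [← Finset.mul_sum, Finset.sum_range_sub (fun i ↦ (τ i : ℝ))]
    have h0 : (0 : ℝ) ≤ (τ n : ℝ) - τ 0 := sub_nonneg.2 (by exact_mod_cast hτ (Nat.zero_le n))
    refine mul_le_mul_of_nonneg_left (mul_le_mul_of_nonneg_right ?_ h0) (sq_nonneg K)
    exact (hW.summable x hx).sum_le_tsum _ fun k _ ↦ sq_nonneg _
  have hlim : ∀ᵐ ω ∂P, Tendsto (fun k ↦ ENNReal.ofReal (F (rs k) ω)) atTop
      (𝓝 (ENNReal.ofReal
        ((∑ i ∈ Finset.range n, Y i ω * (W (τ (i + 1)) x ω - W (τ i) x ω)) ^ 2))) := by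
    filter_upwards [hrs] with ω hω
    refine ENNReal.tendsto_ofReal (Tendsto.pow (tendsto_finsetSum _ fun i _ ↦ ?_) 2)
    refine Tendsto.const_mul _ (((hω (i + 1)).sub (hω i)).congr fun k ↦ ?_)
    simp [partialIncr, sub_mul, Finset.sum_sub_distrib]
  exact lintegral_le_of_tendsto_ae (fun k ↦ (hF _).ennreal_ofReal) hlim fun k ↦ hbound _

end Isometry

/-! ### The Itô remainder along dyadic partitions -/

section ItoRemainder

variable {Ω : Type*} {mΩ : MeasurableSpace Ω} {P : Measure Ω}

/-- A continuous path oscillates little over the intervals of a fine dyadic partition. -/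
theorem eventually_forall_dist_dyadicPt_le {E : Type*} [PseudoMetricSpace E] {f : ℝ≥0 → E}
    (hf : Continuous f) (T : ℝ≥0) {ε : ℝ} (hε : 0 < ε) :
    ∀ᶠ n in atTop, ∀ i < 2 ^ n, ∀ s, dyadicPt T n i ≤ s → s ≤ dyadicPt T n (i + 1) →
      dist (f s) (f (dyadicPt T n i)) ≤ ε := by
  have huc := (isCompact_Icc (a := (0 : ℝ≥0)) (b := T)).uniformContinuousOn_of_continuous
    hf.continuousOn
  obtain ⟨δ, hδ, H⟩ := Metric.uniformContinuousOn_iff.1 huc ε hε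
  have h0 : Tendsto (fun n : ℕ ↦ (T : ℝ) / 2 ^ n) atTop (𝓝 0) := by
    have := (tendsto_pow_atTop_nhds_zero_of_lt_one (r := (1 / 2 : ℝ)) (by norm_num)
      (by norm_num)).const_mul (T : ℝ)
    simpa [div_eq_mul_inv] using this
  filter_upwards [h0.eventually_lt_const hδ] with n hn i hi s h1 h2
  have hiT : dyadicPt T n (i + 1) ≤ T := dyadicPt_le hi
  refine (H s ⟨zero_le, h2.trans hiT⟩ _ ⟨zero_le, h1.trans (h2.trans hiT)⟩ ?_).le
  refine lt_of_le_of_lt ?_ hn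
  rw [NNReal.dist_eq, abs_of_nonneg (sub_nonneg.2 (by exact_mod_cast h1))]
  have h3 : s - dyadicPt T n i ≤ T / 2 ^ n :=
    (tsub_le_tsub_right h2 _).trans_eq (dyadicPt_succ_sub T n i)
  rw [← NNReal.coe_sub h1]
  exact_mod_cast h3

/-- The increment of `f` over the `i`-th interval of the dyadic partition of level `n`. -/
noncomputable def dyadicIncr {E : Type*} [Sub E] (T : ℝ≥0) (n : ℕ) (f : ℝ≥0 → E) (i : ℕ) : E :=
  f (dyadicPt T n (i + 1)) - f (dyadicPt T n i)

/-- The error of the left-point approximation of an integral path `I` of `x` against `w`. -/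
noncomputable def itoRem (T : ℝ≥0) (n : ℕ) (x w I : ℝ≥0 → ℝ) (i : ℕ) : ℝ :=
  dyadicIncr T n I i - x (dyadicPt T n i) * dyadicIncr T n w i

theorem sum_dyadicIncr_block {E : Type*} [AddCommGroup E] (T : ℝ≥0) (n m i : ℕ) (f : ℝ≥0 → E) :
    ∑ l ∈ Finset.range (2 ^ m), dyadicIncr T (n + m) f (i * 2 ^ m + l) = dyadicIncr T n f i := by
  have := Finset.sum_range_sub (fun l ↦ f (dyadicPt T (n + m) (i * 2 ^ m + l))) (2 ^ m)
  simp only [dyadicIncr, add_assoc] at this ⊢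
  rw [this, add_zero, dyadicPt_refine, ← dyadicPt_refine T n m (i + 1), Nat.succ_mul]

/-- The remainder over a coarse interval is the integral of the increment of `x` since the left end:
the integral over the block is a difference of two limits, and the left-point term splits exactly
over the fine intervals. -/
theorem tendsto_itoRem {x w I : ℝ≥0 → ℝ} {T : ℝ≥0} {n i : ℕ} {ms : ℕ → ℕ}
    (h : ∀ b, Tendsto (fun k ↦ ∑ l ∈ Finset.range (b * 2 ^ ms k),
      x (dyadicPt T (n + ms k) l) * dyadicIncr T (n + ms k) w l) atTop (𝓝 (I (dyadicPt T n b)))) :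
    Tendsto (fun k ↦ ∑ l ∈ Finset.range (2 ^ ms k),
      (x (dyadicPt T (n + ms k) (i * 2 ^ ms k + l)) - x (dyadicPt T n i)) *
        dyadicIncr T (n + ms k) w (i * 2 ^ ms k + l)) atTop (𝓝 (itoRem T n x w I i)) := by
  refine (((h (i + 1)).sub (h i)).sub_const (x (dyadicPt T n i) * dyadicIncr T n w i)).congr
    fun k ↦ ?_
  rw [Nat.succ_mul, Finset.sum_range_add, add_sub_cancel_left, ← sum_dyadicIncr_block T n (ms k),
    Finset.mul_sum, ← Finset.sum_sub_distrib]
  exact Finset.sum_congr rfl fun l _ ↦ by ring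

/-- Truncation of a real number to `[-δ, δ]`. -/
noncomputable def clip (δ x : ℝ) : ℝ := max (-δ) (min δ x)

theorem abs_clip_le {δ : ℝ} (hδ : 0 ≤ δ) (x : ℝ) : |clip δ x| ≤ δ :=
  abs_le.2 ⟨le_max_left _ _, max_le (by linarith) (min_le_left _ _)⟩

theorem clip_eq_self {δ x : ℝ} (h : |x| ≤ δ) : clip δ x = x := by
  rw [clip, min_eq_right (abs_le.1 h).2, max_eq_right (abs_le.1 h).1]

theorem measurable_clip (δ : ℝ) : Measurable (clip δ) := by
  unfold clip
  fun_prop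

/-- The elementary integrals of bounded integrands against `w` satisfy Itô's isometry as an
inequality, with variance at most `κ` per unit of time. -/
def IsometryBound (P : Measure Ω) (ℱ : Filtration ℝ≥0 mΩ) (w : ℝ≥0 → Ω → ℝ) (κ : ℝ) : Prop :=
  ∀ (τ : ℕ → ℝ≥0) (Y : ℕ → Ω → ℝ) (K : ℝ), Monotone τ → (∀ i, Measurable[ℱ (τ i)] (Y i)) →
    (∀ i ω, |Y i ω| ≤ K) → ∀ n, ∫⁻ ω, ENNReal.ofReal
      ((∑ i ∈ Finset.range n, Y i ω * (w (τ (i + 1)) ω - w (τ i) ω)) ^ 2) ∂P ≤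
      ENNReal.ofReal (K ^ 2 * (κ * ((τ n : ℝ) - τ 0)))

theorem IsWienerField.isometryBound [IsProbabilityMeasure P] {ℱ : Filtration ℝ≥0 mΩ}
    {a b : ℝ} {β : ℕ → ℝ≥0 → Ω → ℝ} {φ : ℕ → ℝ → ℝ} {W : ℝ≥0 → ℝ → Ω → ℝ}
    (hW : IsWienerField P ℱ a b β φ W) {x : ℝ} (hx : x ∈ Set.Icc a b) :
    IsometryBound P ℱ (fun t ↦ W t x) (∑' k, φ k x ^ 2) :=
  fun _ _ _ hτ hY hYK n ↦ hW.lintegral_sq_sum_le hx hτ hY hYK n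

/-- The event that `X` moves by at most `δ` within the intervals of the dyadic partition of level
`n`, tested at dyadic times. -/
def smallOsc (T : ℝ≥0) (X : ℝ≥0 → Ω → ℝ) (δ : ℝ) (n : ℕ) : Set Ω :=
  {ω | ∀ m i l : ℕ, i < 2 ^ n → l < 2 ^ m →
    |X (dyadicPt T (n + m) (i * 2 ^ m + l)) ω - X (dyadicPt T n i) ω| ≤ δ}

/-- Testing at dyadic times only makes the event a countable intersection; by continuity of paths
nothing is lost. -/
theorem measurableSet_smallOsc (T : ℝ≥0) {X : ℝ≥0 → Ω → ℝ} (hX : ∀ t, Measurable (X t)) (δ : ℝ)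
    (n : ℕ) : MeasurableSet (smallOsc T X δ n) := by
  simp only [smallOsc, Set.ofPred_forall]
  refine MeasurableSet.iInter fun m ↦ MeasurableSet.iInter fun i ↦ MeasurableSet.iInter fun l ↦
    MeasurableSet.iInter fun _ ↦ MeasurableSet.iInter fun _ ↦ ?_
  exact measurableSet_le (((hX _).sub (hX _)).abs) measurable_const

theorem eventually_mem_smallOsc (T : ℝ≥0) {X : ℝ≥0 → Ω → ℝ} {ω : Ω}
    (hX : Continuous fun t ↦ X t ω) {δ : ℝ} (hδ : 0 < δ) :
    ∀ᶠ n in atTop, ω ∈ smallOsc T X δ n := by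
  filter_upwards [eventually_forall_dist_dyadicPt_le hX T hδ] with n hn m i l hi hl
  refine hn i hi _ ?_ ?_
  · rw [← dyadicPt_refine T n m i]
    exact dyadicPt_mono _ _ (Nat.le_add_right _ _)
  · rw [← dyadicPt_refine T n m (i + 1)]
    exact dyadicPt_mono _ _ (by rw [Nat.succ_mul]; omega)

/-- Convergence in measure to `0` from small integrals over events that eventually occur. -/
theorem tendstoInMeasure_zero_of_setLIntegral_le [IsFiniteMeasure P] {f : ℕ → Ω → ℝ}
    (hf0 : ∀ n ω, 0 ≤ f n ω) (hfm : ∀ n, AEMeasurable (f n) P)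
    (h : ∀ δ : ℝ, 0 < δ → ∃ A : ℕ → Set Ω, (∀ n, MeasurableSet (A n)) ∧
      (∀ᵐ ω ∂P, ∀ᶠ n in atTop, ω ∈ A n) ∧
      ∀ n, ∫⁻ ω in A n, ENNReal.ofReal (f n ω) ∂P ≤ ENNReal.ofReal δ) :
    TendstoInMeasure P f atTop fun _ ↦ (0 : ℝ) := by
  rw [tendstoInMeasure_iff_dist]
  intro ε hε
  rw [ENNReal.tendsto_nhds_zero]
  intro η hη
  obtain ⟨r, hr0, hr⟩ := ENNReal.lt_iff_exists_nnreal_btwn.1 hη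
  have hr0' : (0 : ℝ) < r := by exact_mod_cast hr0
  -- Markov's inequality at height `ε` turns `r / 2 * ε` into `r / 2`; the other half pays for the
  -- complement of `A n`.
  obtain ⟨A, hAm, hAe, hA⟩ := h (r / 2 * ε) (by positivity)
  have hAc : Tendsto (fun n ↦ P (A n)ᶜ) atTop (𝓝 (P ∅)) :=
    tendsto_measure_of_ae_tendsto_indicator_of_isFiniteMeasure atTop MeasurableSet.empty
      (fun n ↦ (hAm n).compl) (hAe.mono fun ω hω ↦ hω.mono fun n hn ↦ by simp [hn])
  rw [measure_empty] at hAc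
  have hr2 : (0 : ℝ≥0∞) < ENNReal.ofReal (r / 2) := by rw [ENNReal.ofReal_pos]; positivity
  filter_upwards [hAc.eventually_lt_const hr2] with n hn
  have hsub : {ω | ε ≤ dist (f n ω) 0} ⊆
      (A n)ᶜ ∪ ({ω | ENNReal.ofReal ε ≤ ENNReal.ofReal (f n ω)} ∩ A n) := by
    intro ω hω
    by_cases hmem : ω ∈ A n
    · refine Or.inr ⟨ENNReal.ofReal_le_ofReal ?_, hmem⟩
      simpa [Real.dist_eq, abs_of_nonneg (hf0 n ω)] using hω
    · exact Or.inl hmem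
  have hmarkov : P ({ω | ENNReal.ofReal ε ≤ ENNReal.ofReal (f n ω)} ∩ A n) ≤
      ENNReal.ofReal (r / 2) := by
    rw [← Measure.restrict_apply' (hAm n)]
    refine (meas_ge_le_lintegral_div (hfm n).ennreal_ofReal.restrict
      (by simpa using hε) ENNReal.ofReal_ne_top).trans ?_
    refine ENNReal.div_le_of_le_mul ((hA n).trans_eq ?_)
    rw [ENNReal.ofReal_mul (by positivity)]
  calc P {ω | ε ≤ dist (f n ω) 0} ≤ P (A n)ᶜ + ENNReal.ofReal (r / 2) :=
        (measure_mono hsub).trans ((measure_union_le _ _).trans (add_le_add le_rfl hmarkov))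
    _ ≤ ENNReal.ofReal (r / 2) + ENNReal.ofReal (r / 2) := add_le_add hn.le le_rfl
    _ = r := by
        rw [← ENNReal.ofReal_add (by positivity) (by positivity), add_halves]
        exact ENNReal.ofReal_coe_nnreal
    _ ≤ η := hr.le

section Remainder

variable {ℱ : Filtration ℝ≥0 mΩ} {X w I : ℝ≥0 → Ω → ℝ} {κ : ℝ}

theorem IsItoIntegral.aemeasurable_itoRem (hI : IsItoIntegral P X w I)
    (hX : ∀ t, Measurable (X t)) (hw : ∀ t, Measurable (w t)) (T : ℝ≥0) (n i : ℕ) :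
    AEMeasurable (fun ω ↦ itoRem T n (fun t ↦ X t ω) (fun t ↦ w t ω) (fun t ↦ I t ω) i) P := by
  have hIm : ∀ b, AEMeasurable (I (dyadicPt T n b)) P := fun b ↦
    (hI.tendsto_dyadic T n b).aemeasurable fun m ↦
      (Finset.measurable_fun_sum _ fun k _ ↦
        (hX _).mul ((hw _).sub (hw _))).aemeasurable
  exact ((hIm (i + 1)).sub (hIm i)).sub
    ((hX _).mul ((hw _).sub (hw _))).aemeasurable

theorem IsItoIntegral.exists_tendsto_itoRem (hI : IsItoIntegral P X w I) (T : ℝ≥0) (n : ℕ) :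
    ∃ ms : ℕ → ℕ, ∀ᵐ ω ∂P, ∀ i, Tendsto (fun k ↦ ∑ l ∈ Finset.range (2 ^ ms k),
      (X (dyadicPt T (n + ms k) (i * 2 ^ ms k + l)) ω - X (dyadicPt T n i) ω) *
        dyadicIncr T (n + ms k) (fun t ↦ w t ω) (i * 2 ^ ms k + l)) atTop
      (𝓝 (itoRem T n (fun t ↦ X t ω) (fun t ↦ w t ω) (fun t ↦ I t ω) i)) := by
  obtain ⟨ms, -, hms⟩ := exists_strictMono_forall_tendsto_ae fun b ↦ hI.tendsto_dyadic T n b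
  refine ⟨ms, hms.mono fun ω hω i ↦ ?_⟩
  exact tendsto_itoRem (x := fun t ↦ X t ω) (w := fun t ↦ w t ω) (I := fun t ↦ I t ω) hω

/-- On `smallOsc` the integrand of each remainder is at most `δ`. This event looks into the future,
so it cannot be part of an adapted integrand. Truncation by `clip` changes nothing on the event and
leaves an adapted integrand bounded by `δ` everywhere; then the event is dropped and the isometry is
applied on each coarse interval, of length `T / 2 ^ n`. -/
theorem IsItoIntegral.setLIntegral_sum_sq_itoRem_le (hI : IsItoIntegral P X w I)
    (hw : Adapted ℱ w) (hX : Adapted ℱ X) (hiso : IsometryBound P ℱ w κ) (hκ : 0 ≤ κ)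
    (T : ℝ≥0) (n : ℕ) {δ : ℝ} (hδ : 0 < δ) :
    ∫⁻ ω in smallOsc T X δ n, ENNReal.ofReal (∑ i ∈ Finset.range (2 ^ n),
      itoRem T n (fun t ↦ X t ω) (fun t ↦ w t ω) (fun t ↦ I t ω) i ^ 2) ∂P ≤
      ENNReal.ofReal (δ ^ 2 * (κ * T)) := by
  have hXm : ∀ t, Measurable (X t) := fun t ↦ (hX t).mono (ℱ.le t) le_rfl
  have hwm : ∀ t, Measurable (w t) := fun t ↦ (hw t).mono (ℱ.le t) le_rfl
  obtain ⟨ms, hms⟩ := hI.exists_tendsto_itoRem T n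
  refine lintegral_le_of_tendsto_ae (g := fun k ω ↦ ENNReal.ofReal (∑ i ∈ Finset.range (2 ^ n),
    (∑ l ∈ Finset.range (2 ^ ms k),
      (X (dyadicPt T (n + ms k) (i * 2 ^ ms k + l)) ω - X (dyadicPt T n i) ω) *
        dyadicIncr T (n + ms k) (fun t ↦ w t ω) (i * 2 ^ ms k + l)) ^ 2)) ?_ ?_ ?_
  · intro k
    refine (Finset.measurable_fun_sum _ fun i _ ↦ Measurable.pow_const
      (Finset.measurable_fun_sum _ fun l _ ↦ ?_) 2).ennreal_ofReal
    exact ((hXm _).sub (hXm _)).mul ((hwm _).sub (hwm _))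
  · exact ae_restrict_of_ae (hms.mono fun ω hω ↦ ENNReal.tendsto_ofReal
      (tendsto_finsetSum _ fun i _ ↦ (hω i).pow 2))
  · intro k
    generalize ms k = m
    calc _ ≤ ∫⁻ ω in smallOsc T X δ n, ∑ i ∈ Finset.range (2 ^ n), ENNReal.ofReal
          ((∑ l ∈ Finset.range (2 ^ m),
            clip δ (X (dyadicPt T (n + m) (i * 2 ^ m + l)) ω - X (dyadicPt T n i) ω) *
            (w (dyadicPt T (n + m) (i * 2 ^ m + (l + 1))) ω -
              w (dyadicPt T (n + m) (i * 2 ^ m + l)) ω)) ^ 2) ∂P := by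
          refine setLIntegral_mono' (measurableSet_smallOsc T hXm δ n) fun ω hω ↦ ?_
          rw [ENNReal.ofReal_sum_of_nonneg fun i _ ↦ sq_nonneg _]
          refine Finset.sum_le_sum fun i hi ↦ le_of_eq ?_
          congr 2
          refine Finset.sum_congr rfl fun l hl ↦ ?_
          rw [clip_eq_self (hω m i l (Finset.mem_range.1 hi) (Finset.mem_range.1 hl))]
          rfl
      _ ≤ ∫⁻ ω, ∑ i ∈ Finset.range (2 ^ n), ENNReal.ofReal
          ((∑ l ∈ Finset.range (2 ^ m),
            clip δ (X (dyadicPt T (n + m) (i * 2 ^ m + l)) ω - X (dyadicPt T n i) ω) *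
            (w (dyadicPt T (n + m) (i * 2 ^ m + (l + 1))) ω -
              w (dyadicPt T (n + m) (i * 2 ^ m + l)) ω)) ^ 2) ∂P := setLIntegral_le_lintegral _ _
      _ ≤ ∑ i ∈ Finset.range (2 ^ n), ENNReal.ofReal (δ ^ 2 * (κ * (T / 2 ^ n))) := by
          have hmeas : ∀ i, Measurable fun ω ↦ ENNReal.ofReal ((∑ l ∈ Finset.range (2 ^ m),
              clip δ (X (dyadicPt T (n + m) (i * 2 ^ m + l)) ω - X (dyadicPt T n i) ω) *
              (w (dyadicPt T (n + m) (i * 2 ^ m + (l + 1))) ω -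
                w (dyadicPt T (n + m) (i * 2 ^ m + l)) ω)) ^ 2) := fun i ↦
            (Measurable.pow_const (Finset.measurable_fun_sum _ fun l _ ↦ ((measurable_clip δ).comp
              ((hXm _).sub (hXm _))).mul ((hwm _).sub (hwm _))) 2).ennreal_ofReal
          rw [lintegral_finsetSum _ fun i _ ↦ hmeas i]
          refine Finset.sum_le_sum fun i _ ↦ ?_
          have hle : ∀ l, dyadicPt T n i ≤ dyadicPt T (n + m) (i * 2 ^ m + l) := fun l ↦ by
            rw [← dyadicPt_refine T n m i]
            exact dyadicPt_mono _ _ (Nat.le_add_right _ _)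
          refine (hiso (fun l ↦ dyadicPt T (n + m) (i * 2 ^ m + l))
            (fun l ω ↦ clip δ (X (dyadicPt T (n + m) (i * 2 ^ m + l)) ω - X (dyadicPt T n i) ω)) δ
            (fun l l' h ↦ dyadicPt_mono _ _ (by omega)) (fun l ↦ ?_)
            (fun l ω ↦ abs_clip_le hδ.le _) (2 ^ m)).trans_eq ?_
          · exact (measurable_clip δ).comp ((hX _).sub ((hX _).mono (ℱ.mono (hle l)) le_rfl))
          · have h1 : dyadicPt T (n + m) (i * 2 ^ m + 2 ^ m) = dyadicPt T n (i + 1) := by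
              rw [← dyadicPt_refine T n m (i + 1), Nat.succ_mul]
            have h2 := congrArg ((↑) : ℝ≥0 → ℝ) (dyadicPt_succ_sub T n i)
            rw [NNReal.coe_sub (dyadicPt_mono T n i.le_succ)] at h2
            rw [h1, add_zero, dyadicPt_refine, h2]
            push_cast
            rfl
      _ = ENNReal.ofReal (δ ^ 2 * (κ * T)) := by
          rw [← ENNReal.ofReal_sum_of_nonneg fun i _ ↦ by positivity]
          simp only [Finset.sum_const, Finset.card_range, nsmul_eq_mul]
          congr 1
          push_cast
          field_simp

/-- The square of the sum obeys the same bound as the sum of the squares, without the factor `2 ^ n`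
of Cauchy-Schwarz. Since the weight is taken at the left end of the coarse interval, the whole
weighted sum is one elementary integral of an adapted integrand bounded by `δ` after truncation. -/
theorem IsItoIntegral.setLIntegral_sq_sum_itoRem_le (hI : IsItoIntegral P X w I)
    (hw : Adapted ℱ w) (hX : Adapted ℱ X) (hiso : IsometryBound P ℱ w κ)
    {c : ℝ≥0 → Ω → ℝ} (hc : Adapted ℱ c) (hc1 : ∀ t ω, |c t ω| ≤ 1)
    (T : ℝ≥0) (n : ℕ) {δ : ℝ} (hδ : 0 < δ) :
    ∫⁻ ω in smallOsc T X δ n, ENNReal.ofReal ((∑ i ∈ Finset.range (2 ^ n), c (dyadicPt T n i) ω *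
      itoRem T n (fun t ↦ X t ω) (fun t ↦ w t ω) (fun t ↦ I t ω) i) ^ 2) ∂P ≤
      ENNReal.ofReal (δ ^ 2 * (κ * T)) := by
  have hXm : ∀ t, Measurable (X t) := fun t ↦ (hX t).mono (ℱ.le t) le_rfl
  have hwm : ∀ t, Measurable (w t) := fun t ↦ (hw t).mono (ℱ.le t) le_rfl
  have hcm : ∀ t, Measurable (c t) := fun t ↦ (hc t).mono (ℱ.le t) le_rfl
  obtain ⟨ms, hms⟩ := hI.exists_tendsto_itoRem T n
  refine lintegral_le_of_tendsto_ae (g := fun k ω ↦ ENNReal.ofReal ((∑ i ∈ Finset.range (2 ^ n),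
    c (dyadicPt T n i) ω * ∑ l ∈ Finset.range (2 ^ ms k),
      (X (dyadicPt T (n + ms k) (i * 2 ^ ms k + l)) ω - X (dyadicPt T n i) ω) *
        dyadicIncr T (n + ms k) (fun t ↦ w t ω) (i * 2 ^ ms k + l)) ^ 2)) ?_ ?_ ?_
  · intro k
    refine (Measurable.pow_const (Finset.measurable_fun_sum _ fun i _ ↦ (hcm _).mul
      (Finset.measurable_fun_sum _ fun l _ ↦ ?_)) 2).ennreal_ofReal
    exact ((hXm _).sub (hXm _)).mul ((hwm _).sub (hwm _))
  · exact ae_restrict_of_ae (hms.mono fun ω hω ↦ ENNReal.tendsto_ofReal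
      (Tendsto.pow (tendsto_finsetSum _ fun i _ ↦ (hω i).const_mul _) 2))
  · intro k
    generalize ms k = m
    -- `l / 2 ^ m` is the index of the coarse interval that contains the `l`-th fine one. Its left
    -- end is not later, which makes the integrand adapted.
    have hle : ∀ l, dyadicPt T n (l / 2 ^ m) ≤ dyadicPt T (n + m) l := fun l ↦ by
      rw [← dyadicPt_refine T n m]
      exact dyadicPt_mono _ _ (Nat.div_mul_le_self _ _)
    calc _ ≤ ∫⁻ ω in smallOsc T X δ n, ENNReal.ofReal
          ((∑ l ∈ Finset.range (2 ^ n * 2 ^ m), (c (dyadicPt T n (l / 2 ^ m)) ω *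
            clip δ (X (dyadicPt T (n + m) l) ω - X (dyadicPt T n (l / 2 ^ m)) ω)) *
            (w (dyadicPt T (n + m) (l + 1)) ω - w (dyadicPt T (n + m) l) ω)) ^ 2) ∂P := by
          refine setLIntegral_mono' (measurableSet_smallOsc T hXm δ n) fun ω hω ↦ ?_
          rw [sum_range_mul_eq]
          refine le_of_eq ?_
          congr 2
          refine Finset.sum_congr rfl fun i hi ↦ ?_
          rw [Finset.mul_sum]
          refine Finset.sum_congr rfl fun l hl ↦ ?_
          have hdiv : (i * 2 ^ m + l) / 2 ^ m = i := by
            rw [Nat.add_comm, Nat.add_mul_div_right _ _ (by positivity),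
              Nat.div_eq_of_lt (Finset.mem_range.1 hl), zero_add]
          rw [hdiv, clip_eq_self (hω m i l (Finset.mem_range.1 hi) (Finset.mem_range.1 hl)),
            mul_assoc]
          rfl
      _ ≤ ∫⁻ ω, ENNReal.ofReal
          ((∑ l ∈ Finset.range (2 ^ n * 2 ^ m), (c (dyadicPt T n (l / 2 ^ m)) ω *
            clip δ (X (dyadicPt T (n + m) l) ω - X (dyadicPt T n (l / 2 ^ m)) ω)) *
            (w (dyadicPt T (n + m) (l + 1)) ω - w (dyadicPt T (n + m) l) ω)) ^ 2) ∂P :=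
          setLIntegral_le_lintegral _ _
      _ ≤ ENNReal.ofReal (δ ^ 2 * (κ * ((dyadicPt T (n + m) (2 ^ n * 2 ^ m) : ℝ) -
            dyadicPt T (n + m) 0))) := by
          refine hiso (dyadicPt T (n + m)) (fun l ω ↦ c (dyadicPt T n (l / 2 ^ m)) ω *
            clip δ (X (dyadicPt T (n + m) l) ω - X (dyadicPt T n (l / 2 ^ m)) ω)) δ
            (dyadicPt_mono _ _) (fun l ↦ ?_) (fun l ω ↦ ?_) _
          · exact ((hc _).mono (ℱ.mono (hle l)) le_rfl).mul ((measurable_clip δ).comp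
              ((hX _).sub ((hX _).mono (ℱ.mono (hle l)) le_rfl)))
          · rw [abs_mul]
            exact (mul_le_mul (hc1 _ _) (abs_clip_le hδ.le _) (abs_nonneg _)
              zero_le_one).trans_eq (one_mul δ)
      _ = ENNReal.ofReal (δ ^ 2 * (κ * T)) := by
          rw [← pow_add, dyadicPt_last, dyadicPt_zero, NNReal.coe_zero, sub_zero]

/-- The oscillation threshold `√(δ / (κ * T + 1))` makes its square times `κ * T` at most `δ`; the
`1` covers the case `κ * T = 0`. Almost every path is continuous, hence eventually in the event. -/
theorem exists_smallOsc_events (hX : Adapted ℱ X) (hXc : ∀ᵐ ω ∂P, Continuous fun t ↦ X t ω)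
    (hκ : 0 ≤ κ) (T : ℝ≥0) {f : ℕ → Ω → ℝ}
    (h : ∀ n δ, 0 < δ → ∫⁻ ω in smallOsc T X δ n, ENNReal.ofReal (f n ω) ∂P ≤
      ENNReal.ofReal (δ ^ 2 * (κ * T))) (δ : ℝ) (hδ : 0 < δ) :
    ∃ A : ℕ → Set Ω, (∀ n, MeasurableSet (A n)) ∧ (∀ᵐ ω ∂P, ∀ᶠ n in atTop, ω ∈ A n) ∧
      ∀ n, ∫⁻ ω in A n, ENNReal.ofReal (f n ω) ∂P ≤ ENNReal.ofReal δ := by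
  have hpos : 0 < √(δ / (κ * T + 1)) := Real.sqrt_pos.2 (by positivity)
  refine ⟨smallOsc T X √(δ / (κ * T + 1)), fun n ↦ measurableSet_smallOsc T
    (fun t ↦ (hX t).mono (ℱ.le t) le_rfl) _ n,
    hXc.mono fun ω hω ↦ eventually_mem_smallOsc T hω hpos, fun n ↦ (h n _ hpos).trans ?_⟩
  refine ENNReal.ofReal_le_ofReal ?_
  have : (0 : ℝ) ≤ κ * T := by positivity
  rw [Real.sq_sqrt (by positivity), div_mul_eq_mul_div, div_le_iff₀ (by positivity)]
  nlinarith

/-- The squares of the errors of the left-point approximations of an Itô integral are summable to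
`o(1)` in probability. -/
theorem IsItoIntegral.tendsto_sum_sq_itoRem [IsProbabilityMeasure P] (hI : IsItoIntegral P X w I)
    (hw : Adapted ℱ w) (hX : Adapted ℱ X) (hXc : ∀ᵐ ω ∂P, Continuous fun t ↦ X t ω)
    (hiso : IsometryBound P ℱ w κ) (hκ : 0 ≤ κ) (T : ℝ≥0) :
    TendstoInMeasure P (fun n ω ↦ ∑ i ∈ Finset.range (2 ^ n),
      itoRem T n (fun t ↦ X t ω) (fun t ↦ w t ω) (fun t ↦ I t ω) i ^ 2) atTop
      fun _ ↦ (0 : ℝ) := by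
  have hXm : ∀ t, Measurable (X t) := fun t ↦ (hX t).mono (ℱ.le t) le_rfl
  have hwm : ∀ t, Measurable (w t) := fun t ↦ (hw t).mono (ℱ.le t) le_rfl
  refine tendstoInMeasure_zero_of_setLIntegral_le
    (fun n ω ↦ Finset.sum_nonneg fun i _ ↦ sq_nonneg _)
    (fun n ↦ Finset.aemeasurable_fun_sum _ fun i _ ↦
      (hI.aemeasurable_itoRem hXm hwm T n i).pow_const 2) ?_
  exact exists_smallOsc_events hX hXc hκ T fun n δ hδ ↦
    hI.setLIntegral_sum_sq_itoRem_le hw hX hiso hκ T n hδ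

/-- The errors of the left-point approximations of an Itô integral, weighted by a bounded adapted
process, sum up to `o(1)` in probability. -/
theorem IsItoIntegral.tendsto_sq_sum_itoRem [IsProbabilityMeasure P] (hI : IsItoIntegral P X w I)
    (hw : Adapted ℱ w) (hX : Adapted ℱ X) (hXc : ∀ᵐ ω ∂P, Continuous fun t ↦ X t ω)
    (hiso : IsometryBound P ℱ w κ) (hκ : 0 ≤ κ)
    {c : ℝ≥0 → Ω → ℝ} (hc : Adapted ℱ c) (hc1 : ∀ t ω, |c t ω| ≤ 1) (T : ℝ≥0) :
    TendstoInMeasure P (fun n ω ↦ (∑ i ∈ Finset.range (2 ^ n), c (dyadicPt T n i) ω *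
      itoRem T n (fun t ↦ X t ω) (fun t ↦ w t ω) (fun t ↦ I t ω) i) ^ 2) atTop
      fun _ ↦ (0 : ℝ) := by
  have hXm : ∀ t, Measurable (X t) := fun t ↦ (hX t).mono (ℱ.le t) le_rfl
  have hwm : ∀ t, Measurable (w t) := fun t ↦ (hw t).mono (ℱ.le t) le_rfl
  have hcm : ∀ t, Measurable (c t) := fun t ↦ (hc t).mono (ℱ.le t) le_rfl
  refine tendstoInMeasure_zero_of_setLIntegral_le (fun n ω ↦ sq_nonneg _)
    (fun n ↦ (Finset.aemeasurable_fun_sum _ fun i _ ↦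
      (hcm _).aemeasurable.mul (hI.aemeasurable_itoRem hXm hwm T n i)).pow_const 2) ?_
  exact exists_smallOsc_events hX hXc hκ T fun n δ hδ ↦
    hI.setLIntegral_sq_sum_itoRem_le hw hX hiso hc hc1 T n hδ

end Remainder

end ItoRemainder

/-! ### Weak convergence of discrete measures -/

/-- Weak convergence of discrete measures: if the masses `a n i` are bounded in total variation and
their distribution functions tend to `0` at dyadic points, then the integrals of continuous
functions tend to `0`. -/
theorem tendsto_weighted_sum_zero {l : Filter ℕ} (hl : l ≤ atTop) {T : ℝ≥0} {g : ℝ≥0 → ℂ}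
    (hg : Continuous g) {G a : ℕ → ℕ → ℂ} {B : ℝ}
    (hG : ∀ ε : ℝ, 0 < ε → ∀ᶠ n in l, ∀ i < 2 ^ n, ‖G n i - g (dyadicPt T n i)‖ ≤ ε)
    (ha : ∀ᶠ n in l, ∑ i ∈ Finset.range (2 ^ n), ‖a n i‖ ≤ B)
    (hpart : ∀ K b : ℕ, b ≤ 2 ^ K →
      Tendsto (fun n ↦ ∑ i ∈ Finset.range (b * 2 ^ (n - K)), a n i) l (𝓝 0)) :
    Tendsto (fun n ↦ ∑ i ∈ Finset.range (2 ^ n), G n i * a n i) l (𝓝 0) := by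
  rw [NormedAddGroup.tendsto_nhds_zero]
  intro ε hε
  -- The function is frozen on the blocks of a level `K` at which it oscillates by at most `η`. The
  -- frozen sum involves only differences of distribution functions at dyadic points and tends to
  -- `0`; the rest costs `2 * η` times the total variation. Altogether this is less than `η + 2 * η
  -- * B`, at most `ε`.
  set η : ℝ := ε / (2 * |B| + 2) with hη
  have hη0 : 0 < η := by positivity
  obtain ⟨K, hK⟩ := (eventually_forall_dist_dyadicPt_le hg T hη0).exists
  have hblock : Tendsto (fun n ↦ ∑ b ∈ Finset.range (2 ^ K), g (dyadicPt T K b) *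
      (∑ i ∈ Finset.range ((b + 1) * 2 ^ (n - K)), a n i -
        ∑ i ∈ Finset.range (b * 2 ^ (n - K)), a n i)) l (𝓝 0) := by
    have : Tendsto (fun n ↦ ∑ b ∈ Finset.range (2 ^ K), g (dyadicPt T K b) *
        (∑ i ∈ Finset.range ((b + 1) * 2 ^ (n - K)), a n i -
          ∑ i ∈ Finset.range (b * 2 ^ (n - K)), a n i)) l
        (𝓝 (∑ b ∈ Finset.range (2 ^ K), g (dyadicPt T K b) * (0 - 0))) := by
      refine tendsto_finsetSum _ fun b hb ↦ Tendsto.const_mul _ ?_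
      have hb' := Finset.mem_range.1 hb
      exact (hpart K (b + 1) hb').sub (hpart K b hb'.le)
    simpa using this
  filter_upwards [NormedAddGroup.tendsto_nhds_zero.1 hblock η hη0, hG η hη0, ha,
    hl (eventually_ge_atTop K)] with n h1 h2 h3 h4
  obtain ⟨m, rfl⟩ := Nat.exists_eq_add_of_le h4
  rw [Nat.add_sub_cancel_left] at h1
  have hdiff : ∑ i ∈ Finset.range (2 ^ (K + m)), G (K + m) i * a (K + m) i =
      (∑ b ∈ Finset.range (2 ^ K), g (dyadicPt T K b) *
        (∑ i ∈ Finset.range ((b + 1) * 2 ^ m), a (K + m) i -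
          ∑ i ∈ Finset.range (b * 2 ^ m), a (K + m) i)) +
      ∑ b ∈ Finset.range (2 ^ K), ∑ r ∈ Finset.range (2 ^ m),
        (G (K + m) (b * 2 ^ m + r) - g (dyadicPt T K b)) * a (K + m) (b * 2 ^ m + r) := by
    rw [pow_add, sum_range_mul_eq, ← Finset.sum_add_distrib]
    refine Finset.sum_congr rfl fun b _ ↦ ?_
    rw [Nat.succ_mul, Finset.sum_range_add, add_sub_cancel_left, Finset.mul_sum,
      ← Finset.sum_add_distrib]
    exact Finset.sum_congr rfl fun r _ ↦ by ring
  have hrest : ‖∑ b ∈ Finset.range (2 ^ K), ∑ r ∈ Finset.range (2 ^ m),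
      (G (K + m) (b * 2 ^ m + r) - g (dyadicPt T K b)) * a (K + m) (b * 2 ^ m + r)‖ ≤
      2 * η * B := by
    calc _ ≤ ∑ b ∈ Finset.range (2 ^ K), ∑ r ∈ Finset.range (2 ^ m),
          2 * η * ‖a (K + m) (b * 2 ^ m + r)‖ := by
          refine norm_sum_le_of_le _ fun b hb ↦ norm_sum_le_of_le _ fun r hr ↦ ?_
          rw [norm_mul]
          refine mul_le_mul_of_nonneg_right ?_ (norm_nonneg _)
          have hb' := Finset.mem_range.1 hb
          have hr' := Finset.mem_range.1 hr
          have hlt : b * 2 ^ m + r < (b + 1) * 2 ^ m := by rw [Nat.succ_mul]; omega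
          have hlt' : b * 2 ^ m + r < 2 ^ (K + m) := by
            rw [pow_add]
            exact hlt.trans_le (Nat.mul_le_mul_right _ hb')
          have e1 := h2 _ hlt'
          have e2 := hK b hb' (dyadicPt T (K + m) (b * 2 ^ m + r))
            (by rw [← dyadicPt_refine T K m b]; exact dyadicPt_mono _ _ (Nat.le_add_right _ _))
            (by rw [← dyadicPt_refine T K m (b + 1)]; exact dyadicPt_mono _ _ hlt.le)
          rw [dist_eq_norm] at e2
          calc _ = ‖(G (K + m) (b * 2 ^ m + r) - g (dyadicPt T (K + m) (b * 2 ^ m + r))) +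
                (g (dyadicPt T (K + m) (b * 2 ^ m + r)) - g (dyadicPt T K b))‖ := by
                congr 1; ring
            _ ≤ η + η := (norm_add_le _ _).trans (add_le_add e1 e2)
            _ = 2 * η := by ring
      _ = 2 * η * ∑ i ∈ Finset.range (2 ^ (K + m)), ‖a (K + m) i‖ := by
          rw [pow_add, sum_range_mul_eq, Finset.mul_sum]
          simp only [Finset.mul_sum]
      _ ≤ 2 * η * B := mul_le_mul_of_nonneg_left h3 (by positivity)
  rw [hdiff]
  calc _ ≤ _ := norm_add_le _ _
    _ < η + 2 * η * B := add_lt_add_of_lt_of_le h1 hrest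
    _ ≤ η * (2 * |B| + 2) := by nlinarith [le_abs_self B]
    _ = ε := by rw [hη]; field_simp

/-- The local error of the trapezoidal rule for `e ^ {i x}`. -/
theorem norm_exp_trapezoid_le {x : ℝ} (hx : |x| ≤ 1) :
    ‖Complex.exp (Complex.I * x) - 1 -
      Complex.I * x * ((1 + Complex.exp (Complex.I * x)) / 2)‖ ≤ |x| ^ 3 := by
  set z : ℂ := Complex.I * x with hz
  have hzn : ‖z‖ = |x| := by simp [hz]
  have hb := Complex.exp_bound (x := z) (by rw [hzn]; exact hx) (n := 3) (by norm_num)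
  simp only [Finset.sum_range_succ, Finset.sum_range_zero, hzn] at hb
  norm_num [Nat.factorial] at hb
  -- The Taylor polynomial `1 + z + z² / 2` satisfies the trapezoidal rule up to `-z³ / 4`. With the
  -- Taylor remainder `2/9 |x|³` and the factor `3/2` the total is `(1/3 + 1/4) |x|³`.
  have hid : Complex.exp z - 1 - z * ((1 + Complex.exp z) / 2) =
      (Complex.exp z - (1 + z + z ^ 2 / 2)) * (1 - z / 2) - z ^ 3 / 4 := by ring
  rw [hid]
  have h1 : ‖1 - z / 2‖ ≤ 3 / 2 := by
    refine (norm_sub_le _ _).trans ?_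
    rw [norm_div, hzn]
    norm_num
    linarith
  have h2 : ‖z ^ 3 / 4‖ = |x| ^ 3 / 4 := by rw [norm_div, norm_pow, hzn]; norm_num
  refine (norm_sub_le _ _).trans ?_
  rw [norm_mul, h2]
  have h3 : (0 : ℝ) ≤ |x| ^ 3 := by positivity
  nlinarith [mul_le_mul hb h1 (norm_nonneg _) (by positivity)]

theorem norm_exp_I_mul_sub_le (x y : ℝ) :
    ‖Complex.exp (Complex.I * x) - Complex.exp (Complex.I * y)‖ ≤ |x - y| := by
  have h : Complex.exp (Complex.I * x) - Complex.exp (Complex.I * y) =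
      Complex.exp (Complex.I * y) * (Complex.exp (Complex.I * (x - y : ℝ)) - 1) := by
    rw [mul_sub, ← Complex.exp_add]
    push_cast
    ring_nf
  rw [h, norm_mul, Complex.norm_exp_I_mul_ofReal, one_mul]
  simpa using Real.norm_exp_I_mul_ofReal_sub_one_le (x := x - y)

/-! ### The gauge transform of a path -/

/-- The mean of the values of `g` at the ends of the `i`-th dyadic interval. -/
noncomputable def dyadicAvg (T : ℝ≥0) (n : ℕ) (g : ℝ≥0 → ℂ) (i : ℕ) : ℂ :=
  (g (dyadicPt T n i) + g (dyadicPt T n (i + 1))) / 2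

theorem eventually_forall_norm_dyadicAvg_sub_le {g : ℝ≥0 → ℂ} (hg : Continuous g) (T : ℝ≥0) {ε : ℝ}
    (hε : 0 < ε) : ∀ᶠ n in atTop, ∀ i < 2 ^ n, ∀ s, dyadicPt T n i ≤ s →
      s ≤ dyadicPt T n (i + 1) → ‖dyadicAvg T n g i - g s‖ ≤ ε := by
  filter_upwards [eventually_forall_dist_dyadicPt_le hg T (half_pos hε)] with n hn i hi s h1 h2
  have e1 := hn i hi s h1 h2
  have e2 := hn i hi _ (dyadicPt_mono T n i.le_succ) le_rfl
  rw [dist_eq_norm] at e1 e2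
  have hid : dyadicAvg T n g i - g s =
      (g (dyadicPt T n (i + 1)) - g (dyadicPt T n i)) / 2 - (g s - g (dyadicPt T n i)) := by
    unfold dyadicAvg; ring
  rw [hid]
  refine (norm_sub_le _ _).trans ?_
  rw [norm_div, Complex.norm_ofNat]
  linarith

/-- Riemann-Stieltjes sums against a primitive. -/
theorem tendsto_sum_dyadicAvg_mul_integral {g : ℝ≥0 → ℂ} (hg : Continuous g) {H : ℝ → ℂ}
    (hH : Continuous H) (T : ℝ≥0) :
    Tendsto (fun n ↦ ∑ i ∈ Finset.range (2 ^ n), dyadicAvg T n g i *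
      dyadicIncr T n (fun t ↦ ∫ s in (0 : ℝ)..t, H s) i) atTop
      (𝓝 (∫ s in (0 : ℝ)..T, g s.toNNReal * H s)) := by
  rw [tendsto_iff_norm_sub_tendsto_zero, NormedAddGroup.tendsto_nhds_zero]
  intro ε hε
  obtain ⟨M, hM⟩ := (isCompact_Icc (a := (0 : ℝ)) (b := T)).exists_bound_of_continuousOn
    hH.continuousOn
  set η : ℝ := ε / (|M| * T + 1) with hη
  have hη0 : 0 < η := by positivity
  have hgH : Continuous fun s : ℝ ↦ g s.toNNReal * H s :=
    (hg.comp continuous_real_toNNReal).mul hH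
  filter_upwards [eventually_forall_norm_dyadicAvg_sub_le hg T hη0] with n hn
  rw [norm_norm]
  have hsum : ∫ s in (0 : ℝ)..T, g s.toNNReal * H s = ∑ i ∈ Finset.range (2 ^ n),
      ∫ s in (dyadicPt T n i : ℝ)..(dyadicPt T n (i + 1)), g s.toNNReal * H s := by
    rw [intervalIntegral.sum_integral_adjacent_intervals
      (a := fun i ↦ (dyadicPt T n i : ℝ)) fun k _ ↦ hgH.intervalIntegrable _ _,
      dyadicPt_zero, dyadicPt_last, NNReal.coe_zero]
  have hterm : ∀ i ∈ Finset.range (2 ^ n), ‖dyadicAvg T n g i *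
      dyadicIncr T n (fun t ↦ ∫ s in (0 : ℝ)..t, H s) i -
      ∫ s in (dyadicPt T n i : ℝ)..(dyadicPt T n (i + 1)), g s.toNNReal * H s‖ ≤
      η * |M| * ((dyadicPt T n (i + 1) : ℝ) - dyadicPt T n i) := by
    intro i hi
    have hle : (dyadicPt T n i : ℝ) ≤ dyadicPt T n (i + 1) := by
      exact_mod_cast dyadicPt_mono T n i.le_succ
    have hc : Continuous fun s ↦ dyadicAvg T n g i * H s := continuous_const.mul hH
    rw [dyadicIncr, intervalIntegral.integral_interval_sub_left (hH.intervalIntegrable _ _)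
      (hH.intervalIntegrable _ _), ← intervalIntegral.integral_const_mul,
      ← intervalIntegral.integral_sub (hc.intervalIntegrable _ _) (hgH.intervalIntegrable _ _)]
    refine (intervalIntegral.norm_integral_le_of_norm_le_const (C := η * |M|)
      fun s hs ↦ ?_).trans_eq (by rw [abs_of_nonneg (sub_nonneg.2 hle)])
    rw [Set.uIoc_of_le hle] at hs
    have hs0 : 0 ≤ s := (NNReal.coe_nonneg _).trans hs.1.le
    have hsT : s ≤ T := hs.2.trans (by exact_mod_cast dyadicPt_le (Finset.mem_range.1 hi))
    rw [← sub_mul, norm_mul]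
    refine mul_le_mul (hn i (Finset.mem_range.1 hi) _ ?_ ?_)
      ((hM s ⟨hs0, hsT⟩).trans (le_abs_self M)) (norm_nonneg _) hη0.le
    · exact NNReal.le_toNNReal_of_coe_le hs.1.le
    · exact Real.toNNReal_le_iff_le_coe.2 hs.2
  rw [hsum, ← Finset.sum_sub_distrib]
  calc _ ≤ ∑ i ∈ Finset.range (2 ^ n),
        η * |M| * ((dyadicPt T n (i + 1) : ℝ) - dyadicPt T n i) := norm_sum_le_of_le _ hterm
    _ = η * |M| * T := by
        rw [← Finset.mul_sum, Finset.sum_range_sub (fun i ↦ (dyadicPt T n i : ℝ)), dyadicPt_zero,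
          dyadicPt_last, NNReal.coe_zero, sub_zero]
    _ < ε := by
        rw [hη, mul_assoc, div_mul_eq_mul_div, div_lt_iff₀ (by positivity)]
        nlinarith

/-- Sums of products tend to `0` if one of the factors is bounded and the other one tends to `0` in
the quadratic mean. -/
theorem tendsto_sum_mul_zero_of_sq {l : Filter ℕ} {x : ℕ → ℕ → ℂ} {r : ℕ → ℕ → ℂ} {B : ℝ}
    (hx : ∀ᶠ n in l, ∑ i ∈ Finset.range (2 ^ n), ‖x n i‖ ^ 2 ≤ B)
    (hr : Tendsto (fun n ↦ ∑ i ∈ Finset.range (2 ^ n), ‖r n i‖ ^ 2) l (𝓝 0)) :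
    Tendsto (fun n ↦ ∑ i ∈ Finset.range (2 ^ n), x n i * r n i) l (𝓝 0) := by
  have h0 : Tendsto (fun n ↦ √B * √(∑ i ∈ Finset.range (2 ^ n), ‖r n i‖ ^ 2)) l (𝓝 0) := by
    have := (hr.sqrt).const_mul √B
    simpa using this
  refine squeeze_zero_norm' ?_ h0
  filter_upwards [hx] with n hn
  calc _ ≤ ∑ i ∈ Finset.range (2 ^ n), ‖x n i‖ * ‖r n i‖ :=
        norm_sum_le_of_le _ fun i _ ↦ (norm_mul _ _).le
    _ ≤ √(∑ i ∈ Finset.range (2 ^ n), ‖x n i‖ ^ 2) * √(∑ i ∈ Finset.range (2 ^ n), ‖r n i‖ ^ 2) :=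
        Real.sum_mul_le_sqrt_mul_sqrt _ _ _
    _ ≤ _ := by gcongr

section Gauge

variable {l : Filter ℕ} {T : ℝ≥0} {u C J : ℝ≥0 → ℂ} {w : ℝ≥0 → ℝ} {H : ℝ → ℂ} {u₀ : ℂ} {V B : ℝ}

/-- The error of the left-point approximation of the integral path `J` of `u` against `w`. -/
noncomputable def itoRemC (T : ℝ≥0) (n : ℕ) (u : ℝ≥0 → ℂ) (w : ℝ≥0 → ℝ) (J : ℝ≥0 → ℂ) (i : ℕ) : ℂ :=
  dyadicIncr T n J i - u (dyadicPt T n i) * dyadicIncr T n w i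

theorem dyadicIncr_path (heq : ∀ t : ℝ≥0,
    u t = u₀ + (∫ s in (0 : ℝ)..t, H s) - Complex.I * (J t + C t / 2)) (n i : ℕ) :
    dyadicIncr T n u i = dyadicIncr T n (fun t ↦ ∫ s in (0 : ℝ)..t, H s) i -
      Complex.I * (itoRemC T n u w J i + u (dyadicPt T n i) * dyadicIncr T n w i +
        dyadicIncr T n C i / 2) := by
  simp only [itoRemC, dyadicIncr]
  linear_combination heq (dyadicPt T n (i + 1)) - heq (dyadicPt T n i)

/-- The products of the increments of a solution path and of the driving path have bounded sums. -/
theorem exists_eventually_sum_norm_incr_mul_le (hu : Continuous u)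
    (hH : Continuous H)
    (heq : ∀ t : ℝ≥0, u t = u₀ + (∫ s in (0 : ℝ)..t, H s) - Complex.I * (J t + C t / 2))
    (hCV : ∀ n, ∑ i ∈ Finset.range (2 ^ n), ‖dyadicIncr T n C i‖ ≤ V)
    (hQV : ∀ᶠ n in l, ∑ i ∈ Finset.range (2 ^ n), dyadicIncr T n w i ^ 2 ≤ B)
    (hR : Tendsto (fun n ↦ ∑ i ∈ Finset.range (2 ^ n), ‖itoRemC T n u w J i‖ ^ 2) l (𝓝 0)) :
    ∃ B' : ℝ, ∀ᶠ n in l, ∑ i ∈ Finset.range (2 ^ n),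
      ‖dyadicIncr T n u i * ((dyadicIncr T n w i : ℝ) : ℂ)‖ ≤ B' := by
  obtain ⟨M, hM⟩ := (isCompact_Icc (a := (0 : ℝ)) (b := T)).exists_bound_of_continuousOn
    hH.continuousOn
  obtain ⟨Mu, hMu⟩ := (isCompact_Icc (a := (0 : ℝ≥0)) (b := T)).exists_bound_of_continuousOn
    hu.continuousOn
  set A : ℝ≥0 → ℂ := fun t ↦ ∫ s in (0 : ℝ)..t, H s with hA
  have hAle : ∀ n, ∑ i ∈ Finset.range (2 ^ n), ‖dyadicIncr T n A i‖ ≤ |M| * T := by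
    intro n
    calc _ ≤ ∑ i ∈ Finset.range (2 ^ n),
          |M| * ((dyadicPt T n (i + 1) : ℝ) - dyadicPt T n i) := by
          refine Finset.sum_le_sum fun i hi ↦ ?_
          have hle : (dyadicPt T n i : ℝ) ≤ dyadicPt T n (i + 1) := by
            exact_mod_cast dyadicPt_mono T n i.le_succ
          rw [hA, dyadicIncr, intervalIntegral.integral_interval_sub_left
            (hH.intervalIntegrable _ _) (hH.intervalIntegrable _ _)]
          refine (intervalIntegral.norm_integral_le_of_norm_le_const (C := |M|)
            fun s hs ↦ ?_).trans_eq (by rw [abs_of_nonneg (sub_nonneg.2 hle)])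
          rw [Set.uIoc_of_le hle] at hs
          exact (hM s ⟨(NNReal.coe_nonneg _).trans hs.1.le, hs.2.trans
            (by exact_mod_cast dyadicPt_le (Finset.mem_range.1 hi))⟩).trans (le_abs_self M)
      _ = |M| * T := by
          rw [← Finset.mul_sum, Finset.sum_range_sub (fun i ↦ (dyadicPt T n i : ℝ)),
            dyadicPt_zero, dyadicPt_last, NNReal.coe_zero, sub_zero]
  have hsq : ∀ (x : ℕ → ℂ) (n : ℕ) (c : ℝ), ∑ i ∈ Finset.range (2 ^ n), ‖x i‖ ≤ c →
      ∑ i ∈ Finset.range (2 ^ n), ‖x i‖ ^ 2 ≤ c ^ 2 := fun x n c h ↦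
    (Finset.sum_sq_le_sq_sum_of_nonneg fun i _ ↦ norm_nonneg _).trans
      (pow_le_pow_left₀ (Finset.sum_nonneg fun i _ ↦ norm_nonneg _) h 2)
  -- Young's inequality is applied to each of the four parts of the increment of `u` times the
  -- increment of `w`. Squares of the bounded variation parts sum to at most the square of their
  -- total variation; the `1` bounds the squared remainders, which tend to `0`.
  refine ⟨2 * ((|M| * T) ^ 2 + 1 + Mu ^ 2 * B + V ^ 2) + B, ?_⟩
  filter_upwards [hQV, hR.eventually_le_const one_pos] with n h1 h2
  have hterm : ∀ i ∈ Finset.range (2 ^ n), ‖dyadicIncr T n u i * ((dyadicIncr T n w i : ℝ) : ℂ)‖ ≤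
      2 * (‖dyadicIncr T n A i‖ ^ 2 + ‖itoRemC T n u w J i‖ ^ 2 +
        Mu ^ 2 * dyadicIncr T n w i ^ 2 + ‖dyadicIncr T n C i‖ ^ 2) + dyadicIncr T n w i ^ 2 := by
    intro i hi
    have hb : ‖dyadicIncr T n u i‖ ≤ ‖dyadicIncr T n A i‖ + (‖itoRemC T n u w J i‖ +
        Mu * |dyadicIncr T n w i| + ‖dyadicIncr T n C i‖ / 2) := by
      rw [dyadicIncr_path (w := w) heq]
      refine (norm_sub_le _ _).trans (add_le_add le_rfl ?_)
      rw [norm_mul, Complex.norm_I, one_mul]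
      refine (norm_add_le _ _).trans (add_le_add ((norm_add_le _ _).trans
        (add_le_add le_rfl ?_)) (by simp))
      rw [norm_mul, Complex.norm_real, Real.norm_eq_abs]
      exact mul_le_mul_of_nonneg_right
        (hMu _ ⟨zero_le, dyadicPt_le (Finset.mem_range.1 hi).le⟩) (abs_nonneg _)
    rw [norm_mul, Complex.norm_real, Real.norm_eq_abs, ← sq_abs (dyadicIncr T n w i)]
    have ha := abs_nonneg (dyadicIncr T n w i)
    generalize |dyadicIncr T n w i| = d at *
    generalize ‖dyadicIncr T n A i‖ = x1 at *
    generalize ‖itoRemC T n u w J i‖ = x2 at *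
    generalize ‖dyadicIncr T n C i‖ = x4 at *
    generalize ‖dyadicIncr T n u i‖ = x0 at *
    have h3 : x0 * d ≤ (x1 + (x2 + Mu * d + x4 / 2)) * d := mul_le_mul_of_nonneg_right hb ha
    nlinarith [sq_nonneg (x1 - d / 4), sq_nonneg (x2 - d / 4), sq_nonneg (Mu * d - d / 4),
      sq_nonneg (x4 - d / 4), sq_nonneg d]
  refine (Finset.sum_le_sum hterm).trans ?_
  simp only [Finset.sum_add_distrib, ← Finset.mul_sum]
  have e1 := hsq _ n _ (hAle n)
  have e2 := hsq _ n _ (hCV n)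
  have e3 := mul_le_mul_of_nonneg_left h1 (sq_nonneg Mu)
  linarith

/-- Removal of the Stratonovich noise by a change of phase: a path `u` that solves
`du = H dt - i u ∘ dw` satisfies `d(e^{iw} u) = e^{iw} H dt`. -/
theorem exp_mul_path_sub [l.NeBot] (hl : l ≤ atTop) (hu : Continuous u) (hw : Continuous w)
    (hH : Continuous H)
    (heq : ∀ t : ℝ≥0, u t = u₀ + (∫ s in (0 : ℝ)..t, H s) - Complex.I * (J t + C t / 2))
    (hCV : ∀ n, ∑ i ∈ Finset.range (2 ^ n), ‖dyadicIncr T n C i‖ ≤ V)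
    (hQV : ∀ᶠ n in l, ∑ i ∈ Finset.range (2 ^ n), dyadicIncr T n w i ^ 2 ≤ B)
    (hR : Tendsto (fun n ↦ ∑ i ∈ Finset.range (2 ^ n), ‖itoRemC T n u w J i‖ ^ 2) l (𝓝 0))
    (hER : Tendsto (fun n ↦ ∑ i ∈ Finset.range (2 ^ n),
      Complex.exp (Complex.I * w (dyadicPt T n i)) * itoRemC T n u w J i) l (𝓝 0))
    (hCov : ∀ K b : ℕ, b ≤ 2 ^ K → Tendsto (fun n ↦ ∑ i ∈ Finset.range (b * 2 ^ (n - K)),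
      dyadicIncr T n u i * ((dyadicIncr T n w i : ℝ) : ℂ)) l (𝓝 (C (dyadicPt T K b)))) :
    Complex.exp (Complex.I * w T) * u T - Complex.exp (Complex.I * w 0) * u 0 =
      ∫ s in (0 : ℝ)..T, Complex.exp (Complex.I * w s.toNNReal) * H s := by
  set E : ℝ≥0 → ℂ := fun t ↦ Complex.exp (Complex.I * w t) with hE
  have hEc : Continuous E := by fun_prop
  set A : ℝ≥0 → ℂ := fun t ↦ ∫ s in (0 : ℝ)..t, H s with hA
  have hEincr : ∀ n i, ‖dyadicIncr T n E i‖ ≤ |dyadicIncr T n w i| := fun n i ↦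
    norm_exp_I_mul_sub_le _ _
  have hsmall : ∀ ε : ℝ, 0 < ε → ∀ᶠ n in l, ∀ i < 2 ^ n, |dyadicIncr T n w i| ≤ ε := by
    intro ε hε
    filter_upwards [hl (eventually_forall_dist_dyadicPt_le hw T hε)] with n hn i hi
    exact hn i hi _ (dyadicPt_mono T n i.le_succ) le_rfl
  -- Write `Δ` for increments, `Ē` and `ū` for endpoint means and `R` for the Itô remainder.
  -- Exactly, `Δ(E u) = ū ΔE + Ē Δu`. Inserting the equation for `Δu`, `ΔE ≈ i Ē Δw` and `ū = u + Δu
  -- / 2`, the terms `u Δw` cancel. There remain `Ē ΔA` (`hS1`), `-i Ē R` (`hS2`), the covariation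
  -- defect `-(i/2) Ē (ΔC - Δu Δw)` (`hS3`) and the error made in `ΔE` (`hS4`). Only the first
  -- survives in the limit.
  have hS1 := (tendsto_sum_dyadicAvg_mul_integral hEc hH T).mono_left hl
  -- The mean `Ē` is not adapted, so it is split as `E + ΔE / 2`. The adapted part is `hER`; the
  -- other one is handled by Cauchy-Schwarz, because `|ΔE| ≤ |Δw|`.
  have hS2 : Tendsto (fun n ↦ ∑ i ∈ Finset.range (2 ^ n),
      dyadicAvg T n E i * itoRemC T n u w J i) l (𝓝 0) := by
    have h1 := tendsto_sum_mul_zero_of_sq (x := fun n i ↦ dyadicIncr T n E i)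
      (r := fun n i ↦ itoRemC T n u w J i) (B := B) ?_ hR
    · have := hER.add (h1.div_const 2)
      rw [zero_div, add_zero] at this
      refine this.congr fun n ↦ ?_
      rw [Finset.sum_div, ← Finset.sum_add_distrib]
      refine Finset.sum_congr rfl fun i _ ↦ ?_
      simp only [dyadicAvg, dyadicIncr, hE]
      ring
    · filter_upwards [hQV] with n hn
      refine (Finset.sum_le_sum fun i _ ↦ ?_).trans hn
      rw [← sq_abs (dyadicIncr T n w i)]
      exact pow_le_pow_left₀ (norm_nonneg _) (hEincr n i) 2
  obtain ⟨B', hB'⟩ := exists_eventually_sum_norm_incr_mul_le hu hH heq hCV hQV hR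
  -- For `b = 0` the covariation sums are empty.
  have hC0 : C 0 = 0 := by
    have := hCov 0 0 (Nat.zero_le _)
    simp only [zero_mul, Finset.range_zero, Finset.sum_empty, dyadicPt_zero] at this
    exact tendsto_nhds_unique this tendsto_const_nhds
  -- The masses `ΔC - Δu Δw` have bounded total variation, and by the definition of the covariation
  -- their distribution functions vanish in the limit at dyadic points: weak convergence to `0`.
  have hS3 : Tendsto (fun n ↦ ∑ i ∈ Finset.range (2 ^ n), dyadicAvg T n E i *
      (dyadicIncr T n C i - dyadicIncr T n u i * ((dyadicIncr T n w i : ℝ) : ℂ))) l (𝓝 0) := by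
    refine tendsto_weighted_sum_zero hl (T := T) hEc (B := V + B') (fun ε hε ↦ ?_) ?_ ?_
    · filter_upwards [hl (eventually_forall_norm_dyadicAvg_sub_le hEc T hε)] with n hn i hi
      exact hn i hi _ le_rfl (dyadicPt_mono T n i.le_succ)
    · filter_upwards [hB'] with n hn
      refine (Finset.sum_le_sum fun i _ ↦ norm_sub_le _ _).trans ?_
      rw [Finset.sum_add_distrib]
      exact add_le_add (hCV n) hn
    · intro K b hb
      have := (hCov K b hb).const_sub (C (dyadicPt T K b))
      rw [sub_self] at this
      refine this.congr' ?_
      filter_upwards [hl (eventually_ge_atTop K)] with n hn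
      rw [Finset.sum_sub_distrib]
      simp only [dyadicIncr]
      rw [Finset.sum_range_sub (fun i ↦ C (dyadicPt T n i)), dyadicPt_zero, hC0, sub_zero]
      obtain ⟨m, rfl⟩ := Nat.exists_eq_add_of_le hn
      rw [Nat.add_sub_cancel_left, dyadicPt_refine]
  -- The trapezoidal error is cubic in `Δw`, so the sum is at most a constant times `sup |Δw|` times
  -- the bounded quadratic variation sum.
  have hS4 : Tendsto (fun n ↦ ∑ i ∈ Finset.range (2 ^ n), dyadicAvg T n u i *
      (dyadicIncr T n E i - Complex.I * dyadicAvg T n E i * dyadicIncr T n w i)) l (𝓝 0) := by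
    obtain ⟨Mu, hMu⟩ := (isCompact_Icc (a := (0 : ℝ≥0)) (b := T)).exists_bound_of_continuousOn
      hu.continuousOn
    have hMu0 : 0 ≤ Mu := (norm_nonneg _).trans (hMu 0 ⟨le_rfl, zero_le⟩)
    rw [NormedAddGroup.tendsto_nhds_zero]
    intro ε hε
    set η : ℝ := min 1 (ε / (Mu * |B| + 1)) with hη
    have hη0 : 0 < η := lt_min one_pos (by positivity)
    filter_upwards [hsmall η hη0, hQV] with n h1 h2
    have hterm : ∀ i ∈ Finset.range (2 ^ n), ‖dyadicAvg T n u i *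
        (dyadicIncr T n E i - Complex.I * dyadicAvg T n E i * dyadicIncr T n w i)‖ ≤
        Mu * η * dyadicIncr T n w i ^ 2 := by
      intro i hi
      have hi' := Finset.mem_range.1 hi
      have hui : ‖dyadicAvg T n u i‖ ≤ Mu := by
        rw [dyadicAvg, norm_div, Complex.norm_ofNat]
        have e1 := hMu (dyadicPt T n i) ⟨zero_le, dyadicPt_le hi'.le⟩
        have e2 := hMu (dyadicPt T n (i + 1)) ⟨zero_le, dyadicPt_le hi'⟩
        have := norm_add_le (u (dyadicPt T n i)) (u (dyadicPt T n (i + 1)))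
        linarith
      have hid : dyadicIncr T n E i - Complex.I * dyadicAvg T n E i * dyadicIncr T n w i =
          E (dyadicPt T n i) * (Complex.exp (Complex.I * (dyadicIncr T n w i : ℝ)) - 1 -
            Complex.I * (dyadicIncr T n w i : ℝ) *
              ((1 + Complex.exp (Complex.I * (dyadicIncr T n w i : ℝ))) / 2)) := by
        have hmul : E (dyadicPt T n (i + 1)) =
            E (dyadicPt T n i) * Complex.exp (Complex.I * (dyadicIncr T n w i : ℝ)) := by
          simp only [hE, dyadicIncr]
          rw [← Complex.exp_add]
          push_cast
          ring_nf
        simp only [dyadicAvg]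
        rw [dyadicIncr, hmul]
        ring
      have hE1 : ‖E (dyadicPt T n i)‖ = 1 := Complex.norm_exp_I_mul_ofReal _
      rw [norm_mul, hid, norm_mul, hE1, one_mul, mul_assoc Mu]
      refine mul_le_mul hui ?_ (norm_nonneg _) hMu0
      refine (norm_exp_trapezoid_le ((h1 i hi').trans (min_le_left _ _))).trans ?_
      rw [← sq_abs (dyadicIncr T n w i), pow_succ, mul_comm]
      exact mul_le_mul_of_nonneg_right (h1 i hi') (by positivity)
    calc _ ≤ ∑ i ∈ Finset.range (2 ^ n), Mu * η * dyadicIncr T n w i ^ 2 :=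
          norm_sum_le_of_le _ hterm
      _ ≤ Mu * η * B := by
          rw [← Finset.mul_sum]
          exact mul_le_mul_of_nonneg_left h2 (by positivity)
      _ ≤ Mu * |B| * η := by nlinarith [le_abs_self B, mul_nonneg hMu0 hη0.le]
      _ ≤ Mu * |B| * (ε / (Mu * |B| + 1)) :=
          mul_le_mul_of_nonneg_left (min_le_right _ _) (by positivity)
      _ < ε := by
          rw [mul_div_assoc', div_lt_iff₀ (by positivity)]
          nlinarith
  have hlim := ((hS1.sub (hS2.const_mul Complex.I)).sub
    (hS3.const_mul (Complex.I / 2))).add hS4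
  simp only [mul_zero, sub_zero, add_zero] at hlim
  refine tendsto_nhds_unique (tendsto_const_nhds.congr fun n ↦ ?_) hlim
  have htel : E T * u T - E 0 * u 0 =
      ∑ i ∈ Finset.range (2 ^ n), dyadicIncr T n (fun t ↦ E t * u t) i := by
    simp only [dyadicIncr]
    rw [Finset.sum_range_sub (fun i ↦ E (dyadicPt T n i) * u (dyadicPt T n i)), dyadicPt_zero,
      dyadicPt_last]
  change E T * u T - E 0 * u 0 = _
  rw [htel, Finset.mul_sum, Finset.mul_sum, ← Finset.sum_sub_distrib, ← Finset.sum_sub_distrib,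
    ← Finset.sum_add_distrib]
  refine Finset.sum_congr rfl fun i _ ↦ ?_
  have hprod : dyadicIncr T n (fun t ↦ E t * u t) i =
      dyadicAvg T n u i * dyadicIncr T n E i + dyadicAvg T n E i * dyadicIncr T n u i := by
    simp only [dyadicAvg, dyadicIncr]; ring
  have hup : dyadicAvg T n u i = u (dyadicPt T n i) + dyadicIncr T n u i / 2 := by
    simp only [dyadicAvg, dyadicIncr]; ring
  have hpath := dyadicIncr_path (T := T) (w := w) heq n i
  rw [hprod]
  linear_combination (dyadicAvg T n E i) * hpath +
    Complex.I * dyadicAvg T n E i * ((dyadicIncr T n w i : ℝ) : ℂ) * hup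

end Gauge

/-! ### The gauge transform of a semimartingale -/

section GaugedProcess

variable {Ω : Type*} {mΩ : MeasurableSpace Ω} {P : Measure Ω}

theorem exists_sum_abs_dyadicIncr_le {f : ℝ≥0 → ℝ} (hf : LocallyBoundedVariationOn f Set.univ)
    (T : ℝ≥0) : ∃ V : ℝ, ∀ n, ∑ i ∈ Finset.range (2 ^ n), |dyadicIncr T n f i| ≤ V := by
  have hfin := hf 0 T (Set.mem_univ _) (Set.mem_univ _)
  refine ⟨(eVariationOn f (Set.univ ∩ Set.Icc 0 T)).toReal, fun n ↦ ?_⟩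
  have h := eVariationOn.sum_le_of_monotoneOn_Iic (f := f) (s := Set.univ ∩ Set.Icc 0 T)
    (n := 2 ^ n) (u := dyadicPt T n) ((dyadicPt_mono T n).monotoneOn _)
    fun i hi ↦ ⟨Set.mem_univ _, zero_le, dyadicPt_le hi⟩
  rw [← ENNReal.ofReal_le_iff_le_toReal hfin, ENNReal.ofReal_sum_of_nonneg fun i _ ↦ abs_nonneg _]
  refine le_trans (Finset.sum_le_sum fun i _ ↦ ?_) h
  rw [edist_dist]
  rfl

/-- The expected quadratic variation sums of the noise are bounded. -/
theorem IsometryBound.lintegral_sum_sq_incr_le {ℱ : Filtration ℝ≥0 mΩ} {w : ℝ≥0 → Ω → ℝ} {κ : ℝ}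
    (hiso : IsometryBound P ℱ w κ) (hκ : 0 ≤ κ) (hw : Adapted ℱ w) (T : ℝ≥0) (n : ℕ) :
    ∫⁻ ω, ENNReal.ofReal (∑ i ∈ Finset.range (2 ^ n), dyadicIncr T n (fun t ↦ w t ω) i ^ 2) ∂P ≤
      ENNReal.ofReal (κ * T) := by
  have hwm : ∀ t, Measurable (w t) := fun t ↦ (hw t).mono (ℱ.le t) le_rfl
  have hm : ∀ i, Measurable fun ω ↦ ENNReal.ofReal (dyadicIncr T n (fun t ↦ w t ω) i ^ 2) :=
    fun i ↦ (((hwm _).sub (hwm _)).pow_const 2).ennreal_ofReal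
  simp only [ENNReal.ofReal_sum_of_nonneg fun i _ ↦ sq_nonneg _]
  rw [lintegral_finsetSum _ fun i _ ↦ hm i]
  calc _ ≤ ∑ i ∈ Finset.range (2 ^ n),
        ENNReal.ofReal (κ * ((dyadicPt T n (i + 1) : ℝ) - dyadicPt T n i)) := by
        refine Finset.sum_le_sum fun i _ ↦ ?_
        have := hiso (fun l ↦ dyadicPt T n (i + l)) (fun _ _ ↦ 1) 1
          (fun l l' h ↦ dyadicPt_mono T n (by omega)) (fun _ ↦ measurable_const)
          (fun _ _ ↦ by simp) 1
        simpa [dyadicIncr] using this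
    _ = ENNReal.ofReal (κ * T) := by
        rw [← ENNReal.ofReal_sum_of_nonneg fun i _ ↦ mul_nonneg hκ (sub_nonneg.2
          (by exact_mod_cast dyadicPt_mono T n i.le_succ)), ← Finset.mul_sum,
          Finset.sum_range_sub (fun i ↦ (dyadicPt T n i : ℝ)), dyadicPt_zero, dyadicPt_last,
          NNReal.coe_zero, sub_zero]

/-- Along any sequence of levels, the quadratic variation sums of the noise are almost surely
bounded infinitely often. -/
theorem IsometryBound.ae_exists_frequently_le {ℱ : Filtration ℝ≥0 mΩ}
    {w : ℝ≥0 → Ω → ℝ} {κ : ℝ}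
    (hiso : IsometryBound P ℱ w κ) (hκ : 0 ≤ κ) (hw : Adapted ℱ w) (T : ℝ≥0) (ns : ℕ → ℕ) :
    ∀ᵐ ω ∂P, ∃ B : ℝ, ∃ᶠ k in atTop,
      ∑ i ∈ Finset.range (2 ^ ns k), dyadicIncr T (ns k) (fun t ↦ w t ω) i ^ 2 ≤ B := by
  have hwm : ∀ t, Measurable (w t) := fun t ↦ (hw t).mono (ℱ.le t) le_rfl
  let F : ℕ → Ω → ℝ≥0∞ := fun k ω ↦ ENNReal.ofReal (∑ i ∈ Finset.range (2 ^ ns k),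
    dyadicIncr T (ns k) (fun t ↦ w t ω) i ^ 2)
  have hF : ∀ k, Measurable (F k) := fun k ↦ (Finset.measurable_fun_sum _ fun i _ ↦
    ((hwm _).sub (hwm _)).pow_const 2).ennreal_ofReal
  -- Bounded expectations give, by Fatou, only an almost surely finite lower limit. Hence the bound
  -- holds merely for infinitely many levels, and `B` depends on the path.
  have hle : ∫⁻ ω, liminf (fun k ↦ F k ω) atTop ∂P ≤ ENNReal.ofReal (κ * T) := by
    refine (lintegral_liminf_le hF).trans ?_
    refine liminf_le_of_le (by isBoundedDefault) fun c hc ↦ ?_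
    obtain ⟨k, hk⟩ := hc.exists
    exact hk.trans (hiso.lintegral_sum_sq_incr_le hκ hw T (ns k))
  filter_upwards [ae_lt_top (Measurable.liminf hF)
    (ne_top_of_le_ne_top ENNReal.ofReal_ne_top hle)] with ω hω
  obtain ⟨B, hB1, hB2⟩ := ENNReal.lt_iff_exists_nnreal_btwn.1 hω
  refine ⟨B, (frequently_lt_of_liminf_lt (by isBoundedDefault) hB1).mono fun k hk ↦ ?_⟩
  have := hk.le
  simp only [F] at this
  exact (ENNReal.ofReal_le_iff_le_toReal ENNReal.coe_ne_top).1 this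

/-- Indexing by the absolute level `n` lets all sums share one subsequence of levels. Levels below
`K`, where `n - K` is truncated, do not affect the limit. -/
theorem IsCovariation.tendsto_dyadic_sub {X w C : ℝ≥0 → Ω → ℝ} (h : IsCovariation P X w C)
    (T : ℝ≥0) (K b : ℕ) :
    TendstoInMeasure P (fun n ω ↦ ∑ i ∈ Finset.range (b * 2 ^ (n - K)),
      dyadicIncr T n (fun t ↦ X t ω) i * dyadicIncr T n (fun t ↦ w t ω) i) atTop
      (C (dyadicPt T K b)) := by
  refine ((h.tendsto_dyadic T K b).comp (tendsto_sub_atTop_nat K)).congr' ?_ (ae_eq_refl _)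
  filter_upwards [eventually_ge_atTop K] with n hn
  obtain ⟨m, rfl⟩ := Nat.exists_eq_add_of_le hn
  simp only [Function.comp_apply, Nat.add_sub_cancel_left]
  rfl

theorem tendsto_zero_of_sq {l : Filter ℕ} {x : ℕ → ℝ} (h : Tendsto (fun n ↦ x n ^ 2) l (𝓝 0)) :
    Tendsto x l (𝓝 0) := by
  rw [tendsto_zero_iff_abs_tendsto_zero]
  have := h.sqrt
  simp only [Real.sqrt_sq_eq_abs, Real.sqrt_zero] at this
  exact this

/-- A process `u = p + i q` that solves `du = H dt - i u ∘ dw` in the sense of limits in probability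
satisfies `d(e^{iw} u) = e^{iw} H dt` at any given time almost surely. -/
theorem ae_exp_mul_path_sub [IsProbabilityMeasure P] {ℱ : Filtration ℝ≥0 mΩ}
    {w p q Ip Iq Cp Cq : ℝ≥0 → Ω → ℝ} {κ : ℝ} {H : Ω → ℝ → ℂ} {u₀ : ℂ}
    (hiso : IsometryBound P ℱ w κ) (hκ : 0 ≤ κ)
    (hw : Adapted ℱ w) (hwc : ∀ᵐ ω ∂P, Continuous fun t ↦ w t ω)
    (hp : Adapted ℱ p) (hpc : ∀ᵐ ω ∂P, Continuous fun t ↦ p t ω)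
    (hq : Adapted ℱ q) (hqc : ∀ᵐ ω ∂P, Continuous fun t ↦ q t ω)
    (hIp : IsItoIntegral P p w Ip) (hCp : IsCovariation P p w Cp)
    (hIq : IsItoIntegral P q w Iq) (hCq : IsCovariation P q w Cq)
    (hH : ∀ᵐ ω ∂P, Continuous (H ω))
    (heq : ∀ᵐ ω ∂P, ∀ t : ℝ≥0, (p t ω + Complex.I * q t ω : ℂ) =
      u₀ + (∫ s in (0 : ℝ)..t, H ω s) - Complex.I * ((Ip t ω + Complex.I * Iq t ω) +
        (Cp t ω + Complex.I * Cq t ω) / 2)) (T : ℝ≥0) :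
    ∀ᵐ ω ∂P, Complex.exp (Complex.I * w T ω) * (p T ω + Complex.I * q T ω) -
      Complex.exp (Complex.I * w 0 ω) * (p 0 ω + Complex.I * q 0 ω) =
      ∫ s in (0 : ℝ)..T, Complex.exp (Complex.I * w s.toNNReal ω) * H ω s := by
  have hcos : Adapted ℱ fun t ω ↦ Real.cos (w t ω) := fun t ↦ Real.measurable_cos.comp (hw t)
  have hsin : Adapted ℱ fun t ω ↦ Real.sin (w t ω) := fun t ↦ Real.measurable_sin.comp (hw t)
  let rem : (ℝ≥0 → Ω → ℝ) × (ℝ≥0 → Ω → ℝ) → ℕ → Ω → ℕ → ℝ := fun X n ω i ↦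
    itoRem T n (fun t ↦ X.1 t ω) (fun t ↦ w t ω) (fun t ↦ X.2 t ω) i
  -- These are the limits that `exp_mul_path_sub` needs for one real integrand. Cosine and sine of
  -- `w` are the bounded adapted weights that make up `e^{iw}`. The family is countable, so a single
  -- subsequence of levels gives almost sure convergence of all its members, for `p` and `q`
  -- together.
  let fam : (ℝ≥0 → Ω → ℝ) × (ℝ≥0 → Ω → ℝ) → Fin 3 ⊕ ℕ × ℕ → ℕ → Ω → ℝ := fun X ↦
    Sum.elim ![fun n ω ↦ ∑ i ∈ Finset.range (2 ^ n), rem X n ω i ^ 2,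
      fun n ω ↦ (∑ i ∈ Finset.range (2 ^ n), Real.cos (w (dyadicPt T n i) ω) * rem X n ω i) ^ 2,
      fun n ω ↦ (∑ i ∈ Finset.range (2 ^ n), Real.sin (w (dyadicPt T n i) ω) * rem X n ω i) ^ 2]
      fun Kb n ω ↦ ∑ i ∈ Finset.range (Kb.2 * 2 ^ (n - Kb.1)),
        dyadicIncr T n (fun t ↦ X.1 t ω) i * dyadicIncr T n (fun t ↦ w t ω) i
  let lim : (ℝ≥0 → Ω → ℝ) → Fin 3 ⊕ ℕ × ℕ → Ω → ℝ := fun C ↦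
    Sum.elim (fun _ _ ↦ 0) fun Kb ↦ C (dyadicPt T Kb.1 Kb.2)
  have hfam : ∀ X I C, Adapted ℱ X → (∀ᵐ ω ∂P, Continuous fun t ↦ X t ω) →
      IsItoIntegral P X w I → IsCovariation P X w C →
      ∀ s, TendstoInMeasure P (fam (X, I) s) atTop (lim C s) := by
    intro X I C hX hXc hI hC s
    rcases s with k | ⟨K, b⟩
    · fin_cases k
      · exact hI.tendsto_sum_sq_itoRem hw hX hXc hiso hκ T
      · exact hI.tendsto_sq_sum_itoRem hw hX hXc hiso hκ hcos
          (fun t ω ↦ Real.abs_cos_le_one _) T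
      · exact hI.tendsto_sq_sum_itoRem hw hX hXc hiso hκ hsin
          (fun t ω ↦ Real.abs_sin_le_one _) T
    · exact hC.tendsto_dyadic_sub T K b
  obtain ⟨ns, hns, hlim⟩ := exists_strictMono_forall_tendsto_ae (P := P)
    (f := fun s : Bool × (Fin 3 ⊕ ℕ × ℕ) ↦ fam (bif s.1 then (p, Ip) else (q, Iq)) s.2)
    (g := fun s ↦ lim (bif s.1 then Cp else Cq) s.2) (by
      rintro ⟨_ | _, s⟩
      · exact hfam q Iq Cq hq hqc hIq hCq s
      · exact hfam p Ip Cp hp hpc hIp hCp s)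
  filter_upwards [hlim, hwc, hpc, hqc, hCp.1, hCq.1, hH, heq,
    hiso.ae_exists_frequently_le hκ hw T ns] with ω hω hwω hpω hqω hCpω hCqω hHω heqω ⟨B, hB⟩
  -- From the common subsequence only those levels are kept whose quadratic variation sum is at most
  -- `B`. This selection depends on `ω`; it is infinite, so the filter is nontrivial and limits
  -- along it are unique.
  set l : Filter ℕ := map ns (atTop ⊓ 𝓟 {k | ∑ i ∈ Finset.range (2 ^ ns k),
    dyadicIncr T (ns k) (fun t ↦ w t ω) i ^ 2 ≤ B}) with hl
  have hlne : l.NeBot := by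
    rw [hl, map_neBot_iff]
    exact frequently_mem_iff_neBot.1 hB
  have hlle : l ≤ atTop := (map_mono inf_le_left).trans hns.tendsto_atTop
  have hQV : ∀ᶠ n in l, ∑ i ∈ Finset.range (2 ^ n), dyadicIncr T n (fun t ↦ w t ω) i ^ 2 ≤ B := by
    rw [hl, eventually_map]
    exact mem_inf_of_right (mem_principal_self _)
  have hωl : ∀ s : Bool × (Fin 3 ⊕ ℕ × ℕ), Tendsto
      (fun n ↦ fam (bif s.1 then (p, Ip) else (q, Iq)) s.2 n ω) l
      (𝓝 (lim (bif s.1 then Cp else Cq) s.2 ω)) := fun s ↦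
    tendsto_map'_iff.2 ((hω s).mono_left inf_le_left)
  have hp1 := hωl (true, .inl 0)
  have hp2 := tendsto_zero_of_sq (hωl (true, .inl 1))
  have hp3 := tendsto_zero_of_sq (hωl (true, .inl 2))
  have hq1 := hωl (false, .inl 0)
  have hq2 := tendsto_zero_of_sq (hωl (false, .inl 1))
  have hq3 := tendsto_zero_of_sq (hωl (false, .inl 2))
  have hpC := fun K b ↦ hωl (true, .inr (K, b))
  have hqC := fun K b ↦ hωl (false, .inr (K, b))
  clear hω hωl hlim hfam
  simp only [fam, lim, cond_true, cond_false, Sum.elim_inr, Sum.elim_inl,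
    Matrix.cons_val_zero] at hp1 hp2 hp3 hq1 hq2 hq3 hpC hqC
  obtain ⟨Vp, hVp⟩ := exists_sum_abs_dyadicIncr_le hCpω.2 T
  obtain ⟨Vq, hVq⟩ := exists_sum_abs_dyadicIncr_le hCqω.2 T
  have hrem : ∀ n i, itoRemC T n (fun t ↦ (p t ω + Complex.I * q t ω : ℂ)) (fun t ↦ w t ω)
      (fun t ↦ (Ip t ω + Complex.I * Iq t ω : ℂ)) i =
      rem (p, Ip) n ω i + Complex.I * rem (q, Iq) n ω i := by
    intro n i
    simp only [rem, itoRemC, itoRem, dyadicIncr]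
    push_cast
    ring
  refine exp_mul_path_sub (l := l) (T := T) (u := fun t ↦ (p t ω + Complex.I * q t ω : ℂ))
    (C := fun t ↦ (Cp t ω + Complex.I * Cq t ω : ℂ))
    (J := fun t ↦ (Ip t ω + Complex.I * Iq t ω : ℂ)) (w := fun t ↦ w t ω) (V := Vp + Vq) (B := B)
    hlle (by fun_prop) hwω hHω heqω ?_ hQV ?_ ?_ ?_
  · intro n
    refine le_trans ?_ (add_le_add (hVp n) (hVq n))
    rw [← Finset.sum_add_distrib]
    refine Finset.sum_le_sum fun i _ ↦ ?_
    have : dyadicIncr T n (fun t ↦ (Cp t ω + Complex.I * Cq t ω : ℂ)) i =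
        (dyadicIncr T n (fun t ↦ Cp t ω) i : ℝ) +
          Complex.I * (dyadicIncr T n (fun t ↦ Cq t ω) i : ℝ) := by
      simp only [dyadicIncr]
      push_cast
      ring
    rw [this]
    refine (norm_add_le _ _).trans ?_
    rw [norm_mul, Complex.norm_I, one_mul, Complex.norm_real, Complex.norm_real]
    rfl
  · have := hp1.add hq1
    rw [add_zero] at this
    refine this.congr fun n ↦ ?_
    rw [← Finset.sum_add_distrib]
    refine Finset.sum_congr rfl fun i _ ↦ ?_
    rw [hrem, mul_comm Complex.I, Complex.sq_norm, Complex.normSq_add_mul_I]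
  · have h1 := (hp2.sub hq3).ofReal
    have h2 := (hp3.add hq2).ofReal
    have := h1.add (h2.const_mul Complex.I)
    simp only [sub_zero, add_zero, Complex.ofReal_zero, mul_zero] at this
    refine this.congr fun n ↦ ?_
    push_cast
    rw [← Finset.sum_sub_distrib, ← Finset.sum_add_distrib, Finset.mul_sum,
      ← Finset.sum_add_distrib]
    refine Finset.sum_congr rfl fun i _ ↦ ?_
    rw [hrem, mul_comm Complex.I ((w (dyadicPt T n i) ω : ℝ) : ℂ), Complex.exp_mul_I]
    linear_combination (-Complex.sin (w (dyadicPt T n i) ω) * rem (q, Iq) n ω i : ℂ) *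
      Complex.I_sq
  · intro K b _
    have := (hpC K b).ofReal.add ((hqC K b).ofReal.const_mul Complex.I)
    refine this.congr fun n ↦ ?_
    push_cast
    rw [Finset.mul_sum, ← Finset.sum_add_distrib]
    refine Finset.sum_congr rfl fun i _ ↦ ?_
    simp only [dyadicIncr]
    push_cast
    ring

end GaugedProcess

/-! ### Differentiability of flows -/

/-- Global existence for linear differential equations with continuous coefficients. -/
theorem exists_hasDerivWithinAt_linear {F : Type*} [NormedAddCommGroup F] [NormedSpace ℝ F]
    [CompleteSpace F] {A : ℝ → F →L[ℝ] F} (hA : Continuous A) {T : ℝ} (hT : 0 ≤ T) (x₀ : F) :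
    ∃ x : ℝ → F, x 0 = x₀ ∧ ∀ t ∈ Set.Icc 0 T, HasDerivWithinAt x (A t (x t)) (Set.Icc 0 T) t := by
  obtain ⟨L₀, hL₀⟩ := (isCompact_Icc (a := (0 : ℝ)) (b := T)).exists_bound_of_continuousOn
    hA.continuousOn
  set L : ℝ := |L₀| + 1 with hL
  have hLpos : 0 < L := by positivity
  have hAL : ∀ s ∈ Set.Icc 0 T, ‖A s‖ ≤ L := fun s hs ↦
    (hL₀ s hs).trans ((le_abs_self _).trans (by linarith))
  -- The unknown is `v(t) = e^{-2Lt} x(t)`. With this exponential weight the integral operator has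
  -- Lipschitz constant `1/2` on the whole interval, whatever its length.
  let f : C(Set.Icc 0 T, F) → ℝ → F := fun v s ↦
    A s (Real.exp (2 * L * s) • v (Set.projIcc 0 T hT s))
  have hf : ∀ v, Continuous (f v) := fun v ↦ by
    refine hA.clm_apply ((by fun_prop : Continuous fun s : ℝ ↦ Real.exp (2 * L * s)).smul ?_)
    exact v.continuous.comp continuous_projIcc
  let p : C(Set.Icc 0 T, F) → ℝ → F := fun v t ↦ x₀ + ∫ s in (0 : ℝ)..t, f v s
  have hp : ∀ v t, HasDerivAt (p v) (f v t) t := fun v t ↦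
    (intervalIntegral.integral_hasDerivAt_right ((hf v).intervalIntegrable _ _)
      (hf v).stronglyMeasurable.stronglyMeasurableAtFilter (hf v).continuousAt).const_add x₀
  have hpc : ∀ v, Continuous (p v) := fun v ↦
    continuous_iff_continuousAt.2 fun t ↦ (hp v t).continuousAt
  let Λ : C(Set.Icc 0 T, F) → C(Set.Icc 0 T, F) := fun v ↦
    ⟨fun t ↦ Real.exp (-(2 * L * t)) • p v t, by
      have := hpc v
      fun_prop⟩
  have hΛ : ContractingWith (1 / 2) Λ := by
    refine ⟨by norm_num, LipschitzWith.of_dist_le_mul fun v v' ↦ ?_⟩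
    rw [ContinuousMap.dist_le (by positivity)]
    rintro ⟨t, ht⟩
    have hdiff : Λ v ⟨t, ht⟩ - Λ v' ⟨t, ht⟩ =
        Real.exp (-(2 * L * t)) • ∫ s in (0 : ℝ)..t, (f v s - f v' s) := by
      rw [intervalIntegral.integral_sub ((hf v).intervalIntegrable _ _)
        ((hf v').intervalIntegrable _ _)]
      simp only [Λ, p, ContinuousMap.coe_mk, ← smul_sub, add_sub_add_left_eq_sub]
    have hint : ∫ s in (0 : ℝ)..t, L * dist v v' * Real.exp (2 * L * s) =
        dist v v' / 2 * (Real.exp (2 * L * t) - 1) := by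
      have hder : ∀ s ∈ Set.uIcc 0 t, HasDerivAt (fun s ↦ dist v v' / 2 * Real.exp (2 * L * s))
          (L * dist v v' * Real.exp (2 * L * s)) s := fun s _ ↦ by
        have h1 : HasDerivAt (fun s : ℝ ↦ 2 * L * s) (2 * L) s := by
          simpa using (hasDerivAt_id s).const_mul (2 * L)
        exact ((h1.exp).const_mul (dist v v' / 2)).congr_deriv (by ring)
      rw [intervalIntegral.integral_eq_sub_of_hasDerivAt hder
        ((by fun_prop : Continuous fun s ↦ L * dist v v' * Real.exp (2 * L * s)).intervalIntegrable
          _ _)]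
      simp only [mul_zero, Real.exp_zero]
      ring
    have hbound : ‖∫ s in (0 : ℝ)..t, (f v s - f v' s)‖ ≤
        dist v v' / 2 * (Real.exp (2 * L * t) - 1) := by
      rw [← hint]
      refine intervalIntegral.norm_integral_le_of_norm_le ht.1 (Eventually.of_forall fun s hs ↦ ?_)
        ((by fun_prop : Continuous fun s ↦ L * dist v v' * Real.exp (2 * L * s)).intervalIntegrable
          _ _)
      have hs' : s ∈ Set.Icc 0 T := ⟨hs.1.le, hs.2.trans ht.2⟩
      have hv : ‖v (Set.projIcc 0 T hT s) - v' (Set.projIcc 0 T hT s)‖ ≤ dist v v' := by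
        rw [← dist_eq_norm]
        exact ContinuousMap.dist_apply_le_dist _
      simp only [f, ← map_sub, ← smul_sub]
      refine (ContinuousLinearMap.le_opNorm _ _).trans ?_
      rw [norm_smul, Real.norm_eq_abs, Real.abs_exp]
      calc _ ≤ L * (Real.exp (2 * L * s) * dist v v') := by
            gcongr
            exact hAL s hs'
        _ = _ := by ring
    rw [dist_eq_norm, hdiff, norm_smul, Real.norm_eq_abs, Real.abs_exp]
    calc _ ≤ Real.exp (-(2 * L * t)) * (dist v v' / 2 * (Real.exp (2 * L * t) - 1)) := by gcongr
      _ = dist v v' / 2 * (Real.exp (-(2 * L * t)) * Real.exp (2 * L * t) -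
            Real.exp (-(2 * L * t))) := by ring
      _ = dist v v' / 2 * (1 - Real.exp (-(2 * L * t))) := by
          rw [← Real.exp_add, neg_add_cancel, Real.exp_zero]
      _ ≤ dist v v' / 2 * 1 := by
          gcongr
          linarith [Real.exp_pos (-(2 * L * t))]
      _ = _ := by push_cast; ring
  set v := ContractingWith.fixedPoint Λ hΛ with hv
  have hfix : Λ v = v := hΛ.fixedPoint_isFixedPt
  refine ⟨p v, by simp [p], fun t ht ↦ ?_⟩
  have hvt : Real.exp (2 * L * t) • v ⟨t, ht⟩ = p v t := by
    have : v ⟨t, ht⟩ = Real.exp (-(2 * L * t)) • p v t := by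
      nth_rewrite 1 [← hfix]
      rfl
    rw [this, smul_smul, ← Real.exp_add, add_neg_cancel, Real.exp_zero, one_smul]
  have hft : f v t = A t (p v t) := by
    simp only [f]
    rw [Set.projIcc_of_mem hT ht, hvt]
  rw [← hft]
  exact (hp v t).hasDerivWithinAt

section Flow

variable {E : Type*} [NormedAddCommGroup E] [NormedSpace ℝ E] [ProperSpace E]
  {Φ : ℝ → E → E} {A : ℝ → E → E →L[ℝ] E} {U : ℝ → E → E}

/-- The flow of a continuously differentiable vector field is differentiable with respect to the
initial datum, and its derivative solves the variational equation. -/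
theorem exists_hasFDerivAt_flow (hΦ : ∀ t x, HasFDerivAt (Φ t) (A t x) x)
    (hA : Continuous (Function.uncurry A))
    (hU : ∀ y t, 0 ≤ t → HasDerivWithinAt (fun s ↦ U s y) (Φ t (U t y)) (Set.Ici 0) t)
    (hU0 : ∀ y, U 0 y = y)
    (hbd : ∀ r : ℝ, ∃ R : ℝ, ∀ y, ‖y‖ ≤ r → ∀ t, 0 ≤ t → ‖U t y‖ ≤ R) (y : E) {T : ℝ}
    (hT : 0 ≤ T) :
    ∃ J : ℝ → E →L[ℝ] E, ∀ t ∈ Set.Icc 0 T, HasFDerivAt (U t) (J t) y ∧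
      HasDerivWithinAt J ((A t (U t y)).comp (J t)) (Set.Icc 0 T) t := by
  have hUc : ∀ x, ContinuousOn (fun s ↦ U s x) (Set.Ici 0) := fun x t ht ↦
    (hU x t ht).continuousWithinAt
  -- The trajectory is frozen at negative times, where nothing is known of the flow, to get a
  -- coefficient continuous on the whole line.
  set c : ℝ → E := fun t ↦ U (max t 0) y with hc
  have hcc : Continuous c := (hUc y).comp_continuous (by fun_prop) fun t ↦ le_max_right t 0
  have hct : ∀ t, 0 ≤ t → c t = U t y := fun t ht ↦ by simp only [hc, max_eq_left ht]
  have hA1 : Continuous fun t ↦ A t (c t) := hA.comp (continuous_id.prodMk hcc)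
  -- The candidate for the derivative is constructed as the solution of the variational equation
  -- with `J 0 = id`; that it is the derivative is shown afterwards.
  obtain ⟨J, hJ0, hJ⟩ := exists_hasDerivWithinAt_linear
    (A := fun t ↦ ContinuousLinearMap.compL ℝ E E E (A t (c t)))
    ((ContinuousLinearMap.compL ℝ E E E).continuous.comp hA1) hT (ContinuousLinearMap.id ℝ E)
  simp only [ContinuousLinearMap.compL_apply] at hJ
  refine ⟨J, fun t ht ↦ ⟨?_, by rw [← hct t ht.1]; exact hJ t ht⟩⟩
  -- All trajectories that start within distance `1` of `y` stay in one compact ball. There the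
  -- derivative of the field is bounded by `L` and uniformly continuous.
  obtain ⟨R, hR⟩ := hbd (‖y‖ + 1)
  have hcomp : IsCompact (Set.Icc 0 T ×ˢ Metric.closedBall (0 : E) R) :=
    isCompact_Icc.prod (isCompact_closedBall _ _)
  obtain ⟨L₀, hL₀⟩ := hcomp.exists_bound_of_continuousOn hA.continuousOn
  set L : ℝ≥0 := ⟨|L₀| + 1, by positivity⟩ with hL
  have hLpos : (0 : ℝ) < L := by change 0 < |L₀| + 1; positivity
  have hAL : ∀ s ∈ Set.Icc 0 T, ∀ x ∈ Metric.closedBall (0 : E) R, ‖A s x‖ ≤ L :=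
    fun s hs x hx ↦ (hL₀ (s, x) ⟨hs, hx⟩).trans
      ((le_abs_self _).trans (by change |L₀| ≤ |L₀| + 1; linarith))
  have huc := hcomp.uniformContinuousOn_of_continuous hA.continuousOn
  have hball : ∀ y', ‖y'‖ ≤ ‖y‖ + 1 → ∀ s, 0 ≤ s → U s y' ∈ Metric.closedBall (0 : E) R :=
    fun y' hy' s hs ↦ mem_closedBall_zero_iff.2 (hR y' hy' s hs)
  have hyball := hball y (by linarith)
  have hder : ∀ x s, s ∈ Set.Ico 0 T → HasDerivWithinAt (fun s ↦ U s x) (Φ s (U s x))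
      (Set.Ici s) s := fun x s hs ↦ (hU x s hs.1).mono (Set.Ici_subset_Ici.2 hs.1)
  have hcontT : ∀ x, ContinuousOn (fun s ↦ U s x) (Set.Icc 0 T) := fun x ↦
    (hUc x).mono Set.Icc_subset_Ici_self
  have hlip : ∀ y', ‖y'‖ ≤ ‖y‖ + 1 → ∀ s ∈ Set.Icc 0 T,
      ‖U s y' - U s y‖ ≤ Real.exp (L * T) * ‖y' - y‖ := by
    intro y' hy' s hs
    have := dist_le_of_trajectories_ODE_of_mem (v := Φ) (K := L)
      (s := fun _ ↦ Metric.closedBall (0 : E) R) (δ := dist y' y)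
      (fun r hr ↦ (convex_closedBall (0 : E) R).lipschitzOnWith_of_nnnorm_hasFDerivWithin_le
        (fun x _ ↦ (hΦ r x).hasFDerivWithinAt)
        (fun x hx ↦ hAL r (Set.Ico_subset_Icc_self hr) x hx))
      (hcontT y') (hder y') (fun r hr ↦ hball y' hy' r hr.1)
      (hcontT y) (hder y) (fun r hr ↦ hyball r hr.1) (by rw [hU0, hU0]) s hs
    rw [dist_eq_norm, dist_eq_norm, sub_zero, mul_comm] at this
    refine this.trans (mul_le_mul_of_nonneg_right (Real.exp_le_exp.2 ?_) (norm_nonneg _))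
    exact mul_le_mul_of_nonneg_left hs.2 hLpos.le
  refine HasFDerivAt.of_isLittleO (Asymptotics.isLittleO_iff.2 fun ε hε ↦ ?_)
  -- `G` is the Lipschitz factor `e^{LT}` of the flow times the Gronwall factor `e^{LT} / L`; a
  -- defect of relative size `ε / G` in the linearization thus ends up as `ε`.
  set G : ℝ := Real.exp (L * T) * (Real.exp (L * T) / L) with hG
  have hGpos : 0 < G := by positivity
  obtain ⟨δ, hδ, hδA⟩ := Metric.uniformContinuousOn_iff.1 huc (ε / G) (by positivity)
  have hnhds : ∀ᶠ y' in 𝓝 y, ‖y' - y‖ < min 1 (δ / Real.exp (L * T)) := by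
    have := Metric.ball_mem_nhds y (ε := min 1 (δ / Real.exp (L * T)))
      (lt_min one_pos (by positivity))
    filter_upwards [this] with y' hy'
    rwa [← dist_eq_norm]
  filter_upwards [hnhds] with y' hy'
  have hy'1 : ‖y'‖ ≤ ‖y‖ + 1 := by
    have := norm_sub_norm_le y' y
    have := hy'.trans_le (min_le_left _ _)
    linarith
  have hclose : ∀ s ∈ Set.Icc 0 T, ‖U s y' - U s y‖ < δ := by
    intro s hs
    refine (hlip y' hy'1 s hs).trans_lt ?_
    have := hy'.trans_le (min_le_right _ _)
    rwa [lt_div_iff₀ (Real.exp_pos _), mul_comm] at this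
  have hlin : ∀ s ∈ Set.Ico 0 T, dist (Φ s (U s y') - Φ s (U s y))
      (A s (U s y) (U s y' - U s y)) ≤ ε / G * (Real.exp (L * T) * ‖y' - y‖) := by
    intro s hs
    have hs' := Set.Ico_subset_Icc_self hs
    rw [dist_eq_norm]
    have hconv : Convex ℝ (Metric.closedBall (0 : E) R ∩ Metric.ball (U s y) δ) :=
      (convex_closedBall _ _).inter (convex_ball _ _)
    refine (hconv.norm_image_sub_le_of_norm_hasFDerivWithin_le' (C := ε / G)
      (fun x _ ↦ (hΦ s x).hasFDerivWithinAt) (fun x hx ↦ ?_)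
      ⟨hyball s hs.1, Metric.mem_ball_self hδ⟩
      ⟨hball y' hy'1 s hs.1, by rw [Metric.mem_ball, dist_eq_norm]; exact hclose s hs'⟩).trans
      (mul_le_mul_of_nonneg_left (hlip y' hy'1 s hs') (by positivity))
    have := hδA (s, x) ⟨hs', hx.1⟩ (s, U s y) ⟨hs', hyball s hs.1⟩ (by
      rw [Prod.dist_eq, dist_self]
      exact max_lt hδ hx.2)
    rw [← dist_eq_norm]
    exact this.le
  -- The difference of two trajectories solves the variational equation up to the defect in `hlin`,
  -- and `J s (y' - y)` solves it exactly with the same initial value; Gronwall's inequality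
  -- compares them.
  have hfin := dist_le_of_approx_trajectories_ODE_of_mem (v := fun s x ↦ A s (c s) x) (K := L)
    (s := fun _ ↦ Set.univ) (f := fun s ↦ U s y' - U s y) (g := fun s ↦ J s (y' - y))
    (f' := fun s ↦ Φ s (U s y') - Φ s (U s y)) (g' := fun s ↦ A s (c s) (J s (y' - y)))
    (a := 0) (b := T) (εf := ε / G * (Real.exp (L * T) * ‖y' - y‖)) (εg := 0) (δ := 0)
    (fun s hs ↦ by
      refine LipschitzWith.lipschitzOnWith (ContinuousLinearMap.lipschitzWith_of_opNorm_le ?_)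
      rw [hct s hs.1]
      exact hAL s (Set.Ico_subset_Icc_self hs) _ (hyball s hs.1))
    ((hcontT y').sub (hcontT y)) (fun s hs ↦ (hder y' s hs).sub (hder y s hs))
    (fun s hs ↦ by rw [hct s hs.1]; exact hlin s hs) (fun _ _ ↦ Set.mem_univ _)
    (fun s hs ↦ ((hJ s hs).continuousWithinAt).clm_apply continuousWithinAt_const)
    (fun s hs ↦ by
      have h1 := ((hJ s (Set.Ico_subset_Icc_self hs)).clm_apply
        (hasDerivWithinAt_const s _ (y' - y)))
      simp only [map_zero, add_zero, ContinuousLinearMap.comp_apply] at h1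
      exact h1.mono_of_mem_nhdsWithin (Icc_mem_nhdsGE_of_mem hs))
    (fun s _ ↦ by rw [dist_self]) (fun _ _ ↦ Set.mem_univ _)
    (by rw [hU0, hU0, hJ0, ContinuousLinearMap.id_apply, dist_self]) t ht
  rw [dist_eq_norm, gronwallBound_of_K_ne_0 hLpos.ne'] at hfin
  refine hfin.trans ?_
  simp only [sub_zero, zero_mul, zero_add, add_zero]
  calc _ ≤ ε / G * (Real.exp (L * T) * ‖y' - y‖) / L * Real.exp (L * T) := by
        refine mul_le_mul_of_nonneg_left ?_ (by positivity)
        have := Real.exp_le_exp.2 (mul_le_mul_of_nonneg_left ht.2 hLpos.le)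
        linarith
    _ = ε / G * G * ‖y' - y‖ := by rw [hG]; ring
    _ = ε * ‖y' - y‖ := by rw [div_mul_cancel₀ _ hGpos.ne']

/-- The derivative of the flow with respect to the initial datum solves the variational equation
for all times. -/
theorem hasFDerivAt_flow (hΦ : ∀ t x, HasFDerivAt (Φ t) (A t x) x)
    (hA : Continuous (Function.uncurry A))
    (hU : ∀ y t, 0 ≤ t → HasDerivWithinAt (fun s ↦ U s y) (Φ t (U t y)) (Set.Ici 0) t)
    (hU0 : ∀ y, U 0 y = y)
    (hbd : ∀ r : ℝ, ∃ R : ℝ, ∀ y, ‖y‖ ≤ r → ∀ t, 0 ≤ t → ‖U t y‖ ≤ R) (y : E) {t : ℝ}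
    (ht : 0 ≤ t) :
    DifferentiableAt ℝ (U t) y ∧ HasDerivWithinAt (fun s ↦ fderiv ℝ (U s) y)
      ((A t (U t y)).comp (fderiv ℝ (U t) y)) (Set.Ici 0) t := by
  -- The horizon `t + 1` leaves room to the right of `t`, so that `[0, t + 1]` is a neighbourhood of
  -- `t` in `[0, ∞)`.
  obtain ⟨J, hJ⟩ := exists_hasFDerivAt_flow hΦ hA hU hU0 hbd y (T := t + 1) (by linarith)
  have htm : t ∈ Set.Icc 0 (t + 1) := ⟨ht, by linarith⟩
  refine ⟨(hJ t htm).1.differentiableAt, ?_⟩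
  rw [(hJ t htm).1.fderiv]
  have h1 : HasDerivWithinAt (fun s ↦ fderiv ℝ (U s) y) ((A t (U t y)).comp (J t))
      (Set.Icc 0 (t + 1)) t :=
    (hJ t htm).2.congr (fun s hs ↦ (hJ s hs).1.fderiv) (hJ t htm).1.fderiv
  refine h1.mono_of_mem_nhdsWithin ?_
  rw [← Set.Ici_inter_Iic]
  exact inter_mem self_mem_nhdsWithin (mem_nhdsWithin_of_mem_nhds (Iic_mem_nhds (by linarith)))

end Flow

/-! ### The power nonlinearity -/

/-- The nonlinearity `|u|^(2σ) u`. -/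
noncomputable def powerNonlin (σ : ℝ) (u : ℂ) : ℂ := ((‖u‖ ^ 2) ^ σ : ℝ) • u

/-- The derivative of `powerNonlin`. -/
noncomputable def powerNonlinDeriv (σ : ℝ) (u : ℂ) : ℂ →L[ℝ] ℂ :=
  ((‖u‖ ^ 2) ^ σ : ℝ) • ContinuousLinearMap.id ℝ ℂ +
    (2 * σ * (‖u‖ ^ 2) ^ (σ - 1)) • (innerSL ℝ u).smulRight u

theorem powerNonlinDeriv_apply (σ : ℝ) (u v : ℂ) : powerNonlinDeriv σ u v =
    ((‖u‖ ^ 2) ^ σ : ℝ) • v + (2 * σ * (‖u‖ ^ 2) ^ (σ - 1)) • (inner ℝ u v • u) := by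
  simp [powerNonlinDeriv]

theorem continuous_norm_sq_rpow {σ : ℝ} (hσ : 0 ≤ σ) :
    Continuous fun u : ℂ ↦ ((‖u‖ ^ 2) ^ σ : ℝ) :=
  (continuous_norm.pow 2).rpow_const fun _ ↦ Or.inr hσ

theorem powerNonlin_zero_exp : powerNonlin 0 = id := by
  ext u
  simp [powerNonlin]

theorem powerNonlinDeriv_zero_exp (u : ℂ) : powerNonlinDeriv 0 u = ContinuousLinearMap.id ℝ ℂ := by
  ext
  simp [powerNonlinDeriv]

/-- At `u = 0` the power rule is not available. If `σ > 0`, the factor `|u|^{2σ}` tends to `0` and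
the derivative is `0`; if `σ = 0`, the map is the identity. -/
theorem hasFDerivAt_powerNonlin {σ : ℝ} (hσ : 0 ≤ σ) (u : ℂ) :
    HasFDerivAt (powerNonlin σ) (powerNonlinDeriv σ u) u := by
  rcases hσ.eq_or_lt with rfl | hpos
  · rw [powerNonlin_zero_exp, powerNonlinDeriv_zero_exp]
    exact hasFDerivAt_id u
  rcases eq_or_ne u 0 with rfl | hu
  · have h0 : powerNonlinDeriv σ 0 = 0 := by
      ext
      simp [powerNonlinDeriv, Real.zero_rpow hpos.ne']
    rw [h0]
    refine HasFDerivAt.of_isLittleO (Asymptotics.isLittleO_iff.2 fun c hc ↦ ?_)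
    have hlim : Tendsto (fun u : ℂ ↦ ((‖u‖ ^ 2) ^ σ : ℝ)) (𝓝 0) (𝓝 0) := by
      have := (continuous_norm_sq_rpow hσ).tendsto 0
      simpa [Real.zero_rpow hpos.ne'] using this
    filter_upwards [hlim.eventually_le_const hc] with x hx
    have hz : powerNonlin σ 0 = 0 := by simp [powerNonlin]
    simp only [hz, sub_zero, zero_apply]
    rw [powerNonlin, norm_smul, Real.norm_eq_abs, abs_of_nonneg (by positivity)]
    exact mul_le_mul_of_nonneg_right hx (norm_nonneg _)
  · have h1 : HasFDerivAt (fun x : ℂ ↦ ‖x‖ ^ 2) (2 • innerSL ℝ u) u :=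
      (hasStrictFDerivAt_norm_sq u).hasFDerivAt
    have hne : ‖u‖ ^ 2 ≠ 0 := by simpa using hu
    have h2 := (h1.rpow_const (p := σ) (Or.inl hne)).smul (hasFDerivAt_id u)
    refine h2.congr_fderiv ?_
    ext
    simp [powerNonlinDeriv]
    ring

theorem continuous_powerNonlin {σ : ℝ} (hσ : 0 ≤ σ) : Continuous (powerNonlin σ) :=
  (continuous_norm_sq_rpow hσ).smul continuous_id

/-- The exponent `σ - 1` may be negative, but the factor it governs multiplies a term of size `|u|²
|v|`. The product is at most `2σ |u|^{2σ} |v|` and vanishes at the origin. -/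
theorem continuous_powerNonlinDeriv_apply {σ : ℝ} (hσ : 0 ≤ σ) (v : ℂ) :
    Continuous fun u ↦ powerNonlinDeriv σ u v := by
  rcases hσ.eq_or_lt with rfl | hpos
  · simp only [powerNonlinDeriv_zero_exp]
    exact continuous_const
  simp only [powerNonlinDeriv_apply]
  refine ((continuous_norm_sq_rpow hσ).smul continuous_const).add ?_
  rw [continuous_iff_continuousAt]
  intro u
  rcases eq_or_ne u 0 with rfl | hu
  · rw [ContinuousAt]
    simp only [smul_zero]
    have hlim : Tendsto (fun u : ℂ ↦ 2 * σ * (‖u‖ ^ 2) ^ σ * ‖v‖) (𝓝 0) (𝓝 0) := by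
      have := (((continuous_norm_sq_rpow hσ).tendsto 0).const_mul (2 * σ)).mul_const ‖v‖
      simpa [Real.zero_rpow hpos.ne'] using this
    refine squeeze_zero_norm (fun x ↦ ?_) hlim
    rcases eq_or_ne x 0 with rfl | hx
    · simp only [smul_zero, norm_zero]
      positivity
    have hx2 : 0 < ‖x‖ ^ 2 := by positivity
    rw [norm_smul, norm_smul, Real.norm_eq_abs, abs_of_nonneg (by positivity)]
    have hin : ‖(inner ℝ x v : ℝ)‖ ≤ ‖x‖ * ‖v‖ := norm_inner_le_norm x v
    have hpow : (‖x‖ ^ 2) ^ σ = (‖x‖ ^ 2) ^ (σ - 1) * ‖x‖ ^ 2 := by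
      rw [← Real.rpow_add_one hx2.ne', sub_add_cancel]
    rw [hpow]
    calc _ ≤ 2 * σ * (‖x‖ ^ 2) ^ (σ - 1) * (‖x‖ * ‖v‖ * ‖x‖) := by gcongr
      _ = _ := by ring
  · have hne : ‖u‖ ^ 2 ≠ 0 := by simpa using hu
    have hc : ContinuousAt (fun u : ℂ ↦ (‖u‖ ^ 2) ^ (σ - 1)) u :=
      ((continuous_norm.pow 2).continuousAt).rpow_const (Or.inl hne)
    exact (hc.const_mul (2 * σ)).smul
      ((by fun_prop : Continuous fun u : ℂ ↦ (inner ℝ u v : ℝ) • u).continuousAt)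

/-- The nonlinearity is the gradient of `|u|^{2σ+2} / (2σ+2)`, so its derivative is a Hessian. This
symmetry is what removes it from the evolution of the area form. -/
theorem inner_powerNonlinDeriv_comm (σ : ℝ) (u v v' : ℂ) :
    inner ℝ (powerNonlinDeriv σ u v) v' = inner ℝ v (powerNonlinDeriv σ u v') := by
  simp only [powerNonlinDeriv_apply, inner_add_left, inner_add_right, real_inner_smul_left,
    real_inner_smul_right]
  rw [real_inner_comm v u]
  ring

/-! ### The gauged vector field -/

section Field

variable {N : ℕ} (B : Matrix (Fin N) (Fin N) ℝ) (lam σ : ℝ)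

/-- The coefficient `i B_{jk} e^{i (θ_j - θ_k)}`. -/
noncomputable def gaugeCoeff (θ : Fin N → ℝ) (j k : Fin N) : ℂ :=
  Complex.I * (B j k * Complex.exp (Complex.I * ((θ j - θ k : ℝ) : ℂ)))

/-- The vector field of the system after the change of phase by `θ`. -/
noncomputable def gaugeField (θ : Fin N → ℝ) (U : Fin N → ℂ) : Fin N → ℂ := fun j ↦
  ∑ k, gaugeCoeff B θ j k * U k - Complex.I * lam * powerNonlin σ (U j)

/-- The derivative of `gaugeField`. -/
noncomputable def gaugeFieldDeriv (θ : Fin N → ℝ) (U : Fin N → ℂ) :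
    (Fin N → ℂ) →L[ℝ] (Fin N → ℂ) :=
  ContinuousLinearMap.pi fun j ↦
    ∑ k, gaugeCoeff B θ j k • ContinuousLinearMap.proj (R := ℝ) (φ := fun _ : Fin N ↦ ℂ) k -
      (Complex.I * (lam : ℂ)) • (powerNonlinDeriv σ (U j)).comp
        (ContinuousLinearMap.proj (R := ℝ) (φ := fun _ : Fin N ↦ ℂ) j)

theorem gaugeFieldDeriv_apply (θ : Fin N → ℝ) (U V : Fin N → ℂ) (j : Fin N) :
    gaugeFieldDeriv B lam σ θ U V j =
      ∑ k, gaugeCoeff B θ j k * V k - Complex.I * lam * powerNonlinDeriv σ (U j) (V j) := by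
  simp [gaugeFieldDeriv]

variable {σ}

theorem hasFDerivAt_gaugeField (hσ : 0 ≤ σ) (θ : Fin N → ℝ) (U : Fin N → ℂ) :
    HasFDerivAt (gaugeField B lam σ θ) (gaugeFieldDeriv B lam σ θ U) U := by
  rw [hasFDerivAt_pi']
  intro j
  have h1 : HasFDerivAt (fun V : Fin N → ℂ ↦ ∑ k, gaugeCoeff B θ j k * V k)
      (∑ k, gaugeCoeff B θ j k • ContinuousLinearMap.proj (R := ℝ) (φ := fun _ : Fin N ↦ ℂ) k) U :=
    HasFDerivAt.fun_sum fun k _ ↦ (hasFDerivAt_apply k U).const_mul (gaugeCoeff B θ j k)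
  have h2 : HasFDerivAt (fun V : Fin N → ℂ ↦ Complex.I * lam * powerNonlin σ (V j))
      ((Complex.I * (lam : ℂ)) • (powerNonlinDeriv σ (U j)).comp
        (ContinuousLinearMap.proj (R := ℝ) (φ := fun _ : Fin N ↦ ℂ) j)) U :=
    (HasFDerivAt.comp (f := fun V : Fin N → ℂ ↦ V j) U (hasFDerivAt_powerNonlin hσ (U j))
      (hasFDerivAt_apply j U)).const_mul _
  refine (h1.sub h2).congr_fderiv ?_
  ext V
  simp [gaugeFieldDeriv]

theorem continuous_gaugeCoeff (j k : Fin N) : Continuous fun θ : Fin N → ℝ ↦ gaugeCoeff B θ j k := by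
  unfold gaugeCoeff
  fun_prop

theorem continuous_gaugeField (hσ : 0 ≤ σ) {θ : ℝ → Fin N → ℝ} (hθ : Continuous θ) :
    Continuous (Function.uncurry fun t ↦ gaugeField B lam σ (θ t)) := by
  refine continuous_pi fun j ↦ Continuous.sub (continuous_finsetSum _ fun k _ ↦ ?_) ?_
  · exact ((continuous_gaugeCoeff B j k).comp (hθ.comp continuous_fst)).mul
      ((continuous_apply k).comp continuous_snd)
  · exact continuous_const.mul ((continuous_powerNonlin hσ).comp
      ((continuous_apply j).comp continuous_snd))

theorem continuous_gaugeFieldDeriv (hσ : 0 ≤ σ) {θ : ℝ → Fin N → ℝ} (hθ : Continuous θ) :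
    Continuous (Function.uncurry fun t ↦ gaugeFieldDeriv B lam σ (θ t)) := by
  rw [continuous_clm_apply]
  refine fun V ↦ continuous_pi fun j ↦ ?_
  simp only [Function.uncurry_def, gaugeFieldDeriv_apply]
  refine Continuous.sub (continuous_finsetSum _ fun k _ ↦ ?_) ?_
  · exact ((continuous_gaugeCoeff B j k).comp (hθ.comp continuous_fst)).mul continuous_const
  · exact continuous_const.mul ((continuous_powerNonlinDeriv_apply hσ (V j)).comp
      ((continuous_apply j).comp continuous_snd))

variable (σ) {B}

/-- This is conservation of mass. After undoing the rotation, the linear part is a sum of `B j k *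
Im (conj a_j a_k)`, antisymmetric in `j` and `k` for symmetric `B`. The nonlinear part is `i` times
a real multiple of `U j`, orthogonal to `U j`. -/
theorem sum_inner_gaugeField (hB : Bᵀ = B) (θ : Fin N → ℝ) (U : Fin N → ℂ) :
    ∑ j, inner ℝ (U j) (gaugeField B lam σ θ U j) = 0 := by
  set a : Fin N → ℂ := fun j ↦ Complex.exp (-(Complex.I * θ j)) * U j with ha
  have hBs : ∀ j k, B j k = B k j := fun j k ↦ by rw [← Matrix.transpose_apply B, hB]
  have hlin : ∀ j k, inner ℝ (U j) (gaugeCoeff B θ j k * U k) = -(B j k * (conj (a j) * a k).im) := by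
    intro j k
    have hid : conj (U j) * (gaugeCoeff B θ j k * U k) =
        Complex.I * ((B j k : ℝ) * (conj (a j) * a k)) := by
      simp only [ha, gaugeCoeff, map_mul, ← Complex.exp_conj, map_neg, Complex.conj_I,
        Complex.conj_ofReal]
      have hexp : Complex.exp (Complex.I * ((θ j - θ k : ℝ) : ℂ)) =
          Complex.exp (-(-Complex.I * θ j)) * Complex.exp (-(Complex.I * θ k)) := by
        rw [← Complex.exp_add]
        push_cast
        ring_nf
      rw [hexp]
      ring
    rw [Complex.inner, mul_comm, hid]
    simp [Complex.mul_re, Complex.mul_im]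
  have hnon : ∀ j, inner ℝ (U j) (Complex.I * lam * powerNonlin σ (U j)) = 0 := by
    intro j
    rw [Complex.inner]
    simp [powerNonlin, Complex.mul_re, Complex.mul_im]
    ring
  simp only [gaugeField, inner_sub_right, inner_sum, hlin, hnon, sub_zero]
  have hanti : ∑ j, ∑ k, -(B j k * (conj (a j) * a k).im) =
      -∑ j, ∑ k, -(B j k * (conj (a j) * a k).im) := by
    nth_rewrite 1 [Finset.sum_comm]
    rw [← Finset.sum_neg_distrib]
    refine Finset.sum_congr rfl fun j _ ↦ ?_
    rw [← Finset.sum_neg_distrib]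
    refine Finset.sum_congr rfl fun k _ ↦ ?_
    rw [hBs k j]
    simp [Complex.mul_im]
    ring
  linarith

end Field

/-! ### Solutions of the gauged equation -/

section Solutions

variable {N : ℕ} {B : Matrix (Fin N) (Fin N) ℝ} {lam σ : ℝ} {θ : ℝ → Fin N → ℝ}

/-- A continuous solution of the integral equation solves the differential equation. -/
theorem hasDerivWithinAt_of_integral_eq {Φ : ℝ → (Fin N → ℂ) → Fin N → ℂ}
    (hΦ : Continuous (Function.uncurry Φ)) {V : ℝ → Fin N → ℂ} {x : Fin N → ℂ}
    (hV : ContinuousOn V (Set.Ici 0))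
    (heq : ∀ t, 0 ≤ t → ∀ j, V t j = x j + ∫ s in (0 : ℝ)..t, Φ s (V s) j) {t : ℝ} (ht : 0 ≤ t) :
    HasDerivWithinAt V (Φ t (V t)) (Set.Ici 0) t := by
  rw [hasDerivWithinAt_pi]
  intro j
  have hVc : Continuous fun s ↦ V (max s 0) :=
    hV.comp_continuous (by fun_prop) fun t ↦ le_max_right t 0
  have hg : Continuous fun s ↦ Φ s (V (max s 0)) j :=
    (continuous_apply j).comp (hΦ.comp (continuous_id.prodMk hVc))
  have hd := (intervalIntegral.integral_hasDerivAt_right (hg.intervalIntegrable 0 t)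
    hg.stronglyMeasurable.stronglyMeasurableAtFilter hg.continuousAt).const_add (x j)
  have hcongr : ∀ r ∈ Set.Ici (0 : ℝ), V r j = x j + ∫ s in (0 : ℝ)..r, Φ s (V (max s 0)) j := by
    intro r hr
    rw [heq r hr j]
    congr 1
    refine intervalIntegral.integral_congr fun s hs ↦ ?_
    rw [Set.uIcc_of_le hr] at hs
    simp only [max_eq_left hs.1]
  have := hd.hasDerivWithinAt.congr hcongr (hcongr t ht)
  rwa [max_eq_left ht] at this

theorem sum_norm_sq_eq (hB : Bᵀ = B) {V : ℝ → Fin N → ℂ}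
    (hV : ∀ t, 0 ≤ t → HasDerivWithinAt V (gaugeField B lam σ (θ t) (V t)) (Set.Ici 0) t)
    {t : ℝ} (ht : 0 ≤ t) : ∑ j, ‖V t j‖ ^ 2 = ∑ j, ‖V 0 j‖ ^ 2 := by
  have hd : ∀ s, 0 ≤ s → HasDerivWithinAt (fun s ↦ ∑ j, ‖V s j‖ ^ 2) 0 (Set.Ici 0) s := by
    intro s hs
    have hj := fun j ↦ (hasDerivWithinAt_pi.1 (hV s hs) j).norm_sq
    refine (HasDerivWithinAt.fun_sum fun j _ ↦ hj j).congr_deriv ?_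
    rw [← Finset.mul_sum, sum_inner_gaugeField lam σ hB, mul_zero]
  refine (constant_of_has_deriv_right_zero (a := 0) (b := t)
    (f := fun s ↦ ∑ j, ‖V s j‖ ^ 2) (fun s hs ↦ ?_) (fun s hs ↦ ?_) t ⟨ht, le_rfl⟩)
  · exact (hd s hs.1).continuousWithinAt.mono Set.Icc_subset_Ici_self
  · exact (hd s hs.1).mono (Set.Ici_subset_Ici.2 hs.1)

/-- A bound for solutions in terms of the conserved mass. -/
theorem norm_le_of_sum_norm_sq_eq {x y : Fin N → ℂ} (h : ∑ j, ‖x j‖ ^ 2 = ∑ j, ‖y j‖ ^ 2) {r : ℝ}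
    (hr : ‖y‖ ≤ r) : ‖x‖ ≤ √(N * r ^ 2) := by
  rw [pi_norm_le_iff_of_nonneg (Real.sqrt_nonneg _)]
  intro j
  refine Real.le_sqrt_of_sq_le ?_
  calc ‖x j‖ ^ 2 ≤ ∑ j, ‖x j‖ ^ 2 :=
        Finset.single_le_sum (f := fun j ↦ ‖x j‖ ^ 2) (fun i _ ↦ sq_nonneg _) (Finset.mem_univ j)
    _ = ∑ j, ‖y j‖ ^ 2 := h
    _ ≤ ∑ _j : Fin N, r ^ 2 := Finset.sum_le_sum fun j _ ↦
        pow_le_pow_left₀ (norm_nonneg _) ((norm_le_pi_norm y j).trans hr) 2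
    _ = N * r ^ 2 := by simp

/-- If the gauged equation holds for a dense set of initial data and the solutions depend
continuously on the initial datum at each time, then it holds for all initial data. -/
theorem gaugeField_solution_of_dense (hB : Bᵀ = B) (hσ : 0 ≤ σ) (hθ : Continuous θ)
    {U : ℝ → (Fin N → ℂ) → Fin N → ℂ} (hUc : ∀ t, 0 ≤ t → Continuous (U t))
    {S : Set (Fin N → ℂ)} (hS : Dense S)
    (hcont : ∀ x ∈ S, ContinuousOn (fun t ↦ U t x) (Set.Ici 0))
    (heq : ∀ x ∈ S, ∀ t, 0 ≤ t → ∀ j,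
      U t x j = x j + ∫ s in (0 : ℝ)..t, gaugeField B lam σ (θ s) (U s x) j) (x : Fin N → ℂ) :
    U 0 x = x ∧
    (∀ t, 0 ≤ t → HasDerivWithinAt (fun s ↦ U s x) (gaugeField B lam σ (θ t) (U t x))
      (Set.Ici 0) t) := by
  have hΦ := continuous_gaugeField B lam hσ hθ
  have hU0S : ∀ x ∈ S, U 0 x = x := fun x hx ↦ by
    ext j
    simpa using heq x hx 0 le_rfl j
  have hU0 : ∀ x, U 0 x = x := fun x ↦
    congrFun ((hUc 0 le_rfl).ext_on hS continuous_id hU0S) x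
  have hmassS : ∀ x ∈ S, ∀ t, 0 ≤ t → ∑ j, ‖U t x j‖ ^ 2 = ∑ j, ‖x j‖ ^ 2 := by
    intro x hx t ht
    have := sum_norm_sq_eq (lam := lam) (σ := σ) hB (V := fun t ↦ U t x) (θ := θ)
      (fun t ht ↦ hasDerivWithinAt_of_integral_eq hΦ (hcont x hx) (heq x hx) ht) ht
    rwa [hU0 x] at this
  obtain ⟨y, hyS, hy⟩ := mem_closure_iff_seq_limit.1 (hS x)
  have hyb : ∃ r : ℝ, ∀ n, ‖y n‖ ≤ r := by
    obtain ⟨r, hr⟩ := hy.norm.bddAbove_range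
    exact ⟨r, fun n ↦ hr ⟨n, rfl⟩⟩
  obtain ⟨r, hr⟩ := hyb
  have hUb : ∀ n t, 0 ≤ t → ‖U t (y n)‖ ≤ √(N * r ^ 2) := fun n t ht ↦
    norm_le_of_sum_norm_sq_eq (hmassS _ (hyS n) t ht) (hr n)
  have hbound : ∀ T : ℝ, ∃ M : ℝ, 0 ≤ M ∧ ∀ n, ∀ s ∈ Set.Icc 0 T,
      ‖gaugeField B lam σ (θ s) (U s (y n))‖ ≤ M := by
    intro T
    obtain ⟨M, hM⟩ := ((isCompact_Icc (a := (0 : ℝ)) (b := T)).prod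
      (isCompact_closedBall (0 : Fin N → ℂ) √(N * r ^ 2))).exists_bound_of_continuousOn
      hΦ.continuousOn
    exact ⟨|M|, abs_nonneg M, fun n s hs ↦ (hM (s, U s (y n))
      ⟨hs, mem_closedBall_zero_iff.2 (hUb n s hs.1)⟩).trans (le_abs_self M)⟩
  have hder : ∀ n t, 0 ≤ t → HasDerivWithinAt (fun s ↦ U s (y n))
      (gaugeField B lam σ (θ t) (U t (y n))) (Set.Ici 0) t := fun n t ht ↦
    hasDerivWithinAt_of_integral_eq hΦ (hcont _ (hyS n)) (heq _ (hyS n)) ht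
  have hlim : ∀ t, 0 ≤ t → Tendsto (fun n ↦ U t (y n)) atTop (𝓝 (U t x)) := fun t ht ↦
    ((hUc t ht).tendsto x).comp hy
  -- Continuity in time is assumed only for data in `S`. The approximating solutions share a mass
  -- bound, hence a bound `M` of the field, hence a Lipschitz constant in time, which passes to the
  -- limit.
  have hUx : ContinuousOn (fun t ↦ U t x) (Set.Ici 0) := by
    intro t ht
    obtain ⟨M, hM0, hM⟩ := hbound (t + 1)
    have hlip : LipschitzOnWith ⟨M, hM0⟩ (fun t ↦ U t x) (Set.Icc 0 (t + 1)) := by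
      refine LipschitzOnWith.of_dist_le_mul fun s hs s' hs' ↦ ?_
      refine le_of_tendsto ((hlim s hs.1).dist (hlim s' hs'.1)) (Eventually.of_forall fun n ↦ ?_)
      rw [dist_eq_norm, dist_eq_norm]
      exact (convex_Icc 0 (t + 1)).norm_image_sub_le_of_norm_hasDerivWithin_le
        (f := fun s ↦ U s (y n)) (C := M)
        (fun r hr ↦ (hder n r hr.1).mono Set.Icc_subset_Ici_self) (fun r hr ↦ hM n r hr) hs' hs
    refine (hlip.continuousOn t ⟨ht, by linarith⟩).mono_of_mem_nhdsWithin ?_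
    rw [← Set.Ici_inter_Iic]
    exact inter_mem self_mem_nhdsWithin (mem_nhdsWithin_of_mem_nhds (Iic_mem_nhds (by linarith)))
  refine ⟨hU0 x, fun t ht ↦ hasDerivWithinAt_of_integral_eq hΦ hUx (x := x) (fun t ht j ↦ ?_) ht⟩
  obtain ⟨M, hM0, hM⟩ := hbound t
  have h1 : Tendsto (fun n ↦ U t (y n) j) atTop (𝓝 (U t x j)) :=
    (tendsto_pi_nhds.1 (hlim t ht)) j
  have h2 : Tendsto (fun n ↦ y n j + ∫ s in (0 : ℝ)..t, gaugeField B lam σ (θ s) (U s (y n)) j)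
      atTop (𝓝 (x j + ∫ s in (0 : ℝ)..t, gaugeField B lam σ (θ s) (U s x) j)) := by
    refine ((tendsto_pi_nhds.1 hy) j).add
      (intervalIntegral.tendsto_integral_filter_of_dominated_convergence (fun _ ↦ M)
        (Eventually.of_forall fun n ↦ ?_) (Eventually.of_forall fun n ↦
          Eventually.of_forall fun s hs ↦ ?_) intervalIntegrable_const
        (Eventually.of_forall fun s hs ↦ ?_))
    · rw [Set.uIoc_of_le ht]
      refine ContinuousOn.aestronglyMeasurable (fun s hs ↦ ?_) measurableSet_Ioc
      have hc : ContinuousOn (fun s ↦ gaugeField B lam σ (θ s) (U s (y n)) j) (Set.Ici 0) :=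
        (continuous_apply j).comp_continuousOn (hΦ.comp_continuousOn
          (continuousOn_id.prodMk (hcont _ (hyS n))))
      exact (hc s hs.1.le).mono fun r hr ↦ hr.1.le
    · rw [Set.uIoc_of_le ht] at hs
      exact (norm_le_pi_norm _ j).trans (hM n s ⟨hs.1.le, hs.2⟩)
    · rw [Set.uIoc_of_le ht] at hs
      have hc : Continuous fun V ↦ gaugeField B lam σ (θ s) V j :=
        (continuous_apply j).comp (hΦ.comp (Continuous.prodMk_right s))
      exact (hc.tendsto _).comp (hlim s hs.1.le)
  exact tendsto_nhds_unique h1 (h2.congr fun n ↦ (heq _ (hyS n) t ht j).symm)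

end Solutions

/-! ### The differentiation matrix -/

/-- The substitution `k ↦ -k` preserves the range and the weights, changes the sign of the symbol
and interchanges the two grid points in the exponential. -/
theorem complexD1_swap (α a b : ℝ) (N : ℕ) (j l : Fin N) :
    complexD1 α a b N l j = -complexD1 α a b N j l := by
  simp only [complexD1, Matrix.of_apply, ← Finset.sum_neg_distrib]
  refine Finset.sum_nbij' (fun k ↦ -k) (fun k ↦ -k) ?_ ?_ ?_ ?_ ?_
  · intro k hk
    simp only [Finset.mem_Icc] at hk ⊢
    omega
  · intro k hk
    simp only [Finset.mem_Icc] at hk ⊢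
    omega
  · simp
  · simp
  · intro k _
    have h : modeWeight N (-k) = modeWeight N k := by simp [modeWeight]
    have he : (((-k : ℤ) : ℝ) * baseFreq a b * (gridPoint a b N j - gridPoint a b N l)) =
        k * baseFreq a b * (gridPoint a b N l - gridPoint a b N j) := by
      push_cast
      ring
    rw [h, he]
    push_cast
    simp only [neg_mul, mul_neg, abs_neg, neg_neg]

theorem D1_transpose (α a b : ℝ) (N : ℕ) : (D1 α a b N)ᵀ = -D1 α a b N := by
  ext j l
  simp only [Matrix.transpose_apply, Matrix.neg_apply, D1, Matrix.map_apply,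
    complexD1_swap α a b N j l, Complex.neg_re]

theorem transpose_mul_self_of_skew {n : Type*} [Fintype n] {D : Matrix n n ℝ} (h : Dᵀ = -D) :
    (D * D)ᵀ = D * D := by
  rw [Matrix.transpose_mul, h, neg_mul_neg]

theorem gridPoint_mem_Icc {a b : ℝ} (hab : a ≤ b) {N : ℕ} (j : Fin N) :
    gridPoint a b N j ∈ Set.Icc a b := by
  have hN : (0 : ℝ) < N := by exact_mod_cast j.pos
  have hj : (j : ℝ) ≤ N := by exact_mod_cast j.2.le
  have h0 : 0 ≤ (b - a) / N := div_nonneg (by linarith) hN.le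
  refine ⟨by unfold gridPoint; nlinarith [(Nat.cast_nonneg (j : ℕ) : (0 : ℝ) ≤ (j : ℕ))], ?_⟩
  have : (j : ℝ) * ((b - a) / N) ≤ N * ((b - a) / N) := mul_le_mul_of_nonneg_right hj h0
  rw [mul_div_cancel₀ _ hN.ne'] at this
  unfold gridPoint
  linarith

/-! ### The drift in complex notation -/

section Drift

variable {N : ℕ}

/-- The complex unknown `p_j + i q_j`. -/
noncomputable def complexState (z : Fin N → Fin 4 → ℝ) (j : Fin N) : ℂ := z j 0 + Complex.I * z j 1

/-- The drift of `p_j`. -/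
noncomputable def driftP (D : Matrix (Fin N) (Fin N) ℝ) (lam σ : ℝ) (z : Fin N → Fin 4 → ℝ)
    (j : Fin N) : ℝ :=
  -(D *ᵥ fun k ↦ z k 3) j + lam * (z j 0 ^ 2 + z j 1 ^ 2) ^ σ * z j 1

/-- The drift of `q_j`. -/
noncomputable def driftQ (D : Matrix (Fin N) (Fin N) ℝ) (lam σ : ℝ) (z : Fin N → Fin 4 → ℝ)
    (j : Fin N) : ℝ :=
  (D *ᵥ fun k ↦ z k 2) j - lam * (z j 0 ^ 2 + z j 1 ^ 2) ^ σ * z j 0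

theorem continuous_driftP (D : Matrix (Fin N) (Fin N) ℝ) (lam : ℝ) {σ : ℝ} (hσ : 0 ≤ σ)
    (j : Fin N) : Continuous fun z : Fin N → Fin 4 → ℝ ↦ driftP D lam σ z j := by
  have h : Continuous fun z : Fin N → Fin 4 → ℝ ↦ (z j 0 ^ 2 + z j 1 ^ 2) ^ σ :=
    Continuous.rpow_const (by fun_prop) fun _ ↦ Or.inr hσ
  simp only [driftP, Matrix.mulVec, dotProduct]
  fun_prop

theorem continuous_driftQ (D : Matrix (Fin N) (Fin N) ℝ) (lam : ℝ) {σ : ℝ} (hσ : 0 ≤ σ)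
    (j : Fin N) : Continuous fun z : Fin N → Fin 4 → ℝ ↦ driftQ D lam σ z j := by
  have h : Continuous fun z : Fin N → Fin 4 → ℝ ↦ (z j 0 ^ 2 + z j 1 ^ 2) ^ σ :=
    Continuous.rpow_const (by fun_prop) fun _ ↦ Or.inr hσ
  simp only [driftQ, Matrix.mulVec, dotProduct]
  fun_prop

theorem norm_sq_complexState (z : Fin N → Fin 4 → ℝ) (j : Fin N) :
    ‖complexState z j‖ ^ 2 = z j 0 ^ 2 + z j 1 ^ 2 := by
  rw [complexState, mul_comm, Complex.sq_norm, Complex.normSq_add_mul_I]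

theorem sum_gaugeCoeff_mul (B : Matrix (Fin N) (Fin N) ℝ) (θ : Fin N → ℝ) (c : Fin N → ℂ)
    (j : Fin N) : ∑ k, gaugeCoeff B θ j k * (Complex.exp (Complex.I * θ k) * c k) =
      Complex.exp (Complex.I * θ j) * (Complex.I * ∑ k, B j k * c k) := by
  rw [Finset.mul_sum, Finset.mul_sum]
  refine Finset.sum_congr rfl fun k _ ↦ ?_
  have hexp : Complex.exp (Complex.I * θ j) =
      Complex.exp (Complex.I * ((θ j - θ k : ℝ) : ℂ)) * Complex.exp (Complex.I * θ k) := by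
    rw [← Complex.exp_add]
    push_cast
    ring_nf
  rw [hexp, gaugeCoeff]
  ring

/-- In the rotating frame the drift is the gauged vector field. -/
theorem exp_mul_drift_eq (D : Matrix (Fin N) (Fin N) ℝ) (lam σ : ℝ) (θ : Fin N → ℝ)
    {z : Fin N → Fin 4 → ℝ} (hv : ∀ j, (D *ᵥ fun k ↦ z k 0) j = z j 2)
    (hw : ∀ j, (D *ᵥ fun k ↦ z k 1) j = z j 3) (j : Fin N) :
    Complex.exp (Complex.I * θ j) * (driftP D lam σ z j + Complex.I * driftQ D lam σ z j) =
      gaugeField (D * D) lam σ θ (fun k ↦ Complex.exp (Complex.I * θ k) * complexState z k) j := by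
  have hBv : ∑ k, (D * D) j k * z k 0 = (D *ᵥ fun k ↦ z k 2) j := by
    have : (fun k ↦ z k 2) = D *ᵥ fun k ↦ z k 0 := funext fun k ↦ (hv k).symm
    rw [this, Matrix.mulVec_mulVec]
    rfl
  have hBw : ∑ k, (D * D) j k * z k 1 = (D *ᵥ fun k ↦ z k 3) j := by
    have : (fun k ↦ z k 3) = D *ᵥ fun k ↦ z k 1 := funext fun k ↦ (hw k).symm
    rw [this, Matrix.mulVec_mulVec]
    rfl
  have hsum : ∑ k, (((D * D) j k : ℝ) : ℂ) * complexState z k =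
      ((D *ᵥ fun k ↦ z k 2) j : ℝ) + Complex.I * ((D *ᵥ fun k ↦ z k 3) j : ℝ) := by
    rw [← hBv, ← hBw]
    push_cast
    rw [Finset.mul_sum, ← Finset.sum_add_distrib]
    refine Finset.sum_congr rfl fun k _ ↦ ?_
    rw [complexState]
    ring
  have hnorm : ‖Complex.exp (Complex.I * θ j) * complexState z j‖ ^ 2 = z j 0 ^ 2 + z j 1 ^ 2 := by
    rw [norm_mul, Complex.norm_exp_I_mul_ofReal, one_mul, norm_sq_complexState]
  simp only [gaugeField]
  rw [sum_gaugeCoeff_mul, hsum, powerNonlin, hnorm, complexState, driftP, driftQ, Complex.real_smul]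
  push_cast
  linear_combination (Complex.exp (Complex.I * θ j) * (((D *ᵥ fun k ↦ z k 3) j : ℝ) : ℂ) * (-1) +
    lam * ((((z j 0 ^ 2 + z j 1 ^ 2) ^ σ : ℝ)) : ℂ) * Complex.exp (Complex.I * θ j) * z j 1) *
      Complex.I_sq

end Drift

/-! ### From the stochastic system to the gauged equation -/

section Stochastic

variable {Ω : Type*} {mΩ : MeasurableSpace Ω} {P : Measure Ω}

/-- The process is given only by limits in probability, so its value at time `0` must be read off
from empty sums. It is needed to identify the initial value of the solution. -/
theorem IsItoIntegral.ae_eq_zero {X w I : ℝ≥0 → Ω → ℝ} (h : IsItoIntegral P X w I) :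
    ∀ᵐ ω ∂P, I 0 ω = 0 := by
  have h1 := h.tendsto_dyadic 0 0 0
  simp only [zero_mul, Finset.range_zero, Finset.sum_empty, dyadicPt_zero] at h1
  have h2 : TendstoInMeasure P (fun (_ : ℕ) (_ : Ω) ↦ (0 : ℝ)) atTop fun _ ↦ 0 := by
    intro ε hε
    simp [hε.ne']
  exact tendstoInMeasure_ae_unique h1 h2

theorem IsCovariation.ae_eq_zero {X w C : ℝ≥0 → Ω → ℝ} (h : IsCovariation P X w C) :
    ∀ᵐ ω ∂P, C 0 ω = 0 := by
  have h1 := h.tendsto_dyadic 0 0 0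
  simp only [zero_mul, Finset.range_zero, Finset.sum_empty, dyadicPt_zero] at h1
  have h2 : TendstoInMeasure P (fun (_ : ℕ) (_ : Ω) ↦ (0 : ℝ)) atTop fun _ ↦ 0 := by
    intro ε hε
    simp [hε.ne']
  exact tendstoInMeasure_ae_unique h1 h2

variable [IsProbabilityMeasure P] {ℱ : Filtration ℝ≥0 mΩ} {α σ lam a b : ℝ} {N : ℕ}
  {β : ℕ → ℝ≥0 → Ω → ℝ} {φ : ℕ → ℝ → ℝ} {W : ℝ≥0 → ℝ → Ω → ℝ} {y : Phase N}
  {z : ℝ≥0 → Ω → Fin N → Fin 4 → ℝ}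

/-- The chain rule gives the identity at each fixed time off a null set that depends on the time.
Both sides are continuous in time, so countably many times suffice. -/
theorem IsSemidiscreteSolution.ae_exp_mul_eq (hσ : 0 ≤ σ) (hab : a ≤ b)
    (hW : IsWienerField P ℱ a b β φ W)
    (hz : IsSemidiscreteSolution P ℱ W α σ lam a b N y z) (j : Fin N) :
    ∀ᵐ ω ∂P, complexState (z 0 ω) j = y.1 j + Complex.I * y.2 j ∧ ∀ t : ℝ≥0,
      Complex.exp (Complex.I * W t (gridPoint a b N j) ω) * complexState (z t ω) j -
        Complex.exp (Complex.I * W 0 (gridPoint a b N j) ω) * complexState (z 0 ω) j =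
      ∫ s in (0 : ℝ)..t, Complex.exp (Complex.I * W s.toNNReal (gridPoint a b N j) ω) *
        (driftP (D1 α a b N) lam σ (z s.toNNReal ω) j +
          Complex.I * driftQ (D1 α a b N) lam σ (z s.toNNReal ω) j) := by
  have hx := gridPoint_mem_Icc hab j
  -- The equation for `p` contains the integral of `q` and conversely; the two combine by `q - i p =
  -- -i (p + i q)`.
  obtain ⟨Sq, ⟨Iq, Cq, hIq, hCq, rfl⟩, hp⟩ := hz.eq_p j
  obtain ⟨Sp, ⟨Ip, Cp, hIp, hCp, rfl⟩, hq⟩ := hz.eq_q j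
  have hpc : ∀ c, ∀ᵐ ω ∂P, Continuous fun t ↦ z t ω j c := fun c ↦
    hz.continuous.mono fun ω hω ↦ (continuous_apply_apply j c).comp hω
  have hdP : ∀ᵐ ω ∂P, Continuous fun s : ℝ ↦ driftP (D1 α a b N) lam σ (z s.toNNReal ω) j :=
    hz.continuous.mono fun ω hω ↦ (continuous_driftP _ lam hσ j).comp
      (hω.comp continuous_real_toNNReal)
  have hdQ : ∀ᵐ ω ∂P, Continuous fun s : ℝ ↦ driftQ (D1 α a b N) lam σ (z s.toNNReal ω) j :=
    hz.continuous.mono fun ω hω ↦ (continuous_driftQ _ lam hσ j).comp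
      (hω.comp continuous_real_toNNReal)
  have hH : ∀ᵐ ω ∂P, Continuous fun s : ℝ ↦
      (driftP (D1 α a b N) lam σ (z s.toNNReal ω) j +
        Complex.I * driftQ (D1 α a b N) lam σ (z s.toNNReal ω) j : ℂ) := by
    filter_upwards [hdP, hdQ] with ω h1 h2
    fun_prop
  have hκ : 0 ≤ ∑' k, φ k (gridPoint a b N j) ^ 2 := tsum_nonneg fun k ↦ sq_nonneg _
  have hgauge : ∀ T : ℝ≥0, ∀ᵐ ω ∂P,
      Complex.exp (Complex.I * W T (gridPoint a b N j) ω) * complexState (z T ω) j -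
        Complex.exp (Complex.I * W 0 (gridPoint a b N j) ω) * complexState (z 0 ω) j =
      ∫ s in (0 : ℝ)..T, Complex.exp (Complex.I * W s.toNNReal (gridPoint a b N j) ω) *
        (driftP (D1 α a b N) lam σ (z s.toNNReal ω) j +
          Complex.I * driftQ (D1 α a b N) lam σ (z s.toNNReal ω) j) := by
    refine ae_exp_mul_path_sub (w := fun t ↦ W t (gridPoint a b N j))
      (p := fun t ω ↦ z t ω j 0) (q := fun t ω ↦ z t ω j 1) (u₀ := y.1 j + Complex.I * y.2 j)
      (H := fun ω s ↦ (driftP (D1 α a b N) lam σ (z s.toNNReal ω) j +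
        Complex.I * driftQ (D1 α a b N) lam σ (z s.toNNReal ω) j : ℂ))
      (hW.isometryBound hx) hκ (hW.adapted _ hx) (hW.continuous _ hx) (hz.adapted j 0) (hpc 0)
      (hz.adapted j 1) (hpc 1) hIp hCp hIq hCq hH ?_
    filter_upwards [hp, hq, hdP, hdQ] with ω h1 h2 h3 h4 t
    have e1 : z t ω j 0 = y.1 j +
        (∫ s in (0 : ℝ)..t, driftP (D1 α a b N) lam σ (z s.toNNReal ω) j) +
        (Iq t ω + Cq t ω / 2) := h1 t
    have e2 : z t ω j 1 = y.2 j +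
        (∫ s in (0 : ℝ)..t, driftQ (D1 α a b N) lam σ (z s.toNNReal ω) j) -
        (Ip t ω + Cp t ω / 2) := h2 t
    have e3 : ∫ s in (0 : ℝ)..t, (driftP (D1 α a b N) lam σ (z s.toNNReal ω) j +
        Complex.I * driftQ (D1 α a b N) lam σ (z s.toNNReal ω) j : ℂ) =
        ((∫ s in (0 : ℝ)..t, driftP (D1 α a b N) lam σ (z s.toNNReal ω) j : ℝ) : ℂ) +
        Complex.I * ((∫ s in (0 : ℝ)..t, driftQ (D1 α a b N) lam σ (z s.toNNReal ω) j : ℝ) : ℂ) := by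
      rw [← intervalIntegral.integral_ofReal, ← intervalIntegral.integral_ofReal,
        ← intervalIntegral.integral_const_mul, ← intervalIntegral.integral_add]
      · exact (Complex.continuous_ofReal.comp h3).intervalIntegrable _ _
      · exact (continuous_const.mul (Complex.continuous_ofReal.comp h4)).intervalIntegrable _ _
    rw [e1, e2, e3]
    push_cast
    linear_combination ((Iq t ω : ℂ) + Cq t ω / 2) * Complex.I_sq
  obtain ⟨S, hSc, hSd⟩ := TopologicalSpace.exists_countable_dense ℝ≥0
  have hall := (ae_ball_iff hSc).2 fun T (_ : T ∈ S) ↦ hgauge T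
  filter_upwards [hall, hp, hq, hIp.ae_eq_zero, hCp.ae_eq_zero, hIq.ae_eq_zero, hCq.ae_eq_zero,
    hH, hW.continuous _ hx, hz.continuous] with ω h1 h2 h3 h4 h5 h6 h7 h8 h9 h10
  refine ⟨?_, fun t ↦ ?_⟩
  · have e1 := h2 0
    have e2 := h3 0
    simp only [NNReal.coe_zero, intervalIntegral.integral_same, h4, h5, h6, h7] at e1 e2
    rw [complexState, e1, e2]
    simp
  · have hcs : Continuous fun t ↦ complexState (z t ω) j := by
      unfold complexState
      have h0 : Continuous fun t ↦ z t ω j 0 := (continuous_apply_apply j 0).comp h10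
      have h1' : Continuous fun t ↦ z t ω j 1 := (continuous_apply_apply j 1).comp h10
      fun_prop
    have hexp : Continuous fun s : ℝ ↦
        Complex.exp (Complex.I * W s.toNNReal (gridPoint a b N j) ω) := by
      have := h9.comp continuous_real_toNNReal
      simp only [Function.comp_def] at this
      fun_prop
    have hL : Continuous fun t ↦
        Complex.exp (Complex.I * W t (gridPoint a b N j) ω) * complexState (z t ω) j -
        Complex.exp (Complex.I * W 0 (gridPoint a b N j) ω) * complexState (z 0 ω) j := by
      fun_prop
    have hR : Continuous fun t : ℝ≥0 ↦ ∫ s in (0 : ℝ)..t,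
        Complex.exp (Complex.I * W s.toNNReal (gridPoint a b N j) ω) *
        (driftP (D1 α a b N) lam σ (z s.toNNReal ω) j +
          Complex.I * driftQ (D1 α a b N) lam σ (z s.toNNReal ω) j) :=
      (intervalIntegral.continuous_primitive
        (fun _ _ ↦ (hexp.mul h8).intervalIntegrable _ _) 0).comp NNReal.continuous_coe
    exact congrFun (hL.ext_on hSd hR fun T hT ↦ h1 T hT) t

end Stochastic

/-! ### Symplectic forms -/

section Forms

theorem half_wedgeMat_matM {E : Type*} [NormedAddCommGroup E] [NormedSpace ℝ E]
    (θ : Fin 4 → E →L[ℝ] ℝ) (ξ η : E) :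
    1 / 2 * wedgeMat θ matM θ ξ η = θ 0 ξ * θ 1 η - θ 0 η * θ 1 ξ := by
  simp [wedgeMat, wedge, matM, Fin.sum_univ_four]
  ring

theorem wedgeMat_matK {E : Type*} [NormedAddCommGroup E] [NormedSpace ℝ E]
    (θ ϑ : Fin 4 → E →L[ℝ] ℝ) (ξ η : E) :
    wedgeMat θ matK ϑ ξ η = -(θ 0 ξ * ϑ 2 η - θ 0 η * ϑ 2 ξ) - (θ 1 ξ * ϑ 3 η - θ 1 η * ϑ 3 ξ) +
      (θ 2 ξ * ϑ 0 η - θ 2 η * ϑ 0 ξ) + (θ 3 ξ * ϑ 1 η - θ 3 η * ϑ 1 ξ) := by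
  simp [wedgeMat, wedge, matK, Fin.sum_univ_four]
  ring

variable {N : ℕ}

/-- The identification of `(p, q)` with `p + i q`. -/
noncomputable def toComplex (N : ℕ) : Phase N →L[ℝ] (Fin N → ℂ) :=
  ContinuousLinearMap.pi fun j ↦
    Complex.ofRealCLM.comp ((ContinuousLinearMap.proj j).comp (ContinuousLinearMap.fst ℝ _ _)) +
      Complex.I • Complex.ofRealCLM.comp
        ((ContinuousLinearMap.proj j).comp (ContinuousLinearMap.snd ℝ _ _))

theorem toComplex_apply (y : Phase N) (j : Fin N) :
    toComplex N y j = y.1 j + Complex.I * y.2 j := by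
  simp [toComplex]

/-- The inverse of `toComplex`. -/
noncomputable def ofComplex (x : Fin N → ℂ) : Phase N := (fun j ↦ (x j).re, fun j ↦ (x j).im)

theorem continuous_ofComplex : Continuous (ofComplex (N := N)) := by
  unfold ofComplex
  fun_prop

theorem ofComplex_toComplex (y : Phase N) : ofComplex (toComplex N y) = y := by
  ext j <;> simp [ofComplex, toComplex_apply]

theorem toComplex_ofComplex (x : Fin N → ℂ) : toComplex N (ofComplex x) = x := by
  ext j
  rw [toComplex_apply, ofComplex, mul_comm]
  exact Complex.re_add_im (x j)

/-- The map that recovers the components of `z_j` from the gauged unknown. -/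
noncomputable def ungauge (D : Matrix (Fin N) (Fin N) ℝ) (θ : Fin N → ℝ) (U : Fin N → ℂ)
    (j : Fin N) : Fin 4 → ℝ :=
  ![(Complex.exp (-(Complex.I * θ j)) * U j).re, (Complex.exp (-(Complex.I * θ j)) * U j).im,
    ∑ k, D j k * (Complex.exp (-(Complex.I * θ k)) * U k).re,
    ∑ k, D j k * (Complex.exp (-(Complex.I * θ k)) * U k).im]

/-- Recovering `z` from the gauged unknown is real linear, so it commutes with differentiation in
the initial datum. -/
theorem hasFDerivAt_ungauge (D : Matrix (Fin N) (Fin N) ℝ) (θ : Fin N → ℝ)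
    {E : Type*} [NormedAddCommGroup E] [NormedSpace ℝ E] {G : E → Fin N → ℂ}
    {G' : E →L[ℝ] (Fin N → ℂ)} {y : E} (hG : HasFDerivAt G G' y) (j : Fin N) (c : Fin 4) :
    ∃ L : E →L[ℝ] ℝ, HasFDerivAt (fun y' ↦ ungauge D θ (G y') j c) L y ∧
      ∀ ξ, L ξ = ungauge D θ (G' ξ) j c := by
  have hc : ∀ k, HasFDerivAt (fun y' ↦ Complex.exp (-(Complex.I * θ k)) * G y' k)
      (Complex.exp (-(Complex.I * θ k)) • (ContinuousLinearMap.proj k).comp G') y := fun k ↦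
    (hasFDerivAt_pi'.1 hG k).const_mul _
  have hre := fun k ↦ Complex.reCLM.hasFDerivAt.comp y (hc k)
  have him := fun k ↦ Complex.imCLM.hasFDerivAt.comp y (hc k)
  fin_cases c
  · exact ⟨_, hre j, fun ξ ↦ by simp [ungauge]⟩
  · exact ⟨_, him j, fun ξ ↦ by simp [ungauge]⟩
  · have h : HasFDerivAt
        (fun y' ↦ ∑ k, D j k * (Complex.exp (-(Complex.I * θ k)) * G y' k).re)
        (∑ k, D j k • Complex.reCLM.comp
          (Complex.exp (-(Complex.I * θ k)) • (ContinuousLinearMap.proj k).comp G')) y :=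
      HasFDerivAt.fun_sum fun k _ ↦ (hre k).const_mul (D j k)
    exact ⟨_, h, fun ξ ↦ by simp [ungauge]⟩
  · have h : HasFDerivAt
        (fun y' ↦ ∑ k, D j k * (Complex.exp (-(Complex.I * θ k)) * G y' k).im)
        (∑ k, D j k • Complex.imCLM.comp
          (Complex.exp (-(Complex.I * θ k)) • (ContinuousLinearMap.proj k).comp G')) y :=
      HasFDerivAt.fun_sum fun k _ ↦ (him k).const_mul (D j k)
    exact ⟨_, h, fun ξ ↦ by simp [ungauge]⟩

/-- The area form of the `j`-th component of the gauged unknown. -/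
noncomputable def areaForm (x x' : ℂ) : ℝ := (conj x * x').im

/-- A rotation of the plane preserves area. This is why the noise leaves no trace in the symplectic
form. -/
theorem areaForm_exp_mul (s : ℝ) (x x' : ℂ) :
    areaForm (Complex.exp (-(Complex.I * s)) * x) (Complex.exp (-(Complex.I * s)) * x') =
      areaForm x x' := by
  have h : conj (Complex.exp (-(Complex.I * s))) * Complex.exp (-(Complex.I * s)) = 1 := by
    rw [← Complex.exp_conj, ← Complex.exp_add]
    simp
  rw [areaForm, areaForm, map_mul]
  congr 1
  linear_combination conj x * x' * h

theorem areaForm_eq (x x' : ℂ) : areaForm x x' = x.re * x'.im - x'.re * x.im := by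
  simp [areaForm, Complex.mul_im]
  ring

theorem hasDerivWithinAt_areaForm {x x' : ℝ → ℂ} {d d' : ℂ} {s : Set ℝ} {t : ℝ}
    (hx : HasDerivWithinAt x d s t) (hx' : HasDerivWithinAt x' d' s t) :
    HasDerivWithinAt (fun r ↦ areaForm (x r) (x' r)) (areaForm d (x' t) + areaForm (x t) d') s t := by
  have hre : ∀ {y : ℝ → ℂ} {e : ℂ}, HasDerivWithinAt y e s t →
      HasDerivWithinAt (fun r ↦ (y r).re) e.re s t := fun h ↦
    (Complex.reCLM.hasFDerivAt.comp_hasDerivWithinAt t h)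
  have him : ∀ {y : ℝ → ℂ} {e : ℂ}, HasDerivWithinAt y e s t →
      HasDerivWithinAt (fun r ↦ (y r).im) e.im s t := fun h ↦
    (Complex.imCLM.hasFDerivAt.comp_hasDerivWithinAt t h)
  simp only [areaForm_eq]
  exact (((hre hx).mul (him hx')).sub ((hre hx').mul (him hx))).congr_deriv (by ring)

/-- The evolution of the area form along the linearized gauged equation, in terms of the original
unknowns. -/
theorem areaForm_gaugeFieldDeriv (D : Matrix (Fin N) (Fin N) ℝ) (lam σ : ℝ) (θ : Fin N → ℝ)
    (U V V' : Fin N → ℂ) (j : Fin N) :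
    areaForm (gaugeFieldDeriv (D * D) lam σ θ U V j) (V' j) +
      areaForm (V j) (gaugeFieldDeriv (D * D) lam σ θ U V' j) =
    (ungauge D θ V j 0 * (∑ k, D j k * ungauge D θ V' k 2) -
      ungauge D θ V' j 0 * (∑ k, D j k * ungauge D θ V k 2)) +
    (ungauge D θ V j 1 * (∑ k, D j k * ungauge D θ V' k 3) -
      ungauge D θ V' j 1 * (∑ k, D j k * ungauge D θ V k 3)) := by
  set c : (Fin N → ℂ) → Fin N → ℂ := fun V k ↦ Complex.exp (-(Complex.I * θ k)) * V k with hc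
  have hVc : ∀ V k, V k = Complex.exp (Complex.I * θ k) * c V k := fun V k ↦ by
    simp only [hc]
    rw [← mul_assoc, ← Complex.exp_add, add_neg_cancel, Complex.exp_zero, one_mul]
  have hlin : ∀ V : Fin N → ℂ, Complex.exp (-(Complex.I * θ j)) *
      ∑ k, gaugeCoeff (D * D) θ j k * V k =
      Complex.I * ((∑ k, D j k * ungauge D θ V k 2 : ℝ) +
        Complex.I * (∑ k, D j k * ungauge D θ V k 3 : ℝ)) := by
    intro V
    have h1 : ∑ k, gaugeCoeff (D * D) θ j k * V k =
        Complex.exp (Complex.I * θ j) * (Complex.I * ∑ k, ((D * D) j k : ℝ) * c V k) := by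
      rw [← sum_gaugeCoeff_mul]
      exact Finset.sum_congr rfl fun k _ ↦ by rw [← hVc]
    have h2 : ∑ k, (((D * D) j k : ℝ) : ℂ) * c V k =
        (∑ k, D j k * ungauge D θ V k 2 : ℝ) + Complex.I * (∑ k, D j k * ungauge D θ V k 3 : ℝ) := by
      have h3 : ∀ k, ((ungauge D θ V k 2 : ℝ) : ℂ) + Complex.I * (ungauge D θ V k 3 : ℝ) =
          ∑ l, (D k l : ℂ) * c V l := by
        intro k
        change ((∑ l, D k l * (c V l).re : ℝ) : ℂ) + Complex.I * (∑ l, D k l * (c V l).im : ℝ) = _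
        push_cast
        rw [Finset.mul_sum, ← Finset.sum_add_distrib]
        refine Finset.sum_congr rfl fun l _ ↦ ?_
        nth_rewrite 3 [← Complex.re_add_im (c V l)]
        ring
      have h4 : ((∑ k, D j k * ungauge D θ V k 2 : ℝ) : ℂ) +
          Complex.I * (∑ k, D j k * ungauge D θ V k 3 : ℝ) =
          ∑ k, (D j k : ℂ) * ∑ l, (D k l : ℂ) * c V l := by
        simp only [← h3]
        push_cast
        rw [Finset.mul_sum, ← Finset.sum_add_distrib]
        exact Finset.sum_congr rfl fun k _ ↦ by ring
      rw [h4]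
      simp only [Matrix.mul_apply, Complex.ofReal_sum, Complex.ofReal_mul, Finset.sum_mul,
        Finset.mul_sum]
      rw [Finset.sum_comm]
      exact Finset.sum_congr rfl fun k _ ↦ Finset.sum_congr rfl fun l _ ↦ by ring
    rw [h1, h2, ← mul_assoc, ← Complex.exp_add, neg_add_cancel, Complex.exp_zero, one_mul]
  have hsub : ∀ x y x' : ℂ, areaForm (x - y) x' = areaForm x x' - areaForm y x' := by
    intro x y x'
    simp only [areaForm_eq, Complex.sub_re, Complex.sub_im]
    ring
  have hsub' : ∀ x x' y' : ℂ, areaForm x (x' - y') = areaForm x x' - areaForm x y' := by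
    intro x x' y'
    simp only [areaForm_eq, Complex.sub_re, Complex.sub_im]
    ring
  -- Pairing with `i` times a vector turns the area form into the inner product up to sign, so the
  -- two terms cancel by symmetry of the derivative.
  have hnon : areaForm (Complex.I * lam * powerNonlinDeriv σ (U j) (V j)) (V' j) +
      areaForm (V j) (Complex.I * lam * powerNonlinDeriv σ (U j) (V' j)) = 0 := by
    have := inner_powerNonlinDeriv_comm σ (U j) (V j) (V' j)
    simp only [Complex.inner, Complex.mul_re, Complex.conj_re, Complex.conj_im] at this
    simp only [areaForm_eq, Complex.mul_re, Complex.mul_im, Complex.I_re, Complex.I_im,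
      Complex.ofReal_re, Complex.ofReal_im]
    linear_combination (-lam) * this
  -- After rotating back, the linear part is `i r` with `r = D dv + i D dw`, and the area form of
  -- `x` and `i r` is the real inner product of `x` and `r`.
  have hmain : ∀ V V' : Fin N → ℂ,
      areaForm (V j) (∑ k, gaugeCoeff (D * D) θ j k * V' k) =
      ungauge D θ V j 0 * (∑ k, D j k * ungauge D θ V' k 2) +
      ungauge D θ V j 1 * (∑ k, D j k * ungauge D θ V' k 3) := by
    intro V V'
    rw [← areaForm_exp_mul (θ j), hlin V', areaForm_eq]
    change (c V j).re * _ - _ * (c V j).im = (c V j).re * _ + (c V j).im * _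
    generalize ∑ k, D j k * ungauge D θ V' k 2 = r1
    generalize ∑ k, D j k * ungauge D θ V' k 3 = r2
    simp
    ring
  have hanti : ∀ x x' : ℂ, areaForm x x' = -areaForm x' x := by
    intro x x'
    simp only [areaForm_eq]
    ring
  simp only [gaugeFieldDeriv_apply, hsub, hsub']
  rw [hanti (∑ k, gaugeCoeff (D * D) θ j k * V k) (V' j), hmain V' V, hmain V V']
  linear_combination -hnon

end Forms

/-! ### Sample paths of the phase flow -/

section Path

variable {N : ℕ} {D : Matrix (Fin N) (Fin N) ℝ} {lam σ : ℝ} {θ : ℝ → Fin N → ℝ}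
  {U : ℝ → (Fin N → ℂ) → Fin N → ℂ} {F : ℝ≥0 → Phase N → Fin N → Fin 4 → ℝ}

/-- This is the deterministic half. No regularity of `θ` beyond continuity is needed: `θ` is never
differentiated, because the form of `F` equals the area form of the derivative of the gauged flow
`U`. -/
theorem multisymplectic_of_path (hD : Dᵀ = -D) (hσ : 0 ≤ σ) (hθ : Continuous θ)
    (hU0 : ∀ x, U 0 x = x)
    (hU : ∀ x t, 0 ≤ t → HasDerivWithinAt (fun s ↦ U s x) (gaugeField (D * D) lam σ (θ t) (U t x))
      (Set.Ici 0) t)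
    (hF : ∀ (t : ℝ≥0) y j c, F t y j c = ungauge D (θ t) (U t (toComplex N y)) j c) :
    (∀ t, Differentiable ℝ (F t)) ∧
    ∀ (y ξ η : Phase N) (t : ℝ≥0),
      (∀ j : Fin N, HasDerivWithinAt (fun s : ℝ ↦ symplForm (F s.toNNReal) j y ξ η)
        (-wedgeMat (dz (F t) j y) matK (dGz D (F t) j y) ξ η) (Set.Ici 0) t) ∧
      HasDerivWithinAt (fun s : ℝ ↦ ∑ j, symplForm (F s.toNNReal) j y ξ η) 0 (Set.Ici 0) t ∧
      ∑ j, symplForm (F t) j y ξ η = ∑ j, symplForm (F 0) j y ξ η := by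
  have hB := transpose_mul_self_of_skew hD
  have hmass : ∀ x t, 0 ≤ t → ∑ j, ‖U t x j‖ ^ 2 = ∑ j, ‖x j‖ ^ 2 := fun x t ht ↦ by
    have := sum_norm_sq_eq (lam := lam) (σ := σ) hB (V := fun t ↦ U t x) (θ := θ) (hU x) ht
    rwa [hU0 x] at this
  have hflow := fun x {t : ℝ} (ht : 0 ≤ t) ↦ hasFDerivAt_flow
    (Φ := fun t ↦ gaugeField (D * D) lam σ (θ t))
    (A := fun t ↦ gaugeFieldDeriv (D * D) lam σ (θ t)) (U := U)
    (fun t x ↦ hasFDerivAt_gaugeField (D * D) lam hσ (θ t) x)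
    (continuous_gaugeFieldDeriv (D * D) lam hσ hθ) hU hU0
    (fun r ↦ ⟨√(N * r ^ 2), fun x hx t ht ↦ norm_le_of_sum_norm_sq_eq (hmass x t ht) hx⟩) x ht
  have hFd : ∀ (t : ℝ≥0) y j c, ∃ L : Phase N →L[ℝ] ℝ,
      HasFDerivAt (fun y' ↦ F t y' j c) L y ∧ ∀ ξ, L ξ =
        ungauge D (θ t) (fderiv ℝ (U t) (toComplex N y) (toComplex N ξ)) j c := by
    intro t y j c
    have h1 := ((hflow (toComplex N y) t.coe_nonneg).1.hasFDerivAt).comp y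
      (toComplex N).hasFDerivAt
    obtain ⟨L, hL, hL'⟩ := hasFDerivAt_ungauge D (θ t) h1 j c
    refine ⟨L, ?_, hL'⟩
    simpa only [hF, Function.comp_def] using hL
  have hdz : ∀ (t : ℝ≥0) y j c ξ, dz (F t) j y c ξ =
      ungauge D (θ t) (fderiv ℝ (U t) (toComplex N y) (toComplex N ξ)) j c := by
    intro t y j c ξ
    obtain ⟨L, hL, hL'⟩ := hFd t y j c
    rw [dz, hL.fderiv, hL']
  have hdGz : ∀ (t : ℝ≥0) y j c ξ, dGz D (F t) j y c ξ =
      ∑ k, D j k * ungauge D (θ t) (fderiv ℝ (U t) (toComplex N y) (toComplex N ξ)) k c := by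
    intro t y j c ξ
    simp [dGz, hdz]
  have hform : ∀ (t : ℝ≥0) j y ξ η, symplForm (F t) j y ξ η =
      areaForm (fderiv ℝ (U t) (toComplex N y) (toComplex N ξ) j)
        (fderiv ℝ (U t) (toComplex N y) (toComplex N η) j) := by
    intro t j y ξ η
    rw [symplForm, half_wedgeMat_matM, ← areaForm_exp_mul (θ t j), areaForm_eq]
    simp only [hdz]
    rfl
  have hlocal : ∀ (y ξ η : Phase N) (t : ℝ≥0) (j : Fin N),
      HasDerivWithinAt (fun s : ℝ ↦ symplForm (F s.toNNReal) j y ξ η)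
        (-wedgeMat (dz (F t) j y) matK (dGz D (F t) j y) ξ η) (Set.Ici 0) t := by
    intro y ξ η t j
    have hJ := (hflow (toComplex N y) t.coe_nonneg).2
    have hcol : ∀ ζ : Phase N, HasDerivWithinAt
        (fun s ↦ fderiv ℝ (U s) (toComplex N y) (toComplex N ζ) j)
        (gaugeFieldDeriv (D * D) lam σ (θ t) (U t (toComplex N y))
          (fderiv ℝ (U t) (toComplex N y) (toComplex N ζ)) j) (Set.Ici 0) t := by
      intro ζ
      have := hasDerivWithinAt_pi.1
        (hJ.clm_apply (hasDerivWithinAt_const (t : ℝ) _ (toComplex N ζ))) j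
      simpa using this
    have hd := hasDerivWithinAt_areaForm (hcol ξ) (hcol η)
    rw [areaForm_gaugeFieldDeriv] at hd
    have hcongr : ∀ s ∈ Set.Ici (0 : ℝ), symplForm (F s.toNNReal) j y ξ η =
        areaForm (fderiv ℝ (U s) (toComplex N y) (toComplex N ξ) j)
          (fderiv ℝ (U s) (toComplex N y) (toComplex N η) j) := by
      intro s hs
      rw [hform, Real.coe_toNNReal s hs]
    refine (hd.congr hcongr (hcongr t t.coe_nonneg)).congr_deriv ?_
    rw [wedgeMat_matK]
    simp only [hdz, hdGz]
    -- Since `D dp = dv` and `D dq = dw`, the terms `dv_j ∧ (D dp)_j` and `dw_j ∧ (D dq)_j` of the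
    -- `K`-form are wedge squares and vanish.
    have h2 : ∀ V : Fin N → ℂ, ungauge D (θ t) V j 2 = ∑ k, D j k * ungauge D (θ t) V k 0 :=
      fun V ↦ rfl
    have h3 : ∀ V : Fin N → ℂ, ungauge D (θ t) V j 3 = ∑ k, D j k * ungauge D (θ t) V k 1 :=
      fun V ↦ rfl
    rw [h2, h2, h3, h3]
    ring
  have hglobal : ∀ (y ξ η : Phase N) (t : ℝ≥0),
      HasDerivWithinAt (fun s : ℝ ↦ ∑ j, symplForm (F s.toNNReal) j y ξ η) 0 (Set.Ici 0) t := by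
    intro y ξ η t
    refine (HasDerivWithinAt.fun_sum fun j _ ↦ hlocal y ξ η t j).congr_deriv ?_
    simp only [wedgeMat_matK, hdz, hdGz]
    generalize fderiv ℝ (U t) (toComplex N y) (toComplex N ξ) = V
    generalize fderiv ℝ (U t) (toComplex N y) (toComplex N η) = V'
    -- Summation by parts: `∑ dp_j ∧ (D dv)_j = -∑ (D dp)_j ∧ dv_j = -∑ dv_j ∧ dv_j = 0`, and
    -- likewise for `q` and `w`.
    have hskew : ∀ x x' : Fin N → ℝ, ∑ j, x j * ∑ k, D j k * x' k =
        -∑ j, x' j * ∑ k, D j k * x k := by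
      intro x x'
      simp only [Finset.mul_sum]
      rw [Finset.sum_comm, ← Finset.sum_neg_distrib]
      refine Finset.sum_congr rfl fun j _ ↦ ?_
      rw [← Finset.sum_neg_distrib]
      refine Finset.sum_congr rfl fun k _ ↦ ?_
      have : D k j = -D j k := by rw [← Matrix.neg_apply, ← hD, Matrix.transpose_apply]
      rw [this]
      ring
    have h2 : ∀ V : Fin N → ℂ, ∀ j, ungauge D (θ t) V j 2 = ∑ k, D j k * ungauge D (θ t) V k 0 :=
      fun V j ↦ rfl
    have h3 : ∀ V : Fin N → ℂ, ∀ j, ungauge D (θ t) V j 3 = ∑ k, D j k * ungauge D (θ t) V k 1 :=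
      fun V j ↦ rfl
    have e1 := hskew (fun j ↦ ungauge D (θ t) V j 0) fun j ↦ ungauge D (θ t) V' j 2
    have e2 := hskew (fun j ↦ ungauge D (θ t) V' j 0) fun j ↦ ungauge D (θ t) V j 2
    have e3 := hskew (fun j ↦ ungauge D (θ t) V j 1) fun j ↦ ungauge D (θ t) V' j 3
    have e4 := hskew (fun j ↦ ungauge D (θ t) V' j 1) fun j ↦ ungauge D (θ t) V j 3
    simp only [← h2, ← h3] at e1 e2 e3 e4
    have c1 : ∑ j, ungauge D (θ t) V' j 2 * ungauge D (θ t) V j 2 =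
        ∑ j, ungauge D (θ t) V j 2 * ungauge D (θ t) V' j 2 :=
      Finset.sum_congr rfl fun j _ ↦ mul_comm _ _
    have c2 : ∑ j, ungauge D (θ t) V' j 3 * ungauge D (θ t) V j 3 =
        ∑ j, ungauge D (θ t) V j 3 * ungauge D (θ t) V' j 3 :=
      Finset.sum_congr rfl fun j _ ↦ mul_comm _ _
    simp only [← h2, ← h3, Finset.sum_neg_distrib, Finset.sum_add_distrib,
      Finset.sum_sub_distrib]
    linarith
  refine ⟨fun t ↦ ?_, fun y ξ η t ↦ ⟨hlocal y ξ η t, hglobal y ξ η t, ?_⟩⟩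
  · rw [differentiable_pi]
    intro j
    rw [differentiable_pi]
    intro c y
    obtain ⟨L, hL, -⟩ := hFd t y j c
    exact hL.differentiableAt
  · have hc := constant_of_has_deriv_right_zero (a := 0) (b := (t : ℝ))
      (f := fun s : ℝ ↦ ∑ j, symplForm (F s.toNNReal) j y ξ η) (fun s hs ↦ ?_) (fun s hs ↦ ?_) t
      ⟨t.coe_nonneg, le_rfl⟩
    · simpa using hc
    · have := (hglobal y ξ η s.toNNReal).continuousWithinAt
      rw [Real.coe_toNNReal s hs.1] at this
      exact this.mono Set.Icc_subset_Ici_self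
    · have := hglobal y ξ η s.toNNReal
      rw [Real.coe_toNNReal s hs.1] at this
      exact this.mono (Set.Ici_subset_Ici.2 hs.1)

end Path

section Flow

variable {Ω : Type*} {mΩ : MeasurableSpace Ω} {P : Measure Ω} [IsProbabilityMeasure P]
  {ℱ : Filtration ℝ≥0 mΩ} {α σ lam a b : ℝ} {N : ℕ} {β : ℕ → ℝ≥0 → Ω → ℝ} {φ : ℕ → ℝ → ℝ}
  {W : ℝ≥0 → ℝ → Ω → ℝ} {Z : ℝ≥0 → Ω → Phase N → Fin N → Fin 4 → ℝ}

/-- Almost every sample path of the phase flow is the ungauged flow of the gauged equation. -/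
theorem IsPhaseFlow.ae_exists_gauged_flow (hσ : 0 ≤ σ) (hab : a ≤ b)
    (hW : IsWienerField P ℱ a b β φ W) (hZ : IsPhaseFlow P ℱ W α σ lam a b N Z) :
    ∀ᵐ ω ∂P, ∃ (θ : ℝ → Fin N → ℝ) (U : ℝ → (Fin N → ℂ) → Fin N → ℂ), Continuous θ ∧
      (∀ x, U 0 x = x) ∧
      (∀ x t, 0 ≤ t → HasDerivWithinAt (fun s ↦ U s x)
        (gaugeField (D1 α a b N * D1 α a b N) lam σ (θ t) (U t x)) (Set.Ici 0) t) ∧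
      ∀ (t : ℝ≥0) y j c,
        Z t ω y j c = ungauge (D1 α a b N) (θ t) (U t (toComplex N y)) j c := by
  -- Each initial datum has its own null set on which the system may fail. A countable dense set of
  -- data leaves a single one; continuity in the datum does the rest.
  obtain ⟨S, hSc, hSd⟩ := TopologicalSpace.exists_countable_dense (Phase N)
  have hcW : ∀ᵐ ω ∂P, ∀ j : Fin N, Continuous fun t ↦ W t (gridPoint a b N j) ω :=
    ae_all_iff.2 fun j ↦ hW.continuous _ (gridPoint_mem_Icc hab j)
  have hcz := (ae_ball_iff hSc).2 fun y _ ↦ (hZ.solution y).continuous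
  have hv := (ae_ball_iff hSc).2 fun y _ ↦ (hZ.solution y).eq_v
  have hw := (ae_ball_iff hSc).2 fun y _ ↦ (hZ.solution y).eq_w
  have he := (ae_ball_iff hSc).2 fun y _ ↦
    ae_all_iff.2 fun j ↦ (hZ.solution y).ae_exp_mul_eq hσ hab hW j
  filter_upwards [hcW, hcz, hv, hw, he, hZ.continuous] with ω hcW hcz hv hw he hZc
  have hZc' : ∀ t k c, Continuous fun y ↦ Z t ω y k c := fun t k c ↦
    (continuous_apply_apply k c).comp (hZc t)
  have hmul : ∀ t j c, Continuous fun y ↦ (D1 α a b N *ᵥ fun k ↦ Z t ω y k c) j := by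
    intro t j c
    simp only [Matrix.mulVec, dotProduct]
    exact continuous_finsetSum _ fun k _ ↦ (hZc' t k c).const_mul _
  have hv' : ∀ t j y, (D1 α a b N *ᵥ fun k ↦ Z t ω y k 0) j = Z t ω y j 2 := fun t j y ↦
    congrFun ((hmul t j 0).ext_on hSd (hZc' t j 2) fun y hy ↦ hv y hy t j) y
  have hw' : ∀ t j y, (D1 α a b N *ᵥ fun k ↦ Z t ω y k 1) j = Z t ω y j 3 := fun t j y ↦
    congrFun ((hmul t j 1).ext_on hSd (hZc' t j 3) fun y hy ↦ hw y hy t j) y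
  -- Subtracting the value at time `0` gives `θ 0 = 0`, so the gauged flow starts at the identity
  -- and no normalization of `W` is needed.
  let θ : ℝ → Fin N → ℝ := fun t j ↦
    W t.toNNReal (gridPoint a b N j) ω - W 0 (gridPoint a b N j) ω
  let U : ℝ → (Fin N → ℂ) → Fin N → ℂ := fun t x j ↦
    Complex.exp (Complex.I * θ t j) * complexState (Z t.toNNReal ω (ofComplex x)) j
  have hθ : Continuous θ := continuous_pi fun j ↦
    ((hcW j).comp continuous_real_toNNReal).sub continuous_const
  have hθj : ∀ j, Continuous fun t ↦ θ t j := fun j ↦ (continuous_apply j).comp hθ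
  have hUc : ∀ t, 0 ≤ t → Continuous (U t) := fun t _ ↦ continuous_pi fun j ↦ by
    have h0 := (hZc' t.toNNReal j 0).comp continuous_ofComplex
    have h1 := (hZc' t.toNNReal j 1).comp continuous_ofComplex
    exact continuous_const.mul ((Complex.continuous_ofReal.comp h0).add
      (continuous_const.mul (Complex.continuous_ofReal.comp h1)))
  have hdense : Dense (toComplex N '' S) :=
    (Function.Surjective.denseRange fun x ↦ ⟨ofComplex x, toComplex_ofComplex x⟩).dense_image
      (toComplex N).continuous hSd
  have hcont : ∀ x ∈ toComplex N '' S, ContinuousOn (fun t ↦ U t x) (Set.Ici 0) := by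
    rintro _ ⟨y, hy, rfl⟩
    refine (continuous_pi fun j ↦ ?_).continuousOn
    have hc : ∀ c, Continuous fun t : ℝ ↦ Z t.toNNReal ω y j c := fun c ↦
      (continuous_apply_apply j c).comp ((hcz y hy).comp continuous_real_toNNReal)
    simp only [U, ofComplex_toComplex, complexState]
    exact (Complex.continuous_exp.comp (continuous_const.mul
      (Complex.continuous_ofReal.comp (hθj j)))).mul
      ((Complex.continuous_ofReal.comp (hc 0)).add
        (continuous_const.mul (Complex.continuous_ofReal.comp (hc 1))))
  have hexp : ∀ t j, Complex.exp (Complex.I * θ t j) =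
      Complex.exp (-(Complex.I * W 0 (gridPoint a b N j) ω)) *
        Complex.exp (Complex.I * W t.toNNReal (gridPoint a b N j) ω) := by
    intro t j
    rw [← Complex.exp_add]
    congr 1
    simp only [θ]
    push_cast
    ring
  have heq : ∀ x ∈ toComplex N '' S, ∀ t, 0 ≤ t → ∀ j, U t x j = x j +
      ∫ s in (0 : ℝ)..t, gaugeField (D1 α a b N * D1 α a b N) lam σ (θ s) (U s x) j := by
    rintro _ ⟨y, hy, rfl⟩ t ht j
    lift t to ℝ≥0 using ht
    obtain ⟨h0, h1⟩ := he y hy j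
    have hint : ∀ s : ℝ,
        gaugeField (D1 α a b N * D1 α a b N) lam σ (θ s) (U s (toComplex N y)) j =
        Complex.exp (-(Complex.I * W 0 (gridPoint a b N j) ω)) *
          (Complex.exp (Complex.I * W s.toNNReal (gridPoint a b N j) ω) *
            (driftP (D1 α a b N) lam σ (Z s.toNNReal ω y) j +
              Complex.I * driftQ (D1 α a b N) lam σ (Z s.toNNReal ω y) j)) := by
      intro s
      rw [← mul_assoc, ← hexp, exp_mul_drift_eq _ lam σ (θ s) (fun j ↦ hv' s.toNNReal j y)
        (fun j ↦ hw' s.toNNReal j y)]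
      simp only [U, ofComplex_toComplex]
    have hone : Complex.exp (-(Complex.I * W 0 (gridPoint a b N j) ω)) *
        Complex.exp (Complex.I * W 0 (gridPoint a b N j) ω) = 1 := by
      rw [← Complex.exp_add, neg_add_cancel, Complex.exp_zero]
    simp only [hint]
    rw [intervalIntegral.integral_const_mul, ← h1 t, toComplex_apply, ← h0]
    simp only [U, ofComplex_toComplex, hexp, Real.toNNReal_coe]
    linear_combination complexState (Z 0 ω y) j * hone
  have hsol := gaugeField_solution_of_dense
    (transpose_mul_self_of_skew (D1_transpose α a b N)) hσ hθ hUc hdense hcont heq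
  refine ⟨θ, U, hθ, fun x ↦ (hsol x).1, fun x ↦ (hsol x).2, fun t y j c ↦ ?_⟩
  have hcs : ∀ k, Complex.exp (-(Complex.I * θ t k)) * U t (toComplex N y) k =
      complexState (Z t ω y) k := by
    intro k
    simp only [U, ofComplex_toComplex, Real.toNNReal_coe]
    rw [← mul_assoc, ← Complex.exp_add, neg_add_cancel, Complex.exp_zero, one_mul]
  have hre : ∀ k, (complexState (Z t ω y) k).re = Z t ω y k 0 := fun k ↦ by simp [complexState]
  have him : ∀ k, (complexState (Z t ω y) k).im = Z t ω y k 1 := fun k ↦ by simp [complexState]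
  simp only [ungauge, hcs, hre, him]
  fin_cases c
  · rfl
  · rfl
  · exact (hv' t j y).symm
  · exact (hw' t j y).symm

end Flow

end StochFracNLS

theorem mainTheorem8 {Ω : Type*} {mΩ : MeasurableSpace Ω} (P : Measure Ω) [IsProbabilityMeasure P]
    (ℱ : Filtration ℝ≥0 mΩ)
    (α σ lam a b : ℝ) (hα₀ : 1 / 2 < α) (hα₁ : α < 1) (hσ : 0 ≤ σ) (hlam : lam = 1 ∨ lam = -1)
    (hab : a < b) (N : ℕ) (hN : 0 < N) (hN_even : Even N)
    (β : ℕ → ℝ≥0 → Ω → ℝ) (φ : ℕ → ℝ → ℝ) (W : ℝ≥0 → ℝ → Ω → ℝ)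
    (hW : StochFracNLS.IsWienerField P ℱ a b β φ W)
    (Z : ℝ≥0 → Ω → StochFracNLS.Phase N → Fin N → Fin 4 → ℝ)
    (hZ : StochFracNLS.IsPhaseFlow P ℱ W α σ lam a b N Z) :
    (StochFracNLS.D1 α a b N)ᵀ = -StochFracNLS.D1 α a b N ∧
    ∀ᵐ ω ∂P,
      (∀ t, Differentiable ℝ (Z t ω)) ∧
      ∀ (y ξ η : StochFracNLS.Phase N) (t : ℝ≥0),
        (∀ j : Fin N, HasDerivWithinAt
          (fun s : ℝ ↦ StochFracNLS.symplForm (Z s.toNNReal ω) j y ξ η)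
          (-StochFracNLS.wedgeMat (StochFracNLS.dz (Z t ω) j y) StochFracNLS.matK
            (StochFracNLS.dGz (StochFracNLS.D1 α a b N) (Z t ω) j y) ξ η)
          (Set.Ici 0) t) ∧
        HasDerivWithinAt
          (fun s : ℝ ↦ ∑ j, StochFracNLS.symplForm (Z s.toNNReal ω) j y ξ η) 0 (Set.Ici 0) t ∧
        ∑ j, StochFracNLS.symplForm (Z t ω) j y ξ η =
          ∑ j, StochFracNLS.symplForm (Z 0 ω) j y ξ η := by
  refine ⟨StochFracNLS.D1_transpose α a b N, ?_⟩
  filter_upwards [hZ.ae_exists_gauged_flow hσ hab.le hW] with ω ⟨θ, U, hθ, hU0, hU, hF⟩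
  exact StochFracNLS.multisymplectic_of_path (F := fun t ↦ Z t ω)
    (StochFracNLS.D1_transpose α a b N) hσ hθ hU0 hU hF
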